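/- Let $C$ be a finite irreducible Coxeter group with Coxeter generators $s_1,\dots,s_n$, i.e. $C$ is a finite group with presentation $\langle s_1,\dots,s_n \mid (s_is_j)^{m_{ij}}=1\rangle$, where $m_{ii}=1$, $m_{ij}=m_{ji}\ge 2$ for $i\ne j$, and the Coxeter graph (the vertices $i\neq j$ are joined if and only if $m_{ij}\ge 3$) is connected. The type of $C$ is the isomorphism type of its labelled Coxeter graph. A parabolic subgroup of $C$ is a conjugate of a subgroup $\langle s_i \mid i\in I\rangle$ with $I\subseteq\{1,\dots,n\}$. Then there exist a proper parabolic subgroup $P$ of $C$ and elements $x,y,z\in C$ with $$C=(xPx^{-1})(yPy^{-1})(zPz^{-1})$$ if and only if $C$ is of one of the types $A_n$ ($n\ge 2$), $B_n$ ($n\ge 3$), $D_n$ ($n\ge 4$), $H_4$, $E_6$, $E_7$, $E_8$. In particular, if $C$ is of one of the remaining types $A_1$, $B_2$, $F_4$, $H_3$ or $I_2(m)$ with $m>4$, then $C$ is not a product of three conjugates of a proper parabolic subgroup. -/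

import Mathlib

open scoped Pointwise

namespace CoxeterMatrix

/-- The Coxeter graph of a Coxeter matrix (without its labels): distinct vertices `i`, `j` are
joined when `m i j ≠ 2`, that is, when `m i j ≥ 3` or `m i j = ∞` (encoded in Mathlib by `0`). -/
def coxeterGraph {B : Type*} (M : CoxeterMatrix B) : SimpleGraph B where
  Adj i j := i ≠ j ∧ M i j ≠ 2
  symm := ⟨fun i j h => ⟨h.1.symm, by rw [M.symmetric j i]; exact h.2⟩⟩
  loopless := ⟨fun _ h => h.1 rfl⟩

/-- A Coxeter matrix is irreducible when its Coxeter graph is connected (so it is nonempty). -/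
def IsIrreducible {B : Type*} (M : CoxeterMatrix B) : Prop :=
  M.coxeterGraph.Connected

/-- `M` has the type of `N`: the two agree after a bijective renaming of the generators, i.e.
their labelled Coxeter graphs are isomorphic. -/
def IsOfType {B B' : Type*} (M : CoxeterMatrix B) (N : CoxeterMatrix B') : Prop :=
  ∃ e : B ≃ B', M.reindex e = N

/-- The Coxeter matrix of type `D n` (used for `n ≥ 4`). Its Coxeter graph is the path
`1 - 2 - ⋯ - (n - 1)` together with one more vertex `0` joined to the vertex `2`; no edge
has a label. (In `CoxeterMatrix.D` the two end vertices of the fork are joined to each other,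
so that matrix is not the one of type `D n`.) -/
def typeD (n : ℕ) : CoxeterMatrix (Fin n) where
  M := Matrix.of fun i j : Fin n ↦
    if i = j then 1
    else if (1 ≤ (i : ℕ) ∧ (i : ℕ) + 1 = j) ∨ (1 ≤ (j : ℕ) ∧ (j : ℕ) + 1 = i) ∨
        ((i : ℕ) = 0 ∧ (j : ℕ) = 2) ∨ ((j : ℕ) = 0 ∧ (i : ℕ) = 2) then 3
    else 2
  isSymm := by
    ext i j
    simp only [Matrix.transpose_apply, Matrix.of_apply]
    split_ifs <;> grind
  diagonal := by simp
  off_diagonal i j h := by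
    simp only [Matrix.of_apply]
    split_ifs <;> grind

/-- The Coxeter matrix of type `I₂(m)`, `m ≥ 2`: two vertices, joined by an edge labelled `m`.
(`CoxeterMatrix.I k` is the one whose label is `k + 2`.) -/
def typeI₂ (m : ℕ) : CoxeterMatrix (Fin 2) :=
  CoxeterMatrix.I (m - 2)

/-- The types for which a factorization exists. -/
def IsFactorizableType {B : Type*} (M : CoxeterMatrix B) : Prop :=
  (∃ n : ℕ, 2 ≤ n ∧ M.IsOfType (CoxeterMatrix.A n)) ∨
  (∃ n : ℕ, 3 ≤ n ∧ M.IsOfType (CoxeterMatrix.B n)) ∨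
  (∃ n : ℕ, 4 ≤ n ∧ M.IsOfType (typeD n)) ∨
  M.IsOfType H₄ ∨ M.IsOfType E₆ ∨ M.IsOfType E₇ ∨ M.IsOfType E₈

/-- The remaining types `A₁`, `B₂`, `F₄`, `H₃` and `I₂(m)` with `m > 4`. -/
def IsRemainingType {B : Type*} (M : CoxeterMatrix B) : Prop :=
  M.IsOfType (CoxeterMatrix.A 1) ∨ M.IsOfType (CoxeterMatrix.B 2) ∨
  M.IsOfType F₄ ∨ M.IsOfType H₃ ∨
  (∃ m : ℕ, 4 < m ∧ M.IsOfType (typeI₂ m))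

end CoxeterMatrix

namespace CoxeterSystem

/-- The standard parabolic subgroup generated by the simple reflections `s i`, `i ∈ I`. -/
def standardParabolic {B W : Type*} [Group W] {M : CoxeterMatrix B} (cs : CoxeterSystem M W)
    (I : Set B) : Subgroup W :=
  Subgroup.closure (cs.simple '' I)

/-- A parabolic subgroup is a conjugate `g W_I g⁻¹` of a standard parabolic subgroup. -/
def IsParabolic {B W : Type*} [Group W] {M : CoxeterMatrix B} (cs : CoxeterSystem M W)
    (P : Subgroup W) : Prop :=
  ∃ (I : Set B) (g : W), P = MulAut.conj g • cs.standardParabolic I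

end CoxeterSystem

/-- The group `G` is the setwise product of three conjugates of its subgroup `A`. -/
def IsProductOfThreeConjugates {G : Type*} [Group G] (A : Subgroup G) : Prop :=
  ∃ x y z : G,
    ((MulAut.conj x • A : Subgroup G) : Set G) * ((MulAut.conj y • A : Subgroup G) : Set G) *
      ((MulAut.conj z • A : Subgroup G) : Set G) = Set.univ

/-! The form of the geometric representation of a finite irreducible Coxeter group is positive
definite: averaging yields an invariant inner product, and connectedness of the graph gives all
simple roots the same length (`geomCartan_posDef`). Connected positive definite graphs are
classified in `IsPosDef.classification`, so every type is either factorizable or remaining. It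
therefore suffices to produce factorizations for the first list and to exclude them for the second.

The factorizations all have the form `C = P (g P g⁻¹) P` with `P` a maximal standard parabolic
subgroup. For `A`, `B` and `D` the action on `C/P` is modelled on permutations of points, or on
signed permutations of the vectors `±eᵢ`, and `P` has only two or three double cosets. With `g = s`
the reflection outside `P` and `t ∈ P` a neighbour of `s`, the coset `P s P` is reached because `s =
t (s t s) t`; the third coset is represented by some `s w s` with `w ∈ P`. The double cosets are
found by adding one generator at a time (`IsRankTwo.step`, `IsRankThree.step`). For `E₆`, `E₇`, `E₈`
and `H₄` the subgroup `P` is the stabilizer of a dominant root `θ`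
(`mem_standardParabolic_of_geomRep_eq`), and the factorization says that the `P`-orbits of the
vectors `g q g⁻¹ θ`, `q ∈ P`, cover the orbit of `θ`. This is a finite computation
(`hasFactorization_of_reachIsClosed`).

For the exclusions, `P` may be enlarged to a maximal standard parabolic subgroup, and the product
becomes `C = P g P k P`. For `A₁` this is a single element, for `I₂(m)` it has at most eight
elements, and for `B₂` a sign character trivial on `P` would be constant. For `H₃` and `F₄` let `v`
be fixed by `P`, with `-v` in its orbit. Applying the factorization to `1` and to an element that
sends `v` to `-v` forces `g⁻¹ v` and `k v` to be orthogonal to `v`. Applying it to the remaining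
simple reflection `s` then gives two orbit vectors orthogonal to `v` whose product is that of `v`
and `s v`; an enumeration of the orbit finds no such pair. -/

namespace CoxeterMatrix

/-! ### The geometric representation and its positive definiteness. -/

variable {B : Type*} (M : CoxeterMatrix B)

/-- The Cartan-type matrix `-2 cos (π / m i j)` of the geometric representation. -/
noncomputable def geomCartan (i j : B) : ℝ := -(2 * Real.cos (Real.pi / M i j))

theorem geomCartan_self (i : B) : M.geomCartan i i = 2 := by
  simp [geomCartan]

theorem geomCartan_symm (i j : B) : M.geomCartan i j = M.geomCartan j i := by
  rw [geomCartan, geomCartan, M.symmetric]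

variable [Fintype B]

/-- The coroot functional `x ↦ 2 (x, α i)` of the geometric representation. -/
noncomputable def geomCoroot (i : B) : Module.Dual ℝ (B → ℝ) :=
  ∑ j, M.geomCartan i j • LinearMap.proj j

theorem geomCoroot_apply (i : B) (x : B → ℝ) :
    M.geomCoroot i x = ∑ j, M.geomCartan i j * x j := by
  simp [geomCoroot]

variable [DecidableEq B]

theorem geomCoroot_single (i j : B) : M.geomCoroot i (Pi.single j 1) = M.geomCartan i j := by
  simp [geomCoroot_apply, Pi.single_apply]

theorem geomCoroot_single_self (i : B) : M.geomCoroot i (Pi.single i 1) = 2 := by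
  rw [geomCoroot_single, geomCartan_self]

/-- The simple reflections of the geometric representation. -/
noncomputable def geomReflection (i : B) : (B → ℝ) ≃ₗ[ℝ] (B → ℝ) :=
  Module.reflection (M.geomCoroot_single_self i)

theorem geomReflection_apply (i : B) (x : B → ℝ) :
    M.geomReflection i x = x - M.geomCoroot i x • Pi.single i 1 :=
  Module.reflection_apply _ _

/-- The product of two simple reflections acts on their plane as a rotation by `φ = 2π/m`. Its
powers have Chebyshev polynomials in `2 cos φ` as coefficients, and these are evaluated by `S k *
sin φ = sin ((k + 1) φ)`. -/
theorem geomReflection_isLiftable : M.IsLiftable M.geomReflection := by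
  intro i j
  by_cases hij : i = j
  · subst hij
    rw [M.diagonal, pow_one]
    ext1 x
    exact Module.involutive_reflection (M.geomCoroot_single_self i) x
  set m := M i j with hm
  rcases Nat.eq_zero_or_pos m with h0 | hpos
  · rw [h0, pow_zero]
  have hm2 : 2 ≤ m := by
    have := M.off_diagonal i j hij
    omega
  -- Here `φ = π` and `sin φ = 0`, so the Chebyshev identity gives nothing; the two reflections
  -- simply commute.
  by_cases hm3 : m = 2
  · have h0 : M.geomCartan i j = 0 := by
      rw [geomCartan, ← hm, hm3]
      simp
    rw [hm3, pow_two]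
    ext1 z
    simp only [LinearEquiv.mul_apply, geomReflection_apply, map_sub, map_smul, geomCoroot_single,
      geomCartan_self, M.geomCartan_symm j i, h0, LinearEquiv.coe_one, id]
    module
  ext1 z
  rw [geomReflection, geomReflection, Module.reflection_mul_reflection_pow_apply _ _ m z
    (2 * Real.cos (2 * (Real.pi / m)))
    (by rw [geomCoroot_single, geomCoroot_single, M.geomCartan_symm j i, geomCartan, ← hm,
          Real.cos_two_mul]; ring)]
  set φ : ℝ := 2 * (Real.pi / m) with hφ
  have hmR : (m : ℝ) ≠ 0 := by positivity
  set S : ℤ → ℝ := fun k => (Polynomial.Chebyshev.S ℝ k).eval (2 * Real.cos φ) with hS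
  have key : ∀ k : ℤ, S k * Real.sin φ = Real.sin ((k + 1) * φ) := fun k =>
    Polynomial.Chebyshev.S_two_mul_real_cos φ k
  -- These are the coefficients by which the `m`-th power differs from the identity. With rounded
  -- division, `S (k - 1) = 0` kills both when `m = 2k`, and `S k + S (k - 1) = 0` does so when `m =
  -- 2k + 1`.
  obtain ⟨e1, e2⟩ : S (((m : ℤ) - 2) / 2) * (S (((m : ℤ) - 1) / 2) + S (((m : ℤ) - 3) / 2)) = 0 ∧
      S (((m : ℤ) - 1) / 2) * (S ((m : ℤ) / 2) + S (((m : ℤ) - 2) / 2)) = 0 := by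
    rcases Nat.even_or_odd' m with ⟨k, hk | hk⟩
    · have hk1 : k ≠ 1 := by
        rintro rfl
        exact hm3 hk
      have hsin : Real.sin φ ≠ 0 := by
        apply ne_of_gt
        have hk2 : (2 : ℝ) ≤ k := by exact_mod_cast (by omega : 2 ≤ k)
        apply Real.sin_pos_of_pos_of_lt_pi
        · positivity
        · rw [hφ, hk]
          push_cast
          rw [← mul_div_assoc, mul_div_mul_left _ _ two_ne_zero, div_lt_iff₀ (by linarith)]
          nlinarith [Real.pi_pos]
      have hz : S ((k : ℤ) - 1) = 0 := by
        have := key ((k : ℤ) - 1)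
        rw [show (((k : ℤ) - 1 : ℤ) : ℝ) + 1 = k by push_cast; ring,
          show (k : ℝ) * φ = Real.pi by
            rw [hφ, hk]; push_cast
            have : (k : ℝ) ≠ 0 := by
              intro h; apply hmR; rw [hk]; push_cast; rw [h]; ring
            field_simp, Real.sin_pi] at this
        exact (mul_eq_zero.mp this).resolve_right hsin
      rw [show ((m : ℤ) - 2) / 2 = k - 1 by omega, show ((m : ℤ) - 1) / 2 = k - 1 by omega, hz]
      simp
    · have hk1 : 1 ≤ k := by omega
      have hsin : Real.sin φ ≠ 0 := by
        apply ne_of_gt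
        have hk2 : (1 : ℝ) ≤ k := by exact_mod_cast hk1
        apply Real.sin_pos_of_pos_of_lt_pi
        · positivity
        · rw [hφ, hk]
          push_cast
          rw [← mul_div_assoc, div_lt_iff₀ (by linarith)]
          nlinarith [Real.pi_pos]
      have hz : S (k : ℤ) + S ((k : ℤ) - 1) = 0 := by
        have h1 := key (k : ℤ)
        have h2 := key ((k : ℤ) - 1)
        have hsum : (((k : ℤ) : ℝ) + 1) * φ = 2 * Real.pi - ((((k : ℤ) - 1 : ℤ) : ℝ) + 1) * φ := by
          have : (m : ℝ) * φ = 2 * Real.pi := by rw [hφ]; field_simp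
          rw [hk] at this
          push_cast at this ⊢
          linarith
        rw [hsum, Real.sin_two_pi_sub, ← h2] at h1
        have : (S (k : ℤ) + S ((k : ℤ) - 1)) * Real.sin φ = 0 := by linarith
        exact (mul_eq_zero.mp this).resolve_right hsin
      rw [show ((m : ℤ) - 2) / 2 = k - 1 by omega, show ((m : ℤ) - 1) / 2 = k by omega,
        show ((m : ℤ) - 3) / 2 = k - 1 by omega, show (m : ℤ) / 2 = k by omega, hz]
      simp
  simp only [hS] at e1 e2
  rw [e1, e2]
  simp

end CoxeterMatrix

namespace CoxeterSystem

variable {B W : Type*} [Fintype B] [DecidableEq B] [Group W] {M : CoxeterMatrix B}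
  (cs : CoxeterSystem M W)

/-- The geometric representation of a Coxeter group. -/
noncomputable def geomRep : W →* ((B → ℝ) ≃ₗ[ℝ] (B → ℝ)) :=
  cs.lift ⟨M.geomReflection, M.geomReflection_isLiftable⟩

theorem geomRep_simple (i : B) : cs.geomRep (cs.simple i) = M.geomReflection i :=
  cs.lift_apply_simple _ i

theorem geomRep_simple_apply (i : B) (x : B → ℝ) :
    cs.geomRep (cs.simple i) x = x - M.geomCoroot i x • Pi.single i 1 := by
  rw [geomRep_simple, M.geomReflection_apply]

/-- The form of the geometric representation of a finite irreducible Coxeter group is positive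
definite. -/
theorem geomCartan_posDef (cs : CoxeterSystem M W) [Finite W] (hM : M.IsIrreducible)
    {x : B → ℝ} (hx : x ≠ 0) :
    0 < ∑ i, ∑ j, M.geomCartan i j * x i * x j := by
  have := Fintype.ofFinite W
  -- The standard dot product summed over the group. Each simple reflection is orthogonal for it,
  -- which determines `ip x (Pi.single i 1)` up to the length of the simple root.
  let ip : (B → ℝ) → (B → ℝ) → ℝ := fun x y => ∑ w, ∑ k, cs.geomRep w x k * cs.geomRep w y k
  have ip_def : ∀ x y, ip x y = ∑ w, ∑ k, cs.geomRep w x k * cs.geomRep w y k := fun _ _ => rfl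
  have inv : ∀ u x y, ip (cs.geomRep u x) (cs.geomRep u y) = ip x y := by
    intro u x y
    simp only [ip_def]
    refine Fintype.sum_equiv (Equiv.mulRight u) _ _ fun w => ?_
    simp [map_mul, LinearEquiv.mul_apply]
  have sub_left : ∀ (x y z : B → ℝ) (c : ℝ), ip (x - c • y) z = ip x z - c * ip y z := by
    intro x y z c
    simp only [ip_def, map_sub, map_smul, Pi.sub_apply, Pi.smul_apply, smul_eq_mul, sub_mul,
      Finset.sum_sub_distrib, Finset.mul_sum, mul_assoc]
  have comm : ∀ x y, ip x y = ip y x := by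
    intro x y
    simp only [ip_def, mul_comm]
  have pos : ∀ x, x ≠ 0 → 0 < ip x x := by
    intro x hx
    refine Finset.sum_pos' (fun w _ => Finset.sum_nonneg fun k _ => mul_self_nonneg _)
      ⟨1, Finset.mem_univ _, ?_⟩
    obtain ⟨k, hk⟩ := Function.ne_iff.mp hx
    refine Finset.sum_pos' (fun k _ => mul_self_nonneg _) ⟨k, Finset.mem_univ _, ?_⟩
    simpa using mul_self_pos.mpr hk
  have e_ne : ∀ i : B, (Pi.single i 1 : B → ℝ) ≠ 0 := fun i h => by
    simpa using congrFun h i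
  have refl : ∀ x i, 2 * ip x (Pi.single i 1) =
      M.geomCoroot i x * ip (Pi.single i 1) (Pi.single i 1) := by
    intro x i
    have h := inv (cs.simple i) x (Pi.single i 1)
    rw [geomRep_simple_apply, geomRep_simple_apply, M.geomCoroot_single_self, sub_left, comm x,
      comm (Pi.single i 1) (_ - _), sub_left, sub_left, comm _ x] at h
    linarith
  have d_symm : ∀ i j, M.geomCartan i j * ip (Pi.single i 1) (Pi.single i 1) =
      M.geomCartan i j * ip (Pi.single j 1) (Pi.single j 1) := by
    intro i j
    have h1 := refl (Pi.single j 1) i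
    have h2 := refl (Pi.single i 1) j
    rw [M.geomCoroot_single] at h1 h2
    rw [← h1, M.geomCartan_symm i j, ← h2, comm]
  -- Evaluating `ip` on two simple roots in both ways compares their lengths wherever the Cartan
  -- entry is nonzero, that is, along edges. Connectedness then makes `ip` a constant multiple of
  -- the form.
  have d_adj : ∀ i j, M.coxeterGraph.Adj i j →
      ip (Pi.single i 1) (Pi.single i 1) = ip (Pi.single j 1) (Pi.single j 1) := by
    intro i j hij
    refine mul_left_cancel₀ ?_ (d_symm i j)
    have h1 := M.off_diagonal i j hij.1
    have h2 : M i j ≠ 2 := hij.2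
    rw [CoxeterMatrix.geomCartan]
    rcases Nat.eq_zero_or_pos (M i j) with h0 | hpos
    · simp [h0]
    · have h3 : (3 : ℝ) ≤ M i j := by exact_mod_cast (by omega : 3 ≤ M i j)
      have : 0 < Real.cos (Real.pi / M i j) := by
        apply Real.cos_pos_of_mem_Ioo
        constructor
        · have : 0 < Real.pi / M i j := div_pos Real.pi_pos (by linarith)
          linarith [Real.pi_pos]
        · rw [div_lt_iff₀ (by linarith)]
          nlinarith [Real.pi_pos]
      linarith
  obtain ⟨i₀⟩ := hM.nonempty
  have d_const : ∀ i, ip (Pi.single i 1) (Pi.single i 1) =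
      ip (Pi.single i₀ 1) (Pi.single i₀ 1) := by
    intro i
    obtain ⟨p⟩ := hM.preconnected i i₀
    induction p with
    | nil => rfl
    | cons h _ ih => exact (d_adj _ _ h).trans ih
  have expand : 2 * ip x x = (∑ i, ∑ j, M.geomCartan i j * x i * x j) *
      ip (Pi.single i₀ 1) (Pi.single i₀ 1) := by
    have h1 : ip x x = ∑ i, x i * ip x (Pi.single i 1) := by
      conv_lhs => rw [comm]
      have : ∀ y : B → ℝ, ip y x = ∑ i, y i * ip (Pi.single i 1) x := by
        intro y
        simp only [ip_def, Finset.mul_sum]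
        symm
        rw [Finset.sum_comm]
        refine Finset.sum_congr rfl fun w _ => ?_
        rw [Finset.sum_comm]
        refine Finset.sum_congr rfl fun k _ => ?_
        have hy : y = ∑ i, y i • (Pi.single i 1 : B → ℝ) := by
          ext
          simp [Finset.sum_apply, Pi.single_apply]
        conv_rhs => rw [hy, map_sum, Finset.sum_apply, Finset.sum_mul]
        refine Finset.sum_congr rfl fun i _ => ?_
        rw [map_smul, Pi.smul_apply, smul_eq_mul, mul_assoc]
      rw [this]
      exact Finset.sum_congr rfl fun i _ => by rw [comm]
    rw [h1, Finset.mul_sum, Finset.sum_mul]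
    refine Finset.sum_congr rfl fun i _ => ?_
    have hi : x i * M.geomCoroot i x = ∑ j, M.geomCartan i j * x i * x j := by
      rw [M.geomCoroot_apply, Finset.mul_sum]
      exact Finset.sum_congr rfl fun j _ => by ring
    rw [mul_left_comm, refl, d_const i, ← mul_assoc, hi]
  have hp := pos x hx
  by_contra hneg
  nlinarith [pos _ (e_ne i₀)]

end CoxeterSystem

/-! ### Numerical bounds around connected vertex sets. -/

namespace CoxeterMatrix

variable {B : Type*} (M : CoxeterMatrix B)

theorem three_le_of_ne {i j : B} (hij : i ≠ j) (h2 : M i j ≠ 2) : M i j = 0 ∨ 3 ≤ M i j := by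
  have := M.off_diagonal i j hij
  omega

theorem geomCartan_of_eq_two {i j : B} (h : M i j = 2) : M.geomCartan i j = 0 := by
  simp [geomCartan, h]

theorem geomCartan_of_eq_three {i j : B} (h : M i j = 3) : M.geomCartan i j = -1 := by
  rw [geomCartan, h]
  simp [Real.cos_pi_div_three]

theorem geomCartan_of_eq_zero {i j : B} (h : M i j = 0) : M.geomCartan i j = -2 := by
  simp [geomCartan, h]

/-- `cos (π / m)` is monotone in `m`, with `m = 0` standing for infinity. -/
theorem cos_pi_div_le {k m : ℕ} (hk : 1 ≤ k) (h : m = 0 ∨ k ≤ m) :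
    Real.cos (Real.pi / k) ≤ Real.cos (Real.pi / m) := by
  have hk' : (1 : ℝ) ≤ k := by exact_mod_cast hk
  rcases h with rfl | h
  · simpa using Real.cos_le_one _
  have hm : (k : ℝ) ≤ m := by exact_mod_cast h
  apply Real.cos_le_cos_of_nonneg_of_le_pi
  · positivity
  · exact div_le_self Real.pi_pos.le hk'
  · exact div_le_div_of_nonneg_left Real.pi_pos.le (by linarith) hm

theorem geomCartan_nonpos {i j : B} (hij : i ≠ j) : M.geomCartan i j ≤ 0 := by
  by_cases h2 : M i j = 2
  · rw [M.geomCartan_of_eq_two h2]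
  have := cos_pi_div_le (k := 2) (m := M i j) (by norm_num)
    ((M.three_le_of_ne hij h2).imp_right (by omega))
  norm_num at this
  rw [geomCartan]
  linarith

theorem geomCartan_le_neg_one {i j : B} (hij : i ≠ j) (h2 : M i j ≠ 2) :
    M.geomCartan i j ≤ -1 := by
  have := cos_pi_div_le (k := 3) (m := M i j) (by norm_num) (M.three_le_of_ne hij h2)
  norm_num at this
  rw [geomCartan]
  linarith

theorem two_le_geomCartan_sq {i j : B} (h : M i j = 0 ∨ 4 ≤ M i j) :
    2 ≤ M.geomCartan i j ^ 2 := by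
  have := cos_pi_div_le (k := 4) (m := M i j) (by norm_num) h
  norm_num at this
  rw [geomCartan]
  nlinarith [Real.sq_sqrt (show (0 : ℝ) ≤ 2 by norm_num), Real.sqrt_nonneg 2]

/-- At label `5` the square is `2.618…`, the square of the golden ratio; the rational bound `13/5`
is sharp enough for bounding the legs of a path. -/
theorem lt_geomCartan_sq_of_five_le {i j : B} (h : M i j = 0 ∨ 5 ≤ M i j) :
    13 / 5 ≤ M.geomCartan i j ^ 2 := by
  have := cos_pi_div_le (k := 5) (m := M i j) (by norm_num) h
  norm_num at this
  rw [geomCartan]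
  have h5 : (2.236 : ℝ) ≤ √5 := Real.le_sqrt_of_sq_le (by norm_num)
  nlinarith

theorem three_le_geomCartan_sq {i j : B} (h : M i j = 0 ∨ 6 ≤ M i j) :
    3 ≤ M.geomCartan i j ^ 2 := by
  have := cos_pi_div_le (k := 6) (m := M i j) (by norm_num) h
  norm_num at this
  rw [geomCartan]
  nlinarith [Real.sq_sqrt (show (0 : ℝ) ≤ 3 by norm_num), Real.sqrt_nonneg 3]

theorem sum_geomCartan_le [DecidableEq B] {T : Finset B} {b u : B} (hb : b ∉ T) (hu : u ∈ T) :
    ∑ u ∈ T, M.geomCartan b u ≤ M.geomCartan b u := by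
  have : ∑ u ∈ T, M.geomCartan b u ≤ ∑ u ∈ {u}, M.geomCartan b u := by
    rw [← Finset.sum_sdiff (Finset.singleton_subset_iff.mpr hu)]
    have : ∑ j ∈ T \ {u}, M.geomCartan b j ≤ 0 := by
      refine Finset.sum_nonpos fun j hj => M.geomCartan_nonpos ?_
      rintro rfl
      exact hb (Finset.mem_sdiff.mp hj).1
    linarith
  simpa using this

theorem one_le_sum_sq [DecidableEq B] {T : Finset B} {b u : B} (hb : b ∉ T) (hu : u ∈ T)
    (h : M b u ≠ 2) : 1 ≤ (∑ u ∈ T, M.geomCartan b u) ^ 2 := by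
  have h1 := M.sum_geomCartan_le hb hu
  have h2 := M.geomCartan_le_neg_one (ne_of_mem_of_not_mem hu hb).symm h
  nlinarith

theorem two_le_sum_sq [DecidableEq B] {T : Finset B} {b u : B} (hb : b ∉ T) (hu : u ∈ T)
    (h : M b u ≠ 2) (h' : M b u ≠ 3) : 2 ≤ (∑ u ∈ T, M.geomCartan b u) ^ 2 := by
  have h1 := M.sum_geomCartan_le hb hu
  have h2 := M.geomCartan_le_neg_one (ne_of_mem_of_not_mem hu hb).symm h
  have h3 := M.two_le_geomCartan_sq (i := b) (j := u) (by
    have := M.three_le_of_ne (ne_of_mem_of_not_mem hu hb).symm h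
    omega)
  nlinarith

/-- Finite vertex sets that are connected in the Coxeter graph, built up vertex by vertex. -/
inductive ConnectedSet [DecidableEq B] : Finset B → Prop
  | singleton (b : B) : ConnectedSet {b}
  | insert {T : Finset B} {b c : B} : ConnectedSet T → b ∉ T → c ∈ T → M b c ≠ 2 →
      ConnectedSet (insert b T)

/-- Adding a vertex contributes `2` on the diagonal and at most `-1` twice off it, because it is
joined to some earlier vertex. A connected set thus behaves like a single root, of squared norm at
most `2`. -/
theorem ConnectedSet.sum_le {M : CoxeterMatrix B} [DecidableEq B] {T : Finset B}
    (hT : M.ConnectedSet T) : ∑ i ∈ T, ∑ j ∈ T, M.geomCartan i j ≤ 2 := by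
  induction hT with
  | singleton b => simp [geomCartan_self]
  | @insert T b c hT hb hc hbc ih =>
    have h1 : ∑ j ∈ T, M.geomCartan b j ≤ -1 :=
      (M.sum_geomCartan_le hb hc).trans
        (M.geomCartan_le_neg_one (ne_of_mem_of_not_mem hc hb).symm hbc)
    have h2 : ∑ j ∈ T, M.geomCartan j b = ∑ j ∈ T, M.geomCartan b j :=
      Finset.sum_congr rfl fun j _ => M.geomCartan_symm j b
    simp only [Finset.sum_insert hb, Finset.sum_add_distrib, h2, geomCartan_self]
    linarith

variable [Fintype B]

/-- Positive definiteness of the form of the geometric representation. -/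
def IsPosDef : Prop :=
  ∀ x : B → ℝ, x ≠ 0 → 0 < ∑ i, ∑ j, M.geomCartan i j * x i * x j

variable {M}

theorem IsPosDef.sum_mul_pos (hM : M.IsPosDef) {x : B → ℝ} (hx : x ≠ 0) :
    0 < ∑ i, x i * ∑ j, M.geomCartan i j * x j := by
  refine (hM x hx).trans_eq (Finset.sum_congr rfl fun i _ => ?_)
  rw [Finset.mul_sum]
  exact Finset.sum_congr rfl fun j _ => by ring

/-- Contract `T` to one vertex: a vertex cannot have outer edges whose squared Cartan entries add up
to `4`. This one inequality limits branching, labels and cycles. -/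
theorem IsPosDef.sum_sq_lt_four [DecidableEq B] (hM : M.IsPosDef) {T : Finset B}
    (hT : M.ConnectedSet T) :
    ∑ b ∈ Tᶜ, (∑ u ∈ T, M.geomCartan b u) ^ 2 < 4 := by
  set a : B → ℝ := fun b => -∑ u ∈ T, M.geomCartan b u with ha
  have ha0 : ∀ b ∈ Tᶜ, 0 ≤ a b := by
    intro b hb
    rw [ha]
    simp only [Left.nonneg_neg_iff]
    refine Finset.sum_nonpos fun u hu => M.geomCartan_nonpos ?_
    rintro rfl
    exact (Finset.mem_compl.mp hb) hu
  -- The test vector is twice the sum of the roots in `T`, corrected at each outer vertex by its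
  -- negated row sum over `T`.
  set x : B → ℝ := fun b => if b ∈ T then 2 else a b with hx
  have hxT : ∀ b ∈ T, x b = 2 := fun b hb => by simp [hx, hb]
  have hxC : ∀ b ∈ Tᶜ, x b = a b := fun b hb => by simp [hx, Finset.mem_compl.mp hb]
  have hne : T.Nonempty := by cases hT <;> simp
  obtain ⟨t, ht⟩ := hne
  have hpos := hM.sum_mul_pos (x := x) (fun h => by
    have := congrFun h t
    rw [hxT t ht] at this
    norm_num at this)
  have split : ∀ b, ∑ j, M.geomCartan b j * x j =
      2 * ∑ j ∈ T, M.geomCartan b j + ∑ j ∈ Tᶜ, M.geomCartan b j * a j := by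
    intro b
    rw [← Finset.sum_add_sum_compl T, Finset.mul_sum]
    congr 1
    · exact Finset.sum_congr rfl fun j hj => by rw [hxT j hj, mul_comm]
    · exact Finset.sum_congr rfl fun j hj => by rw [hxC j hj]
  rw [← Finset.sum_add_sum_compl T] at hpos
  -- In an outer row, `T` contributes `-2 a i` and the diagonal `2 a i`; all other terms are
  -- nonpositive.
  have h1 : ∑ i ∈ Tᶜ, x i * ∑ j, M.geomCartan i j * x j ≤ 0 := by
    refine Finset.sum_nonpos fun i hi => ?_
    rw [hxC i hi]
    refine mul_nonpos_of_nonneg_of_nonpos (ha0 i hi) ?_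
    rw [split]
    have h2 : ∑ j ∈ Tᶜ, M.geomCartan i j * a j ≤ ∑ j ∈ {i}, M.geomCartan i j * a j := by
      rw [← Finset.sum_sdiff (Finset.singleton_subset_iff.mpr hi)]
      have : ∑ j ∈ Tᶜ \ {i}, M.geomCartan i j * a j ≤ 0 := by
        refine Finset.sum_nonpos fun j hj => ?_
        simp only [Finset.mem_sdiff, Finset.mem_singleton] at hj
        exact mul_nonpos_of_nonpos_of_nonneg (M.geomCartan_nonpos (Ne.symm hj.2)) (ha0 j hj.1)
      linarith
    rw [Finset.sum_singleton, geomCartan_self] at h2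
    have : a i = -∑ u ∈ T, M.geomCartan i u := rfl
    linarith
  have h2 : ∑ i ∈ T, x i * ∑ j, M.geomCartan i j * x j =
      4 * ∑ i ∈ T, ∑ j ∈ T, M.geomCartan i j - 2 * ∑ b ∈ Tᶜ, a b ^ 2 := by
    have e1 : ∑ i ∈ T, x i * ∑ j, M.geomCartan i j * x j =
        ∑ i ∈ T, (4 * ∑ j ∈ T, M.geomCartan i j + 2 * ∑ j ∈ Tᶜ, M.geomCartan i j * a j) :=
      Finset.sum_congr rfl fun i hi => by rw [hxT i hi, split]; ring
    rw [e1, Finset.sum_add_distrib, ← Finset.mul_sum, ← Finset.mul_sum, Finset.sum_comm (s := T)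
      (t := Tᶜ), sub_eq_add_neg, ← mul_neg, ← Finset.sum_neg_distrib]
    congr 2
    refine Finset.sum_congr rfl fun b _ => ?_
    rw [← Finset.sum_mul]
    have : ∑ i ∈ T, M.geomCartan i b = -a b := by
      rw [ha]
      simp only [neg_neg]
      exact Finset.sum_congr rfl fun i _ => M.geomCartan_symm i b
    rw [this]
    ring
  have h3 := hT.sum_le
  have h4 : ∑ b ∈ Tᶜ, a b ^ 2 = ∑ b ∈ Tᶜ, (∑ u ∈ T, M.geomCartan b u) ^ 2 :=
    Finset.sum_congr rfl fun b _ => by simp [ha]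
  linarith

/-- An edge with infinite label has squared Cartan entry `4`, which already exhausts the bound for a
one-vertex set. -/
theorem IsPosDef.ne_zero [DecidableEq B] (hM : M.IsPosDef) (i j : B) : M i j ≠ 0 := by
  intro h0
  have hij : i ≠ j := by
    rintro rfl
    simp at h0
  have h := hM.sum_sq_lt_four (ConnectedSet.singleton j)
  have h1 : ∑ b ∈ ({i} : Finset B), (∑ u ∈ {j}, M.geomCartan b u) ^ 2 ≤
      ∑ b ∈ ({j} : Finset B)ᶜ, (∑ u ∈ {j}, M.geomCartan b u) ^ 2 :=
    Finset.sum_le_sum_of_subset_of_nonneg (by simpa using Ne.symm hij) fun _ _ _ => sq_nonneg _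
  simp only [Finset.sum_singleton, M.geomCartan_of_eq_zero h0] at h1
  norm_num at h1 h
  linarith

/-- A vertex outside a connected set is joined to at most one of its vertices. -/
theorem IsPosDef.eq_two_of_connectedSet [DecidableEq B] (hM : M.IsPosDef) {T : Finset B}
    (hT : M.ConnectedSet T) {b u w : B} (hb : b ∉ T) (hu : u ∈ T) (hw : w ∈ T) (huw : w ≠ u)
    (h : M b u ≠ 2) : M b w = 2 := by
  by_contra h'
  -- Two edges from `b` into `T` make its row sum at most `-2`, whose square is `4`. In particular
  -- the graph has no cycles.
  have h1 := hM.sum_sq_lt_four hT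
  have h2 : ∑ b ∈ ({b} : Finset B), (∑ u ∈ T, M.geomCartan b u) ^ 2 ≤
      ∑ b ∈ Tᶜ, (∑ u ∈ T, M.geomCartan b u) ^ 2 :=
    Finset.sum_le_sum_of_subset_of_nonneg (by simpa using hb) fun _ _ _ => sq_nonneg _
  rw [Finset.sum_singleton] at h2
  have h3 : ∑ u ∈ T, M.geomCartan b u ≤ ∑ u ∈ {u, w}, M.geomCartan b u := by
    rw [← Finset.sum_sdiff (show {u, w} ⊆ T by
      intro z hz
      simp only [Finset.mem_insert, Finset.mem_singleton] at hz
      rcases hz with rfl | rfl <;> assumption)]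
    have : ∑ j ∈ T \ {u, w}, M.geomCartan b j ≤ 0 := by
      refine Finset.sum_nonpos fun j hj => M.geomCartan_nonpos ?_
      rintro rfl
      exact hb (Finset.mem_sdiff.mp hj).1
    linarith
  rw [Finset.sum_pair huw.symm] at h3
  have h4 := M.geomCartan_le_neg_one (ne_of_mem_of_not_mem hu hb).symm h
  have h5 := M.geomCartan_le_neg_one (ne_of_mem_of_not_mem hw hb).symm h'
  nlinarith

end CoxeterMatrix

/-! ### Forbidden neighbourhoods, spiders and inequalities for leg lengths. -/

namespace CoxeterMatrix

variable {B : Type*} {M : CoxeterMatrix B}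

theorem ne_of_apply_ne_one {i j : B} (h : M i j ≠ 1) : i ≠ j := by
  rintro rfl
  exact h (M.diagonal i)

section Decorations

variable [Fintype B] [DecidableEq B]

/-- An outer neighbour of `T` has weight at least `1`, and at least `2` if its edge has a label
above `3`. The three lemmas below exclude the totals `1+1+1+1`, `2+1+1` and `2+2`. -/
theorem IsPosDef.sum_weights_lt_four (hM : M.IsPosDef) {T D : Finset B} (hT : M.ConnectedSet T)
    (n : B → ℕ) (hD : ∀ b ∈ D, b ∉ T ∧ (n b : ℝ) ≤ (∑ u ∈ T, M.geomCartan b u) ^ 2) :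
    ∑ b ∈ D, n b < 4 := by
  have h1 : ∑ b ∈ D, (n b : ℝ) ≤ ∑ b ∈ Tᶜ, (∑ u ∈ T, M.geomCartan b u) ^ 2 :=
    (Finset.sum_le_sum fun b hb => (hD b hb).2).trans <|
      Finset.sum_le_sum_of_subset_of_nonneg (fun b hb => by simpa using (hD b hb).1)
        fun _ _ _ => sq_nonneg _
  have h2 := h1.trans_lt (hM.sum_sq_lt_four hT)
  exact_mod_cast h2

theorem IsPosDef.false_of_four_neighbors (hM : M.IsPosDef) {T : Finset B} (hT : M.ConnectedSet T)
    {a b c d : B} (hn : [a, b, c, d].Nodup)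
    (h : ∀ z ∈ [a, b, c, d], z ∉ T ∧ ∃ u ∈ T, M z u ≠ 2) : False := by
  have := hM.sum_weights_lt_four (D := [a, b, c, d].toFinset) hT (fun _ => 1) fun z hz => by
    obtain ⟨h1, u, hu, h2⟩ := h z (by simpa using hz)
    exact ⟨h1, by simpa using M.one_le_sum_sq h1 hu h2⟩
  rw [Finset.sum_const, List.toFinset_card_of_nodup hn] at this
  simp at this

theorem IsPosDef.false_of_three_neighbors (hM : M.IsPosDef) {T : Finset B}
    (hT : M.ConnectedSet T) {a b c : B} (hn : [a, b, c].Nodup)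
    (h : ∀ z ∈ [a, b, c], z ∉ T ∧ ∃ u ∈ T, M z u ≠ 2)
    (ha : ∃ u ∈ T, M a u ≠ 2 ∧ M a u ≠ 3) : False := by
  have := hM.sum_weights_lt_four (D := [a, b, c].toFinset) hT (fun z => if z = a then 2 else 1)
    fun z hz => by
      obtain ⟨h1, u, hu, h2⟩ := h z (by simpa using hz)
      refine ⟨h1, ?_⟩
      split_ifs with hza
      · obtain ⟨u, hu, h3, h4⟩ := ha
        subst hza
        exact M.two_le_sum_sq h1 hu h3 h4
      · simpa using M.one_le_sum_sq h1 hu h2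
  simp only [List.nodup_cons, List.mem_cons, List.not_mem_nil, or_false, not_or] at hn
  obtain ⟨⟨h1, h2⟩, h3, -⟩ := hn
  simp [Finset.sum_insert, h1, h2, h3, Ne.symm h1, Ne.symm h2] at this

theorem IsPosDef.false_of_two_neighbors (hM : M.IsPosDef) {T : Finset B}
    (hT : M.ConnectedSet T) {a b : B} (hn : a ≠ b)
    (h : ∀ z ∈ [a, b], z ∉ T ∧ ∃ u ∈ T, M z u ≠ 2 ∧ M z u ≠ 3) : False := by
  have := hM.sum_weights_lt_four (D := {a, b}) hT (fun _ => 2) fun z hz => by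
    obtain ⟨h1, u, hu, h2, h3⟩ := h z (by simpa using hz)
    exact ⟨h1, by simpa using M.two_le_sum_sq h1 hu h2 h3⟩
  rw [Finset.sum_pair hn] at this
  omega

end Decorations

/-- A family of legs `f k 0, f k 1, …, f k (L k)` whose edges have label `3`; the only other edges
between vertices of the legs are those between the roots `f k 0`. -/
structure Spider (M : CoxeterMatrix B) {K : Type*} (f : K → ℕ → B) (L : K → ℕ) : Prop where
  adj : ∀ k i, i < L k → M (f k i) (f k (i + 1)) = 3
  same : ∀ k i j, i + 2 ≤ j → j ≤ L k → M (f k i) (f k j) = 2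
  cross : ∀ k l i j, k ≠ l → 1 ≤ i → i ≤ L k → 1 ≤ j → j ≤ L l → M (f k i) (f l j) = 2
  root : ∀ k l j, f k 0 ≠ f l 0 → 1 ≤ j → j ≤ L l → M (f k 0) (f l j) = 2

namespace Spider

variable {K : Type*} {f : K → ℕ → B} {L : K → ℕ}

theorem adj' (h : M.Spider f L) (k : K) (i : ℕ) (hi : i < L k) :
    M (f k (i + 1)) (f k i) = 3 := by
  rw [M.symmetric, h.adj k i hi]

theorem ne_of_lt (h : M.Spider f L) {k : K} {i j : ℕ} (hij : i < j) (hj : j ≤ L k) :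
    f k i ≠ f k j := by
  apply ne_of_apply_ne_one (M := M)
  rcases Nat.lt_or_ge j (i + 2) with h1 | h1
  · obtain rfl : j = i + 1 := by omega
    rw [h.adj k i (by omega)]
    norm_num
  · rw [h.same k i j h1 hj]
    norm_num

theorem ne_of_ne (h : M.Spider f L) {k : K} {i j : ℕ} (hij : i ≠ j) (hi : i ≤ L k)
    (hj : j ≤ L k) : f k i ≠ f k j := by
  rcases Nat.lt_or_gt_of_ne hij with h1 | h1
  · exact h.ne_of_lt h1 hj
  · exact (h.ne_of_lt h1 hi).symm

theorem cross_ne (h : M.Spider f L) {k l : K} {i j : ℕ} (hkl : k ≠ l) (hi : i ≤ L k)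
    (hj : 1 ≤ j) (hj' : j ≤ L l) : f k i ≠ f l j := by
  rcases Nat.eq_zero_or_pos i with rfl | hi0
  · by_cases hr : f k 0 = f l 0
    · rw [hr]
      exact h.ne_of_lt hj hj'
    · apply ne_of_apply_ne_one (M := M)
      rw [h.root k l j hr hj hj']
      norm_num
  · apply ne_of_apply_ne_one (M := M)
    rw [h.cross k l i j hkl hi0 hi hj hj']
    norm_num

theorem eq_or_of_eq (h : M.Spider f L) {k l : K} {i j : ℕ} (hi : i ≤ L k) (hj : j ≤ L l)
    (e : f k i = f l j) : (k = l ∧ i = j) ∨ (i = 0 ∧ j = 0) := by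
  by_cases hkl : k = l
  · subst hkl
    by_cases hij : i = j
    · exact Or.inl ⟨rfl, hij⟩
    · exact absurd e (h.ne_of_ne hij hi hj)
  · right
    constructor
    · by_contra h0
      exact h.cross_ne (Ne.symm hkl) hj (Nat.one_le_iff_ne_zero.mpr h0) hi e.symm
    · by_contra h0
      exact h.cross_ne hkl hi (Nat.one_le_iff_ne_zero.mpr h0) hj e

theorem extend [DecidableEq K] (h : M.Spider f L) (k₀ : K) (v : B)
    (hv : M (f k₀ (L k₀)) v = 3)
    (hv' : ∀ k i, i ≤ L k → f k i ≠ f k₀ (L k₀) → M (f k i) v = 2) :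
    M.Spider (fun k i => if k = k₀ ∧ i = L k₀ + 1 then v else f k i)
      (Function.update L k₀ (L k₀ + 1)) where
  adj k i hi := by
    by_cases hk : k = k₀
    · subst hk
      rw [Function.update_self] at hi
      by_cases hi' : i = L k
      · subst hi'
        simpa using hv
      · have : i ≠ L k + 1 := by omega
        simpa [this, hi'] using h.adj k i (by omega)
    · rw [Function.update_of_ne hk] at hi
      simpa [hk] using h.adj k i hi
  same k i j hij hj := by
    by_cases hk : k = k₀
    · subst hk
      rw [Function.update_self] at hj
      have hi : i ≠ L k + 1 := by omega
      by_cases hj' : j = L k + 1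
      · simpa [hi, hj'] using hv' k i (by omega) (h.ne_of_lt (by omega) le_rfl)
      · simpa [hi, hj'] using h.same k i j hij (by omega)
    · rw [Function.update_of_ne hk] at hj
      simpa [hk] using h.same k i j hij hj
  cross k l i j hkl hi hi' hj hj' := by
    have key : ∀ k i, k ≠ k₀ → 1 ≤ i → i ≤ L k → M (f k i) v = 2 := fun k i hk h1 h2 =>
      hv' k i h2 (h.cross_ne (Ne.symm hk) le_rfl h1 h2).symm
    by_cases hk : k = k₀
    · subst hk
      rw [Function.update_self] at hi'
      rw [Function.update_of_ne (Ne.symm hkl)] at hj'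
      by_cases hi2 : i = L k + 1
      · rw [M.symmetric]
        simpa [hi2, Ne.symm hkl] using key l j (Ne.symm hkl) hj hj'
      · simpa [hi2, Ne.symm hkl] using h.cross k l i j hkl hi (by omega) hj hj'
    · rw [Function.update_of_ne hk] at hi'
      by_cases hl : l = k₀
      · subst hl
        rw [Function.update_self] at hj'
        by_cases hj2 : j = L l + 1
        · simpa [hj2, hk] using key k i hk hi hi'
        · simpa [hj2, hk] using h.cross k l i j hkl hi hi' hj (by omega)
      · rw [Function.update_of_ne hl] at hj'
        simpa [hk, hl] using h.cross k l i j hkl hi hi' hj hj'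
  root k l j hkl hj hj' := by
    simp only [Nat.right_eq_add, Nat.add_eq_zero_iff, one_ne_zero, and_false, if_false] at hkl ⊢
    by_cases hl : l = k₀
    · subst hl
      rw [Function.update_self] at hj'
      by_cases hj2 : j = L l + 1
      · simp only [hj2, and_self, if_true]
        refine hv' k 0 (Nat.zero_le _) ?_
        rcases Nat.eq_zero_or_pos (L l) with h0 | h0
        · rwa [h0]
        · refine h.cross_ne ?_ (Nat.zero_le _) h0 le_rfl
          rintro rfl
          exact hkl rfl
      · simpa [hj2] using h.root k l j hkl hj (by omega)
    · rw [Function.update_of_ne hl] at hj'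
      simpa [hl] using h.root k l j hkl hj hj'

theorem connectedSet_leg [DecidableEq B] (h : M.Spider f L) (k : K) :
    ∀ i, i ≤ L k → M.ConnectedSet ((Finset.range (i + 1)).image (f k)) := by
  intro i
  induction i with
  | zero =>
    intro _
    simpa using ConnectedSet.singleton (f k 0)
  | succ i ih =>
    intro hi
    rw [Finset.range_add_one, Finset.image_insert]
    refine ConnectedSet.insert (c := f k i) (ih (by omega)) ?_ ?_ ?_
    · simp only [Finset.mem_image, Finset.mem_range, not_exists, not_and]
      intro j hj
      exact h.ne_of_lt hj hi
    · exact Finset.mem_image_of_mem _ (by simp)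
    · rw [h.adj' k i (by omega)]
      norm_num

/-- A connected spider whose only possible extensions prolong a leg by an edge with label `3` can be
extended to cover all vertices. -/
theorem exists_covering [Fintype B] [DecidableEq B] [DecidableEq K] (hM : M.IsPosDef)
    (hirr : M.IsIrreducible) (c : K → B) (L₀ : K → ℕ)
    (hext : ∀ (f : K → ℕ → B) (L : K → ℕ), M.Spider f L → (∀ k, f k 0 = c k) →
      (∀ k, L₀ k ≤ L k) → ∀ v k i, i ≤ L k → (∀ k i, i ≤ L k → f k i ≠ v) →
      M v (f k i) ≠ 2 → M v (f k i) = 3 ∧ i = L k)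
    (f : K → ℕ → B) (L : K → ℕ) (h : M.Spider f L) (hc : ∀ k, f k 0 = c k)
    (hL : ∀ k, L₀ k ≤ L k) (S : Finset B) (hS : M.ConnectedSet S)
    (hSf : ∀ b, b ∈ S ↔ ∃ k i, i ≤ L k ∧ f k i = b) :
    ∃ (f : K → ℕ → B) (L : K → ℕ), M.Spider f L ∧ (∀ k, f k 0 = c k) ∧
      (∀ k, L₀ k ≤ L k) ∧ ∀ b, ∃ k i, i ≤ L k ∧ f k i = b := by
  induction hn : Sᶜ.card generalizing f L S with
  | zero =>
    refine ⟨f, L, h, hc, hL, fun b => (hSf b).mp ?_⟩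
    rw [Finset.card_eq_zero, Finset.compl_eq_empty_iff] at hn
    rw [hn]
    exact Finset.mem_univ b
  | succ n ih =>
    have hne : S.Nonempty := by cases hS <;> simp
    obtain ⟨a, ha⟩ := hne
    obtain ⟨b, hb⟩ : Sᶜ.Nonempty := by
      rw [← Finset.card_pos]
      omega
    -- A path from a covered to an uncovered vertex leaves `S` along some edge. By `hext` this edge
    -- prolongs a leg, and by the absence of cycles it is the only edge from the new vertex to `S`.
    obtain ⟨p⟩ := hirr.preconnected a b
    obtain ⟨d, -, hd1, hd2⟩ := p.exists_boundary_dart (S : Set B) (by simpa using ha)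
      (by simpa using hb)
    obtain ⟨⟨u, v⟩, huv⟩ := d
    simp only [Finset.mem_coe] at hd1 hd2
    obtain ⟨k, i, hi, rfl⟩ := (hSf u).mp hd1
    have huv2 : M v (f k i) ≠ 2 := by
      rw [M.symmetric]
      exact huv.2
    obtain ⟨h3, rfl⟩ := hext f L h hc hL v k i hi
      (fun k i hi e => hd2 (e ▸ (hSf _).mpr ⟨k, i, hi, rfl⟩)) huv2
    have hnew := h.extend k v (by rw [M.symmetric]; exact h3) fun l j hj hlj => by
      rw [M.symmetric]
      exact hM.eq_two_of_connectedSet hS hd2 hd1 ((hSf _).mpr ⟨l, j, hj, rfl⟩) hlj huv2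
    refine ih _ _ hnew (by simpa using hc) ?_ (insert v S) (hS.insert hd2 hd1 huv2) ?_ ?_
    · intro l
      by_cases hl : l = k
      · subst hl
        rw [Function.update_self]
        exact (hL l).trans (Nat.le_succ _)
      · rw [Function.update_of_ne hl]
        exact hL l
    · intro b
      rw [Finset.mem_insert, hSf]
      constructor
      · rintro (rfl | ⟨l, j, hj, rfl⟩)
        · exact ⟨k, L k + 1, by simp, by simp⟩
        · refine ⟨l, j, ?_, ?_⟩
          · by_cases hl : l = k
            · subst hl
              rw [Function.update_self]
              omega
            · rwa [Function.update_of_ne hl]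
          · rw [if_neg]
            rintro ⟨rfl, rfl⟩
            omega
      · rintro ⟨l, j, hj, rfl⟩
        by_cases hl : l = k ∧ j = L k + 1
        · exact Or.inl (by rw [if_pos hl])
        · refine Or.inr ⟨l, j, ?_, by rw [if_neg hl]⟩
          by_cases hl' : l = k
          · subst hl'
            rw [Function.update_self] at hj
            have : j ≠ L l + 1 := fun e => hl ⟨rfl, e⟩
            omega
          · rwa [Function.update_of_ne hl'] at hj
    · rw [Finset.compl_insert, Finset.card_erase_of_mem (by simpa using hd2), hn]
      rfl

/-- The weight falls linearly along a leg, from `t k` at the root to the value `0` that would occur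
one place beyond the tip. The condition `ht` makes it well defined at shared roots. -/
theorem exists_weights (h : M.Spider f L) (hcov : ∀ b, ∃ k i, i ≤ L k ∧ f k i = b) (t : K → ℝ)
    (ht : ∀ k l, f k 0 = f l 0 → t k = t l) :
    ∃ y : B → ℝ, ∀ k i, i ≤ L k → y (f k i) = t k * (1 - i / (L k + 1)) := by
  choose κ ι hι hf using hcov
  refine ⟨fun b => t (κ b) * (1 - ι b / (L (κ b) + 1)), fun k i hi => ?_⟩
  rcases h.eq_or_of_eq (hι (f k i)) hi (hf (f k i)) with ⟨h1, h2⟩ | ⟨h1, h2⟩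
  · simp only
    rw [h1, h2]
  · subst h2
    have h3 := hf (f k 0)
    rw [h1] at h3
    simp [h1, ht _ _ h3]

section Weights

variable [Fintype B] [DecidableEq B]

theorem _root_.CoxeterMatrix.sum_geomCartan_mul_le {y : B → ℝ} (hy : ∀ b, 0 ≤ y b)
    {N : Finset B} {b : B} (hb : b ∈ N) :
    ∑ j, M.geomCartan b j * y j ≤ ∑ j ∈ N, M.geomCartan b j * y j := by
  rw [← Finset.sum_add_sum_compl N]
  have : ∑ j ∈ Nᶜ, M.geomCartan b j * y j ≤ 0 := by
    refine Finset.sum_nonpos fun j hj => mul_nonpos_of_nonpos_of_nonneg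
      (M.geomCartan_nonpos (ne_of_mem_of_not_mem hb (Finset.mem_compl.mp hj))) (hy j)
  linarith

/-- Second differences of a linear function vanish, and the phantom vertex beyond the tip has weight
`0`. Entries off the leg only lower the sum. -/
theorem sum_geomCartan_mul_nonpos (h : M.Spider f L) {t : K → ℝ} {y : B → ℝ}
    (hy0 : ∀ b, 0 ≤ y b) (hy : ∀ k i, i ≤ L k → y (f k i) = t k * (1 - i / (L k + 1))) (k : K)
    (i : ℕ) (hi : 1 ≤ i) (hi' : i ≤ L k) :
    ∑ j, M.geomCartan (f k i) j * y j ≤ 0 := by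
  obtain ⟨i, rfl⟩ : ∃ j, i = j + 1 := ⟨i - 1, by omega⟩
  have hn1 : f k (i + 1) ≠ f k i := (h.ne_of_lt (Nat.lt_succ_self i) hi').symm
  have hpos : (0 : ℝ) < L k + 1 := by positivity
  have e1 := hy k i (by omega)
  have e2 := hy k (i + 1) hi'
  rcases Nat.lt_or_ge (i + 1) (L k) with h1 | h1
  · have e3 := hy k (i + 2) h1
    have hn2 : f k (i + 1) ≠ f k (i + 2) := h.ne_of_lt (by omega) h1
    have hn3 : f k i ≠ f k (i + 2) := h.ne_of_lt (by omega) h1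
    refine (sum_geomCartan_mul_le hy0 (N := {f k (i + 1), f k i, f k (i + 2)})
      (by simp)).trans_eq ?_
    rw [Finset.sum_insert (by simp [hn1, hn2]), Finset.sum_pair hn3, geomCartan_self,
      M.geomCartan_of_eq_three (h.adj' k i (by omega)),
      M.geomCartan_of_eq_three (h.adj k (i + 1) h1), e1, e2, e3]
    push_cast
    ring
  · have h2 : L k = i + 1 := by omega
    refine (sum_geomCartan_mul_le hy0 (N := {f k (i + 1), f k i}) (by simp)).trans_eq ?_
    rw [Finset.sum_pair hn1, geomCartan_self,
      M.geomCartan_of_eq_three (h.adj' k i (by omega)), e1, e2, h2]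
    push_cast
    field_simp
    ring

/-- With the linear weights only the central row can be positive. It is at most `∑ 1 / (L k + 1) -
1`, so the reciprocals of the `L k + 1` add up to more than `1`. -/
theorem tripod_inequality {f : Fin 3 → ℕ → B} {L : Fin 3 → ℕ} (hM : M.IsPosDef)
    (h : M.Spider f L) (hcov : ∀ b, ∃ k i, i ≤ L k ∧ f k i = b) (hroot : ∀ k, f k 0 = f 0 0)
    (hL : ∀ k, 1 ≤ L k) :
    (L 0 + 1) * (L 1 + 1) * (L 2 + 1) <
      (L 0 + 1) * (L 1 + 1) + (L 0 + 1) * (L 2 + 1) + (L 1 + 1) * (L 2 + 1) := by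
  obtain ⟨y, hy⟩ := h.exists_weights hcov (fun _ => 1) (fun _ _ _ => rfl)
  have hy0 : ∀ b, 0 ≤ y b := by
    intro b
    obtain ⟨k, i, hi, rfl⟩ := hcov b
    rw [hy k i hi, one_mul, sub_nonneg, div_le_one (by positivity)]
    exact_mod_cast hi.trans (Nat.le_succ _)
  have hc : y (f 0 0) = 1 := by simpa using hy 0 0 (Nat.zero_le _)
  have hpos := hM.sum_mul_pos (x := y) fun e => by
    rw [e] at hc
    simp at hc
  rw [← Finset.add_sum_erase _ _ (Finset.mem_univ (f 0 0)), hc, one_mul] at hpos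
  have h1 : ∑ b ∈ Finset.univ.erase (f 0 0), y b * ∑ j, M.geomCartan b j * y j ≤ 0 := by
    refine Finset.sum_nonpos fun b hb => mul_nonpos_of_nonneg_of_nonpos (hy0 b) ?_
    obtain ⟨k, i, hi, rfl⟩ := hcov b
    refine h.sum_geomCartan_mul_nonpos hy0 hy k i ?_ hi
    by_contra hi0
    obtain rfl : i = 0 := by omega
    exact (Finset.ne_of_mem_erase hb) (hroot k)
  have hne : ∀ k, f 0 0 ≠ f k 1 := fun k => by
    rw [← hroot k]
    exact h.ne_of_lt Nat.zero_lt_one (hL k)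
  have hne' : ∀ k l, k ≠ l → f k 1 ≠ f l 1 := fun k l hkl =>
    h.cross_ne hkl (hL k) le_rfl (hL l)
  have hA : ∀ k, M.geomCartan (f 0 0) (f k 1) = -1 := fun k => by
    rw [← hroot k]
    exact M.geomCartan_of_eq_three (h.adj k 0 (hL k))
  have h2 := sum_geomCartan_mul_le (M := M) hy0
    (N := {f 0 0, f 0 1, f 1 1, f 2 1}) (b := f 0 0) (by simp)
  rw [Finset.sum_insert (by simp [hne]), Finset.sum_insert (by simp [hne']),
    Finset.sum_pair (hne' 1 2 (by decide)), geomCartan_self, hA, hA, hA, hc, hy 0 1 (hL 0),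
    hy 1 1 (hL 1), hy 2 1 (hL 2)] at h2
  have h3 : 0 < (1 : ℝ) / (L 0 + 1) + 1 / (L 1 + 1) + 1 / (L 2 + 1) - 1 := by
    push_cast at h2
    linarith
  have h4 : (0 : ℝ) < ((1 : ℝ) / (L 0 + 1) + 1 / (L 1 + 1) + 1 / (L 2 + 1) - 1) *
      ((L 0 + 1) * (L 1 + 1) * (L 2 + 1)) := by positivity
  have h5 : ((1 : ℝ) / (L 0 + 1) + 1 / (L 1 + 1) + 1 / (L 2 + 1) - 1) *
      ((L 0 + 1) * (L 1 + 1) * (L 2 + 1)) =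
      (L 0 + 1) * (L 1 + 1) + (L 0 + 1) * (L 2 + 1) + (L 1 + 1) * (L 2 + 1) -
      (L 0 + 1) * (L 1 + 1) * (L 2 + 1) := by
    field_simp
    ring
  rw [h5, sub_pos] at h4
  exact_mod_cast h4

/-- With linear weights on both legs, all rows except those of the two roots are nonpositive, and
positivity becomes `g² < α β` for the entry `g` of the middle edge. -/
theorem path_inequality {f : Bool → ℕ → B} {L : Bool → ℕ} (hM : M.IsPosDef)
    (h : M.Spider f L) (hcov : ∀ b, ∃ k i, i ≤ L k ∧ f k i = b)
    (hroot : M (f false 0) (f true 0) ≠ 1) {γ : ℝ}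
    (hγ : γ ≤ M.geomCartan (f false 0) (f true 0) ^ 2) :
    γ * ((L false + 1) * (L true + 1)) < (L false + 2) * (L true + 2) := by
  have hroot := ne_of_apply_ne_one hroot
  set g := M.geomCartan (f false 0) (f true 0) with hg
  have hg0 : g ≤ 0 := M.geomCartan_nonpos hroot
  set α : ℝ := (L false + 2) / (L false + 1) with hα
  set β : ℝ := (L true + 2) / (L true + 1) with hβ
  have hα0 : 0 < α := by positivity
  have hβ0 : 0 < β := by positivity
  -- The root weights are `α` on the `true` leg and `-g` on the `false` leg, which makes the bound
  -- for the row of `f false 0` zero.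
  obtain ⟨y, hy⟩ := h.exists_weights hcov (fun k => cond k α (-g)) (by
    rintro (_ | _) (_ | _) e
    · rfl
    · exact absurd e hroot
    · exact absurd e.symm hroot
    · rfl)
  have ht : ∀ k : Bool, 0 ≤ cond k α (-g) := by
    rintro (_ | _)
    · simpa using hg0
    · exact hα0.le
  have hy0 : ∀ b, 0 ≤ y b := by
    intro b
    obtain ⟨k, i, hi, rfl⟩ := hcov b
    rw [hy k i hi]
    refine mul_nonneg (ht k) ?_
    rw [sub_nonneg, div_le_one (by positivity)]
    exact_mod_cast hi.trans (Nat.le_succ _)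
  have hf0 : y (f false 0) = -g := by simpa using hy false 0 (Nat.zero_le _)
  have ht0 : y (f true 0) = α := by simpa using hy true 0 (Nat.zero_le _)
  have hpos := hM.sum_mul_pos (x := y) fun e => by
    rw [e] at ht0
    exact hα0.ne ht0
  rw [← Finset.sum_add_sum_compl {f false 0, f true 0}, Finset.sum_pair hroot, hf0, ht0] at hpos
  have h1 : ∑ b ∈ ({f false 0, f true 0} : Finset B)ᶜ, y b * ∑ j, M.geomCartan b j * y j ≤ 0 := by
    refine Finset.sum_nonpos fun b hb => mul_nonpos_of_nonneg_of_nonpos (hy0 b) ?_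
    obtain ⟨k, i, hi, rfl⟩ := hcov b
    refine h.sum_geomCartan_mul_nonpos hy0 hy k i ?_ hi
    by_contra hi0
    obtain rfl : i = 0 := by omega
    revert hb
    cases k <;> simp
  have key : ∀ k : Bool, ∑ j, M.geomCartan (f k 0) j * y j ≤
      y (f k 0) * ((L k + 2) / (L k + 1)) + g * y (f (!k) 0) := by
    intro k
    have hr : f k 0 ≠ f (!k) 0 := by
      cases k
      · exact hroot
      · exact hroot.symm
    have hgk : M.geomCartan (f k 0) (f (!k) 0) = g := by
      cases k
      · rfl
      · exact M.geomCartan_symm _ _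
    rcases Nat.eq_zero_or_pos (L k) with h0 | h0
    · have h2 := sum_geomCartan_mul_le (M := M) hy0 (N := {f k 0, f (!k) 0}) (b := f k 0) (by simp)
      rw [Finset.sum_pair hr, geomCartan_self, hgk] at h2
      rw [h0]
      push_cast
      linarith
    · have hn1 : f k 0 ≠ f k 1 := h.ne_of_lt Nat.zero_lt_one h0
      have hn2 : f (!k) 0 ≠ f k 1 := h.cross_ne (by simp) (Nat.zero_le _) le_rfl h0
      have h2 := sum_geomCartan_mul_le (M := M) hy0 (N := {f k 0, f (!k) 0, f k 1}) (b := f k 0)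
        (by simp)
      rw [Finset.sum_insert (by simp [hr, hn1]), Finset.sum_pair hn2, geomCartan_self, hgk,
        M.geomCartan_of_eq_three (h.adj k 0 h0), hy k 1 h0] at h2
      have h3 := hy k 0 (Nat.zero_le _)
      simp only [Nat.cast_zero, zero_div, sub_zero, mul_one] at h3
      rw [← h3] at h2
      have h4 : y (f k 0) * (((L k : ℝ) + 2) / (L k + 1)) =
          2 * y (f k 0) + -1 * (y (f k 0) * (1 - ((1 : ℕ) : ℝ) / (L k + 1))) := by
        field_simp
        push_cast
        ring
      linarith
  have k1 := key false
  have k2 := key true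
  simp only [Bool.not_false, Bool.not_true, hf0, ht0] at k1 k2
  rw [← hα] at k1
  rw [← hβ] at k2
  have h5 : 0 < α * (α * β - g ^ 2) := by nlinarith
  have h6 : g ^ 2 < α * β := by
    have := (mul_pos_iff_of_pos_left hα0).mp h5
    linarith
  have h7 : γ < α * β := hγ.trans_lt h6
  rw [hα, hβ, div_mul_div_comm, lt_div_iff₀ (by positivity)] at h7
  exact h7

end Weights

end Spider

end CoxeterMatrix

/-! ### Identification of spiders with the named types. -/

namespace CoxeterMatrix

variable {B : Type*} {M : CoxeterMatrix B}

/-- The entries of a Coxeter matrix, as natural numbers. -/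
def entry (M : CoxeterMatrix B) (i j : B) : ℕ := M i j

theorem isOfType_of_surjective {B' : Type*} {N : CoxeterMatrix B'} (F : B' → B)
    (hF : Function.Surjective F) (h : ∀ i j, M (F i) (F j) = N i j) : M.IsOfType N := by
  have hinj : Function.Injective F := by
    intro i j e
    by_contra hij
    apply N.off_diagonal i j hij
    rw [← h, e, M.diagonal]
  refine ⟨(Equiv.ofBijective F ⟨hinj, hF⟩).symm, ?_⟩
  ext i j
  exact h i j

/-- The Coxeter matrix entries of a spider with three legs and common root. -/
def tripodLabel (k : Fin 3) (i : ℕ) (l : Fin 3) (j : ℕ) : ℕ :=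
  if k = l ∨ i = 0 ∨ j = 0 then if i = j then 1 else if i + 1 = j ∨ j + 1 = i then 3 else 2 else 2

/-- The position on the two legs of a path of its `i`-th vertex. -/
def pathVertex (f : Bool → ℕ → B) (p i : ℕ) : B :=
  if i ≤ p then f false (p - i) else f true (i - p - 1)

namespace Spider

theorem apply_same {K : Type*} {f : K → ℕ → B} {L : K → ℕ} (h : M.Spider f L) (k : K) {i j : ℕ}
    (hi : i ≤ L k) (hj : j ≤ L k) :
    M (f k i) (f k j) = if i = j then 1 else if i + 1 = j ∨ j + 1 = i then 3 else 2 := by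
  split_ifs with h1 h2
  · rw [h1, M.diagonal]
  · rcases h2 with rfl | rfl
    · exact h.adj k i (by omega)
    · exact h.adj' k j (by omega)
  · rcases Nat.lt_or_gt_of_ne h1 with h3 | h3
    · exact h.same k i j (by omega) hj
    · rw [M.symmetric]
      exact h.same k j i (by omega) hi

theorem tripod_apply {f : Fin 3 → ℕ → B} {L : Fin 3 → ℕ} (h : M.Spider f L)
    (hroot : ∀ k, f k 0 = f 0 0) {k l : Fin 3} {i j : ℕ} (hi : i ≤ L k) (hj : j ≤ L l) :
    M (f k i) (f l j) = tripodLabel k i l j := by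
  unfold tripodLabel
  split_ifs with h1 h2 h3
  all_goals first
    | rcases h1 with rfl | rfl | rfl
      · rw [h.apply_same k hi hj]
        simp_all
      · rw [hroot k, ← hroot l, h.apply_same l (Nat.zero_le _) hj]
        simp_all
      · rw [hroot l, ← hroot k, h.apply_same k hi (Nat.zero_le _)]
        simp_all
    | push Not at h1
      exact h.cross k l i j h1.1 (by omega) hi (by omega) hj

theorem comp {K K' : Type*} {f : K → ℕ → B} {L : K → ℕ} (h : M.Spider f L) (σ : K' ≃ K) :
    M.Spider (fun k => f (σ k)) (fun k => L (σ k)) where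
  adj k := h.adj (σ k)
  same k := h.same (σ k)
  cross k l i j hkl := h.cross (σ k) (σ l) i j (σ.injective.ne hkl)
  root k l := h.root (σ k) (σ l)

theorem path_apply {f : Bool → ℕ → B} {L : Bool → ℕ} (h : M.Spider f L)
    (hroot : f false 0 ≠ f true 0) {i j : ℕ} (hij : i < j) (hj : j < L false + L true + 2) :
    M (pathVertex f (L false) i) (pathVertex f (L false) j) =
      if j = i + 1 then if i = L false then M (f false 0) (f true 0) else 3 else 2 := by
  unfold pathVertex
  by_cases h1 : j ≤ L false
  · rw [if_pos (by omega), if_pos h1, h.apply_same false (Nat.sub_le _ _) (Nat.sub_le _ _)]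
    have : i ≠ L false := by omega
    split_ifs <;> omega
  · rw [if_neg h1]
    by_cases h2 : i ≤ L false
    · rw [if_pos h2]
      rcases Nat.eq_zero_or_pos (L false - i) with h3 | h3
      · rcases Nat.eq_zero_or_pos (j - L false - 1) with h4 | h4
        · rw [h3, h4, if_pos (by omega), if_pos (by omega)]
        · rw [h3, h.root false true _ hroot h4 (by omega), if_neg (by omega)]
      · rcases Nat.eq_zero_or_pos (j - L false - 1) with h4 | h4
        · rw [h4, M.symmetric, h.root true false _ hroot.symm h3 (by omega), if_neg (by omega)]
        · rw [h.cross false true _ _ (by decide) h3 (by omega) h4 (by omega), if_neg (by omega)]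
    · rw [if_neg h2, h.apply_same true (by omega) (by omega)]
      have : i ≠ L false := by omega
      split_ifs <;> omega

theorem path_isOfType {f : Bool → ℕ → B} {L : Bool → ℕ} (h : M.Spider f L)
    (hcov : ∀ b, ∃ k i, i ≤ L k ∧ f k i = b) (hroot : f false 0 ≠ f true 0) {n : ℕ}
    (hn : n = L false + L true + 2) (N : CoxeterMatrix (Fin n))
    (hN : ∀ i j : Fin n, i < j → N.entry i j =
      if (j : ℕ) = i + 1 then if (i : ℕ) = L false then M (f false 0) (f true 0) else 3 else 2) :
    M.IsOfType N := by
  subst hn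
  refine isOfType_of_surjective (fun i => pathVertex f (L false) i) ?_ ?_
  · intro b
    obtain ⟨k, i, hi, rfl⟩ := hcov b
    cases k
    · refine ⟨⟨L false - i, by omega⟩, ?_⟩
      simp only [pathVertex]
      rw [if_pos (Nat.sub_le _ _)]
      congr 1
      omega
    · refine ⟨⟨L false + 1 + i, by omega⟩, ?_⟩
      simp only [pathVertex]
      rw [if_neg (by omega)]
      congr 1
      omega
  · intro i j
    rcases lt_trichotomy i j with h1 | rfl | h1
    · rw [h.path_apply hroot h1 j.2, ← hN i j h1, entry]
    · rw [M.diagonal, N.diagonal]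
    · rw [M.symmetric, N.symmetric, h.path_apply hroot h1 i.2, ← hN j i h1, entry]

/-- The maps `κ` and `ι` give leg and position of each numbered vertex. The centre lies on all three
legs, so in `hsurj` a single index with `ι a = 0` serves them all. -/
theorem tripod_isOfType {f : Fin 3 → ℕ → B} {L : Fin 3 → ℕ} (h : M.Spider f L)
    (hcov : ∀ b, ∃ k i, i ≤ L k ∧ f k i = b) (hroot : ∀ k, f k 0 = f 0 0) {n : ℕ}
    (N : CoxeterMatrix (Fin n)) (κ : Fin n → Fin 3) (ι : Fin n → ℕ) (hι : ∀ a, ι a ≤ L (κ a))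
    (hsurj : ∀ k i, i ≤ L k → (∃ a, κ a = k ∧ ι a = i) ∨ (i = 0 ∧ ∃ a, ι a = 0))
    (hN : ∀ a b, N.entry a b = tripodLabel (κ a) (ι a) (κ b) (ι b)) : M.IsOfType N := by
  refine isOfType_of_surjective (fun a => f (κ a) (ι a)) ?_ ?_
  · intro b
    obtain ⟨k, i, hi, rfl⟩ := hcov b
    rcases hsurj k i hi with ⟨a, rfl, rfl⟩ | ⟨rfl, a, ha⟩
    · exact ⟨a, rfl⟩
    · refine ⟨a, ?_⟩
      simp only [ha]
      rw [hroot, hroot k]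
  · intro a b
    rw [h.tripod_apply hroot (hι a) (hι b), ← hN, entry]

theorem tripod_classification [Fintype B] [DecidableEq B] (hM : M.IsPosDef)
    {f : Fin 3 → ℕ → B} {L : Fin 3 → ℕ} (h : M.Spider f L)
    (hcov : ∀ b, ∃ k i, i ≤ L k ∧ f k i = b) (hroot : ∀ k, f k 0 = f 0 0)
    (hL : ∀ k, 1 ≤ L k) : M.IsFactorizableType := by
  wlog hmono : Monotone L generalizing f L with H
  · refine H (h.comp (Tuple.sort L)) ?_ (fun k => ?_) (fun k => hL _) (Tuple.monotone_sort L)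
    · intro b
      obtain ⟨k, i, hi, rfl⟩ := hcov b
      exact ⟨(Tuple.sort L).symm k, i, by simpa using hi, by simp⟩
    · rw [hroot, hroot (Tuple.sort L 0)]
  have h01 : L 0 ≤ L 1 := hmono (by decide)
  have h12 : L 1 ≤ L 2 := hmono (by decide)
  have hineq := h.tripod_inequality hM hcov hroot hL
  -- If even the shortest leg had two edges, the three reciprocals would add up to at most `1`. The
  -- remaining solutions for the `L k + 1` are `(2, 2, r)`, giving type `D`, and `(2, 3, r)` with `r
  -- = 3, 4, 5`, giving type `E`.
  have h0 : L 0 = 1 := by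
    by_contra h0
    have := hL 0
    have h2 : 2 ≤ L 0 := by omega
    have e1 : (L 0 + 1) * (L 1 + 1) ≤ (L 1 + 1) * (L 2 + 1) := by
      rw [mul_comm]
      gcongr
      exact h01.trans h12
    have e2 : (L 0 + 1) * (L 2 + 1) ≤ (L 1 + 1) * (L 2 + 1) := by gcongr
    have e3 : 3 * ((L 1 + 1) * (L 2 + 1)) ≤ (L 0 + 1) * ((L 1 + 1) * (L 2 + 1)) := by
      gcongr
      omega
    rw [mul_assoc] at hineq
    omega
  rcases (show L 1 = 1 ∨ 2 ≤ L 1 by have := hL 1; omega) with h1 | h1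
  · refine Or.inr (Or.inr (Or.inl ⟨L 2 + 3, by have := hL 2; omega, ?_⟩))
    refine h.tripod_isOfType hcov hroot _
      (fun a => if (a : ℕ) = 0 then 0 else if (a : ℕ) = 1 then 1 else 2)
      (fun a => if (a : ℕ) ≤ 1 then 1 else (a : ℕ) - 2) ?_ ?_ ?_
    · intro a
      have := a.2
      split_ifs <;> omega
    · intro k i hi
      by_cases hi0 : i = 0
      · exact Or.inr ⟨hi0, ⟨2, by omega⟩, by simp⟩
      · left
        fin_cases k
        · simp only [Fin.zero_eta, h0] at hi
          exact ⟨⟨0, by omega⟩, by simp, by simp; omega⟩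
        · simp only [Fin.mk_one, h1] at hi
          exact ⟨⟨1, by omega⟩, by simp, by simp; omega⟩
        · simp only [Fin.reduceFinMk] at hi
          refine ⟨⟨i + 2, by omega⟩, by simp, by simp⟩
    · intro a b
      simp only [entry, typeD, Matrix.of_apply, tripodLabel, Fin.ext_iff]
      rcases a with ⟨a, ha⟩
      rcases b with ⟨b, hb⟩
      rcases (show a = 0 ∨ a = 1 ∨ 2 ≤ a by omega) with rfl | rfl | ha' <;>
      rcases (show b = 0 ∨ b = 1 ∨ 2 ≤ b by omega) with rfl | rfl | hb'
      · simp
      · simp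
      · have e1 : ¬ b ≤ 1 := by omega
        have e2 : b ≠ 0 := by omega
        have e3 : b ≠ 1 := by omega
        simp [e1, e2, e3]
        grind
      · simp
      · simp
      · have e1 : ¬ b ≤ 1 := by omega
        have e2 : b ≠ 0 := by omega
        have e3 : b ≠ 1 := by omega
        simp [e1, e2, e3]
        grind
      · have e1 : ¬ a ≤ 1 := by omega
        have e2 : a ≠ 0 := by omega
        have e3 : a ≠ 1 := by omega
        simp [e1, e2, e3]
        grind
      · have e1 : ¬ a ≤ 1 := by omega
        have e2 : a ≠ 0 := by omega
        have e3 : a ≠ 1 := by omega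
        simp [e1, e2, e3]
        grind
      · have e1 : ¬ b ≤ 1 := by omega
        have e2 : b ≠ 0 := by omega
        have e3 : b ≠ 1 := by omega
        have e4 : ¬ a ≤ 1 := by omega
        have e5 : a ≠ 0 := by omega
        have e6 : a ≠ 1 := by omega
        simp [e1, e2, e3, e4, e5, e6]
        grind
  · rw [h0] at hineq
    have h11 : L 1 = 2 := by
      by_contra h2
      nlinarith [show 3 ≤ L 1 by omega]
    rw [h11] at hineq h12
    have h2 : L 2 = 2 ∨ L 2 = 3 ∨ L 2 = 4 := by omega
    have hLk : ∀ k, L k = ![1, 2, L 2] k := by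
      intro k
      fin_cases k <;> simp [h0, h11]
    refine Or.inr (Or.inr (Or.inr (Or.inr ?_)))
    rcases h2 with h2 | h2 | h2
    · rw [h2] at hLk
      refine Or.inl (h.tripod_isOfType hcov hroot _ ![1, 0, 1, 2, 2, 2] ![2, 1, 1, 0, 1, 2] ?_ ?_
        (by decide))
      · simp only [hLk]
        decide
      · simp only [hLk]
        intro k i hi
        have : i ≤ 4 := by fin_cases k <;> simp at hi <;> omega
        revert k
        interval_cases i <;> decide
    · rw [h2] at hLk
      refine Or.inr (Or.inl (h.tripod_isOfType hcov hroot _ ![1, 0, 1, 2, 2, 2, 2]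
        ![2, 1, 1, 0, 1, 2, 3] ?_ ?_ (by decide)))
      · simp only [hLk]
        decide
      · simp only [hLk]
        intro k i hi
        have : i ≤ 4 := by fin_cases k <;> simp at hi <;> omega
        revert k
        interval_cases i <;> decide
    · rw [h2] at hLk
      refine Or.inr (Or.inr (h.tripod_isOfType hcov hroot _ ![1, 0, 1, 2, 2, 2, 2, 2]
        ![2, 1, 1, 0, 1, 2, 3, 4] ?_ ?_ (by decide)))
      · simp only [hLk]
        decide
      · simp only [hLk]
        intro k i hi
        have : i ≤ 4 := by fin_cases k <;> simp at hi <;> omega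
        revert k
        interval_cases i <;> decide

/-- Let `q ≤ p` be the leg lengths on the two sides of the edge labelled `m`. Label `3` imposes
nothing, `4` leaves `q = 0` or `p = q = 1`, `5` leaves `q = 0` and `p ≤ 2`, and larger labels leave
`p = q = 0`. -/
theorem path_classification [Fintype B] [DecidableEq B] (hM : M.IsPosDef)
    {f : Bool → ℕ → B} {L : Bool → ℕ} (h : M.Spider f L)
    (hcov : ∀ b, ∃ k i, i ≤ L k ∧ f k i = b) (hroot : f false 0 ≠ f true 0)
    (hm : M (f false 0) (f true 0) ≠ 2) : M.IsFactorizableType ∨ M.IsRemainingType := by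
  wlog hle : L true ≤ L false generalizing f L with H
  · refine H (h.comp Equiv.boolNot) ?_ hroot.symm ?_ ?_
    · intro b
      obtain ⟨k, i, hi, rfl⟩ := hcov b
      exact ⟨!k, i, by simpa using hi, by simp⟩
    · rw [M.symmetric]
      exact hm
    · simpa using (not_le.mp hle).le
  have h0 := hM.ne_zero (f false 0) (f true 0)
  have h1 := M.off_diagonal _ _ hroot
  set m := M (f false 0) (f true 0) with hm'
  rcases (show m = 3 ∨ m = 4 ∨ m = 5 ∨ 6 ≤ m by omega) with h3 | h4 | h5 | h6
  · refine Or.inl (Or.inl ⟨_, by omega, h.path_isOfType hcov hroot rfl _ ?_⟩)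
    intro i j hij
    rw [← hm', h3]
    simp only [entry, CoxeterMatrix.A, Matrix.of_apply]
    have : (i : ℕ) < j := hij
    have h7 : i ≠ j := hij.ne
    simp only [h7, if_false]
    split_ifs <;> omega
  · have hineq := h.path_inequality hM hcov (by omega)
      (M.two_le_geomCartan_sq (Or.inr (by omega)))
    have hineq' : 2 * ((L false + 1) * (L true + 1)) < (L false + 2) * (L true + 2) := by
      exact_mod_cast hineq
    rcases Nat.eq_zero_or_pos (L true) with ht | ht
    · have hB : M.IsOfType (CoxeterMatrix.B (L false + L true + 2)) := by
        refine h.path_isOfType hcov hroot rfl _ ?_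
        intro i j hij
        rw [← hm', h4]
        simp only [entry, CoxeterMatrix.B, Matrix.of_apply]
        have : (i : ℕ) < j := hij
        have h7 : i ≠ j := hij.ne
        have := j.2
        simp only [h7, if_false]
        split_ifs <;> omega
      rcases Nat.eq_zero_or_pos (L false) with hf | hf
      · rw [hf, ht] at hB
        exact Or.inr (Or.inr (Or.inl hB))
      · exact Or.inl (Or.inr (Or.inl ⟨_, by omega, hB⟩))
    · have ht1 : L true = 1 := by
        by_contra hne
        nlinarith [show 2 ≤ L true by omega]
      have hf1 : L false = 1 := by
        rw [ht1] at hineq'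
        omega
      refine Or.inr (Or.inr (Or.inr (Or.inl (h.path_isOfType hcov hroot (by omega) _ ?_))))
      rw [← hm', h4, hf1]
      decide
  · have hineq := h.path_inequality hM hcov (by omega)
      (M.lt_geomCartan_sq_of_five_le (Or.inr (by omega)))
    have hineq' : 13 * ((L false + 1) * (L true + 1)) < 5 * ((L false + 2) * (L true + 2)) := by
      have : (13 : ℝ) * ((L false + 1) * (L true + 1)) < 5 * ((L false + 2) * (L true + 2)) := by
        linarith
      exact_mod_cast this
    have ht : L true = 0 := by
      by_contra hne
      nlinarith [show 1 ≤ L true by omega]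
    rw [ht] at hineq'
    have hf : L false = 0 ∨ L false = 1 ∨ L false = 2 := by omega
    rcases hf with hf | hf | hf
    · refine Or.inr (Or.inr (Or.inr (Or.inr (Or.inr ⟨5, by norm_num,
        h.path_isOfType hcov hroot (by omega) _ ?_⟩))))
      rw [← hm', h5, hf]
      decide
    · refine Or.inr (Or.inr (Or.inr (Or.inr (Or.inl
        (h.path_isOfType hcov hroot (by omega) _ ?_)))))
      rw [← hm', h5, hf]
      decide
    · refine Or.inl (Or.inr (Or.inr (Or.inr (Or.inl
        (h.path_isOfType hcov hroot (by omega) _ ?_)))))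
      rw [← hm', h5, hf]
      decide
  · have hineq := h.path_inequality hM hcov (by omega)
      (M.three_le_geomCartan_sq (Or.inr (by omega)))
    have hineq' : 3 * ((L false + 1) * (L true + 1)) < (L false + 2) * (L true + 2) := by
      exact_mod_cast hineq
    have ht : L true = 0 := by
      by_contra hne
      nlinarith [show 1 ≤ L true by omega]
    rw [ht] at hineq'
    have hf : L false = 0 := by omega
    refine Or.inr (Or.inr (Or.inr (Or.inr (Or.inr ⟨m, by omega,
      h.path_isOfType hcov hroot (by omega) _ ?_⟩))))
    intro i j hij
    have h7 : i ≠ j := hij.ne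
    have h8 : (i : ℕ) < j := hij
    rw [← hm', if_pos (by omega), if_pos (by omega)]
    simp only [entry, typeI₂, CoxeterMatrix.I, Matrix.of_apply, h7, if_false]
    omega

end Spider

end CoxeterMatrix

/-! ### Growth of spiders and the classification. -/

namespace CoxeterMatrix

variable {B : Type*} {M : CoxeterMatrix B}

theorem Spider.pair (M : CoxeterMatrix B) (u v : B) :
    M.Spider (fun (k : Bool) (_ : ℕ) => cond k v u) (fun _ => 0) where
  adj k i hi := by omega
  same k i j hij hj := by omega
  cross k l i j _ hi hi' := by omega
  root k l j _ hj hj' := by omega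

variable [Fintype B] [DecidableEq B]

theorem path_classification_of_extension (hM : M.IsPosDef) (hirr : M.IsIrreducible) {u v : B}
    (huv : u ≠ v) (h2 : M u v ≠ 2)
    (hext : ∀ (f : Bool → ℕ → B) (L : Bool → ℕ), M.Spider f L → (∀ k, f k 0 = cond k v u) →
      ∀ w k i, i ≤ L k → (∀ k i, i ≤ L k → f k i ≠ w) →
      M w (f k i) ≠ 2 → M w (f k i) = 3 ∧ i = L k) :
    M.IsFactorizableType ∨ M.IsRemainingType := by
  obtain ⟨f, L, h, hc, -, hcov⟩ := Spider.exists_covering hM hirr (fun k => cond k v u)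
    (fun _ => 0) (fun f L h hc _ => hext f L h hc) _ _ (Spider.pair M u v) (fun _ => rfl)
    (fun _ => le_rfl) {u, v}
    ((ConnectedSet.singleton v).insert (by simpa using huv) (Finset.mem_singleton_self v) h2)
    (fun b => by
      simp only [Finset.mem_insert, Finset.mem_singleton, Bool.exists_bool, cond_true, cond_false]
      constructor
      · rintro (rfl | rfl)
        · exact Or.inl ⟨0, le_rfl, rfl⟩
        · exact Or.inr ⟨0, le_rfl, rfl⟩
      · rintro (⟨-, -, rfl⟩ | ⟨-, -, rfl⟩) <;> simp)
  have e0 : f false 0 = u := hc false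
  have e1 : f true 0 = v := hc true
  exact h.path_classification hM hcov (by rwa [e0, e1]) (by rwa [e0, e1])

theorem tripod_classification_of_branch (hM : M.IsPosDef) (hirr : M.IsIrreducible) {c : B}
    {n : Fin 3 → B} (hn : Function.Injective n) (hnc : ∀ k, n k ≠ c) (hadj : ∀ k, M (n k) c ≠ 2) :
    M.IsFactorizableType := by
  have hnodup : ∀ σ : Fin 3 ≃ Fin 3, [n (σ 0), n (σ 1), n (σ 2)].Nodup := by
    intro σ
    simp [hn.eq_iff, σ.injective.eq_iff]
  have h3 : ∀ k, M (n k) c = 3 := by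
    intro k
    by_contra hk
    refine hM.false_of_three_neighbors (ConnectedSet.singleton c)
      (hnodup (Equiv.swap 0 k)) ?_ ?_
    · intro z hz
      have : ∃ l, n l = z := by
        simp only [List.mem_cons, List.not_mem_nil, or_false] at hz
        rcases hz with rfl | rfl | rfl <;> exact ⟨_, rfl⟩
      obtain ⟨l, rfl⟩ := this
      exact ⟨by simpa using hnc l, c, by simp, hadj l⟩
    · exact ⟨c, by simp, by simpa using hadj k, by simpa using hk⟩
  have hnn : ∀ k l, k ≠ l → M (n k) (n l) = 2 := by
    intro k l hkl
    refine hM.eq_two_of_connectedSet (T := {n l, c}) (u := c) ?_ ?_ (by simp) (by simp) (hnc l)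
      (hadj k)
    · exact (ConnectedSet.singleton c).insert (by simpa using hnc l) (by simp) (hadj l)
    · simp [hn.eq_iff, hkl, hnc k]
  have hsp : M.Spider (fun (k : Fin 3) i => if i = 0 then c else n k) (fun _ => 1) := by
    refine ⟨?_, ?_, ?_, ?_⟩
    · intro k i hi
      obtain rfl : i = 0 := by omega
      rw [M.symmetric]
      simpa using h3 k
    · intro k i j hij hj
      omega
    · intro k l i j hkl hi hi' hj hj'
      obtain rfl : i = 1 := by omega
      obtain rfl : j = 1 := by omega
      simpa using hnn k l hkl
    · intro k l j hkl
      simp at hkl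
  have hS : M.ConnectedSet {n 2, n 1, n 0, c} := by
    refine ConnectedSet.insert (ConnectedSet.insert (ConnectedSet.insert
      (ConnectedSet.singleton c) ?_ (by simp) (hadj 0)) ?_ (c := c) (by simp) (hadj 1)) ?_
      (c := c) (by simp) (hadj 2) <;> simp [hn.eq_iff, hnc]
  -- Take for `T` the part of leg `k` up to position `i`. The first vertices of the other two legs
  -- have total weight `2`, so a new neighbour by a label above `3`, or one before the tip (next to
  -- `f k (i + 1)`), would bring the total to `4`.
  have hext : ∀ (f : Fin 3 → ℕ → B) (L : Fin 3 → ℕ), M.Spider f L → (∀ k, f k 0 = c) →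
      (∀ k, 1 ≤ L k) → ∀ v k i, i ≤ L k → (∀ k i, i ≤ L k → f k i ≠ v) →
      M v (f k i) ≠ 2 → M v (f k i) = 3 ∧ i = L k := by
    intro f L h hc hL v k i hi hv hvi
    have hT := h.connectedSet_leg k i hi
    have hother : ∀ l, l ≠ k → f l 1 ∉ (Finset.range (i + 1)).image (f k) ∧
        ∃ u ∈ (Finset.range (i + 1)).image (f k), M (f l 1) u ≠ 2 := by
      intro l hl
      refine ⟨?_, f k 0, Finset.mem_image_of_mem _ (by simp), ?_⟩
      · simp only [Finset.mem_image, Finset.mem_range, not_exists, not_and]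
        intro j hj
        exact h.cross_ne hl.symm (by omega) le_rfl (hL l)
      · rw [hc k, ← hc l, h.adj' l 0 (hL l)]
        norm_num
    have hvT : v ∉ (Finset.range (i + 1)).image (f k) := by
      simp only [Finset.mem_image, Finset.mem_range, not_exists, not_and]
      intro j hj
      exact hv k j (by omega)
    have hvm : f k i ∈ (Finset.range (i + 1)).image (f k) :=
      Finset.mem_image_of_mem _ (by simp)
    obtain ⟨l, l', hl, hl', hll⟩ : ∃ l l' : Fin 3, l ≠ k ∧ l' ≠ k ∧ l ≠ l' :=
      (by decide : ∀ k : Fin 3, ∃ l l' : Fin 3, l ≠ k ∧ l' ≠ k ∧ l ≠ l') k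
    have hne : f l 1 ≠ f l' 1 := h.cross_ne hll (hL l) le_rfl (hL l')
    constructor
    · by_contra hv3
      refine hM.false_of_three_neighbors hT (a := v) (b := f l 1) (c := f l' 1) ?_ ?_
        ⟨_, hvm, hvi, hv3⟩
      · simp [hne, (hv l 1 (hL l)).symm, (hv l' 1 (hL l')).symm]
      · intro z hz
        simp only [List.mem_cons, List.not_mem_nil, or_false] at hz
        rcases hz with rfl | rfl | rfl
        · exact ⟨hvT, _, hvm, hvi⟩
        · exact hother l hl
        · exact hother l' hl'
    · by_contra hiL
      have hiL' : i + 1 ≤ L k := by omega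
      refine hM.false_of_four_neighbors hT (a := v) (b := f l 1) (c := f l' 1) (d := f k (i + 1))
        ?_ ?_
      · simp [hne, (hv l 1 (hL l)).symm, (hv l' 1 (hL l')).symm, (hv k (i + 1) hiL').symm,
          h.cross_ne hl (hL l) (Nat.le_add_left 1 i) hiL',
          h.cross_ne hl' (hL l') (Nat.le_add_left 1 i) hiL']
      · intro z hz
        simp only [List.mem_cons, List.not_mem_nil, or_false] at hz
        rcases hz with rfl | rfl | rfl | rfl
        · exact ⟨hvT, _, hvm, hvi⟩
        · exact hother l hl
        · exact hother l' hl'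
        · refine ⟨?_, _, hvm, by rw [h.adj' k i hiL']; norm_num⟩
          simp only [Finset.mem_image, Finset.mem_range, not_exists, not_and]
          intro j hj
          exact h.ne_of_lt hj hiL'
  have hmem : ∀ b, b ∈ ({n 2, n 1, n 0, c} : Finset B) ↔
      ∃ (k : Fin 3) (i : ℕ), i ≤ 1 ∧ (if i = 0 then c else n k) = b := by
    intro b
    simp only [Finset.mem_insert, Finset.mem_singleton]
    constructor
    · rintro (rfl | rfl | rfl | rfl)
      · exact ⟨2, 1, le_rfl, by simp⟩
      · exact ⟨1, 1, le_rfl, by simp⟩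
      · exact ⟨0, 1, le_rfl, by simp⟩
      · exact ⟨0, 0, by simp, by simp⟩
    · rintro ⟨k, i, -, rfl⟩
      by_cases hi : i = 0
      · simp [hi]
      · fin_cases k <;> simp [hi]
  obtain ⟨f, L, h, hc, hL, hcov⟩ := Spider.exists_covering hM hirr (fun _ => c) (fun _ => 1)
    hext _ _ hsp (fun _ => by simp) (fun _ => le_rfl) _ hS hmem
  exact h.tripod_classification hM hcov (fun k => by rw [hc, hc]) hL

/-- The classification of the connected positive definite Coxeter graphs. -/
theorem IsPosDef.classification (hM : M.IsPosDef) (hirr : M.IsIrreducible) :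
    M.IsFactorizableType ∨ M.IsRemainingType := by
  by_cases hbr : ∃ (c : B) (n : Fin 3 → B), Function.Injective n ∧ (∀ k, n k ≠ c) ∧
      ∀ k, M (n k) c ≠ 2
  · obtain ⟨c, n, hn, hnc, hadj⟩ := hbr
    exact Or.inl (tripod_classification_of_branch hM hirr hn hnc hadj)
  -- The two spider roots are the ends of an edge with label above `3`. Seen from either leg, the
  -- opposite root already has weight `2`, so a second such edge or a branching would reach `4`.
  by_cases hlab : ∃ u v : B, u ≠ v ∧ M u v ≠ 2 ∧ M u v ≠ 3
  · obtain ⟨u, v, huv, h2, h3⟩ := hlab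
    refine path_classification_of_extension hM hirr huv h2 ?_
    intro f L h hc w k i hi hw hwi
    have hT := h.connectedSet_leg k i hi
    have hr : f k 0 ≠ f (!k) 0 := by
      cases k <;> simp [hc, huv, huv.symm]
    have hwT : w ∉ (Finset.range (i + 1)).image (f k) := by
      simp only [Finset.mem_image, Finset.mem_range, not_exists, not_and]
      intro j hj
      exact hw k j (by omega)
    have hwm : f k i ∈ (Finset.range (i + 1)).image (f k) :=
      Finset.mem_image_of_mem _ (by simp)
    have hkT : f (!k) 0 ∉ (Finset.range (i + 1)).image (f k) := by
      simp only [Finset.mem_image, Finset.mem_range, not_exists, not_and]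
      intro j hj
      rcases Nat.eq_zero_or_pos j with rfl | hj0
      · exact hr
      · exact (h.cross_ne (by simp) (Nat.zero_le _) hj0 (by omega)).symm
    have hk2 : ∃ u ∈ (Finset.range (i + 1)).image (f k), M (f (!k) 0) u ≠ 2 ∧
        M (f (!k) 0) u ≠ 3 := by
      refine ⟨f k 0, Finset.mem_image_of_mem _ (by simp), ?_⟩
      cases k
      · simpa [hc, M.symmetric v u] using And.intro h2 h3
      · simpa [hc] using And.intro h2 h3
    have hkw : f (!k) 0 ≠ w := hw _ _ (Nat.zero_le _)
    constructor
    · by_contra hw3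
      refine hM.false_of_two_neighbors hT hkw ?_
      intro z hz
      simp only [List.mem_cons, List.not_mem_nil, or_false] at hz
      rcases hz with rfl | rfl
      · exact ⟨hkT, hk2⟩
      · exact ⟨hwT, _, hwm, hwi, hw3⟩
    · by_contra hiL
      have hiL' : i + 1 ≤ L k := by omega
      refine hM.false_of_three_neighbors hT (a := f (!k) 0) (b := w) (c := f k (i + 1)) ?_ ?_ hk2
      · simp [hkw, (hw k (i + 1) hiL').symm,
          h.cross_ne (show (!k) ≠ k by simp) (Nat.zero_le _) (Nat.le_add_left 1 i) hiL']
      · intro z hz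
        simp only [List.mem_cons, List.not_mem_nil, or_false] at hz
        rcases hz with rfl | rfl | rfl
        · obtain ⟨u, hu, h4, -⟩ := hk2
          exact ⟨hkT, u, hu, h4⟩
        · exact ⟨hwT, _, hwm, hwi⟩
        · refine ⟨?_, _, hwm, by rw [h.adj' k i hiL']; norm_num⟩
          simp only [Finset.mem_image, Finset.mem_range, not_exists, not_and]
          intro j hj
          exact h.ne_of_lt hj hiL'
  -- Now all edges have label `3` and no vertex has three neighbours, so the graph grows as a path
  -- from any edge.
  push Not at hlab hbr
  have hdeg : ∀ c a b d : B, [a, b, d].Nodup → a ≠ c → b ≠ c → d ≠ c → M a c ≠ 2 → M b c ≠ 2 →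
      M d c ≠ 2 → False := by
    intro c a b d hn ha hb hd ha2 hb2 hd2
    simp only [List.nodup_cons, List.mem_cons, List.not_mem_nil, or_false, not_or,
      List.nodup_nil, and_true, not_false_eq_true] at hn
    obtain ⟨⟨h1, h2⟩, h3⟩ := hn
    obtain ⟨k, hk⟩ := hbr c ![a, b, d] (by
      intro i j hij
      fin_cases i <;> fin_cases j <;> simp_all [eq_comm]) (by
      intro k
      fin_cases k <;> simp [ha, hb, hd])
    fin_cases k
    · exact ha2 hk
    · exact hb2 hk
    · exact hd2 hk
  by_cases hsub : Subsingleton B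
  · right
    left
    obtain ⟨b⟩ := hirr.nonempty
    refine isOfType_of_surjective (fun _ => b) (fun b' => ⟨0, Subsingleton.elim _ _⟩) ?_
    intro i j
    obtain rfl : i = j := Subsingleton.elim _ _
    rw [M.diagonal, CoxeterMatrix.diagonal]
  · rw [not_subsingleton_iff_nontrivial] at hsub
    obtain ⟨u⟩ := hirr.nonempty
    obtain ⟨v, hv⟩ := hirr.preconnected.exists_adj_of_nontrivial u
    refine path_classification_of_extension hM hirr hv.1 hv.2 ?_
    intro f L h hc w k i hi hw hwi
    refine ⟨hlab _ _ (hw k i hi).symm hwi, ?_⟩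
    by_contra hiL
    have hiL' : i + 1 ≤ L k := by omega
    have h3 : M (f k (i + 1)) (f k i) ≠ 2 := by
      rw [h.adj' k i hiL']
      norm_num
    have hn1 : f k (i + 1) ≠ f k i := (h.ne_of_lt (Nat.lt_succ_self i) hiL').symm
    rcases Nat.eq_zero_or_pos i with rfl | hi0
    · have hr : f (!k) 0 ≠ f k 0 := by
        cases k <;> simp [hc, hv.1, hv.1.symm]
      have hr2 : M (f (!k) 0) (f k 0) ≠ 2 := by
        cases k
        · simpa [hc, M.symmetric v u] using hv.2
        · simpa [hc] using hv.2
      refine hdeg (f k 0) (f k 1) w (f (!k) 0) ?_ hn1 (hw k 0 hi).symm hr h3 hwi hr2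
      simp [hw k 1 hiL', (hw (!k) 0 (Nat.zero_le _)).symm,
        (h.cross_ne (show (!k) ≠ k by simp) (Nat.zero_le _) le_rfl hiL').symm]
    · obtain ⟨i, rfl⟩ : ∃ j, i = j + 1 := ⟨i - 1, by omega⟩
      refine hdeg (f k (i + 1)) (f k (i + 2)) w (f k i) ?_ hn1 (hw k _ hi).symm
        (h.ne_of_lt (Nat.lt_succ_self i) hi) h3 hwi ?_
      · simp [hw k (i + 2) hiL', (hw k i (by omega)).symm,
          (h.ne_of_lt (show i < i + 2 by omega) hiL').symm]
      · rw [h.adj k i (by omega)]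
        norm_num

end CoxeterMatrix

namespace CoxeterSystem

theorem isFactorizableType_or_isRemainingType {B W : Type*} [Finite B] [Group W] [Finite W]
    {M : CoxeterMatrix B} (cs : CoxeterSystem M W) (hM : M.IsIrreducible) :
    M.IsFactorizableType ∨ M.IsRemainingType := by
  classical
  have := Fintype.ofFinite B
  exact CoxeterMatrix.IsPosDef.classification (fun _ hx => geomCartan_posDef cs hM hx) hM

end CoxeterSystem

/-! ### Groups that are unions of two or three double cosets. -/

section DoubleCosets

variable {G : Type*} [Group G]

/-- To show that every element of `⟨P, s⟩` has a property it suffices that the property is stable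
under right multiplication by `P` and by the involution `s`. -/
theorem Subgroup.closure_insert_induction {P : Subgroup G} {s : G} (hs : s * s = 1)
    {p : G → Prop} (one : p 1) (mul_mem : ∀ g, p g → ∀ a ∈ P, p (g * a))
    (mul_gen : ∀ g, p g → p (g * s)) {g : G}
    (hg : g ∈ Subgroup.closure (insert s (P : Set G))) : p g := by
  have hs' : s⁻¹ = s := inv_eq_of_mul_eq_one_left hs
  induction hg using Subgroup.closure_induction_right with
  | one => exact one
  | mul_right x hx y hy ih =>
    rcases hy with rfl | hy
    · exact mul_gen _ ih
    · exact mul_mem _ ih _ hy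
  | mul_inv_cancel x hx y hy ih =>
    rcases hy with rfl | hy
    · rw [hs']
      exact mul_gen _ ih
    · exact mul_mem _ ih _ (P.inv_mem hy)

/-- `P` is the union of `Q` and `Q t Q`. -/
def IsRankTwo (P Q : Subgroup G) (t : G) : Prop :=
  Q ≤ P ∧ t ∈ P ∧ ∀ p ∈ P, p ∈ Q ∨ ∃ a ∈ Q, ∃ b ∈ Q, p = a * t * b

theorem isRankTwo_bot {s : G} (hs : s * s = 1) :
    IsRankTwo (Subgroup.closure (insert s ((⊥ : Subgroup G) : Set G))) ⊥ s := by
  refine ⟨bot_le, Subgroup.subset_closure (Set.mem_insert _ _), fun p hp => ?_⟩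
  have : p = 1 ∨ p = s := by
    refine Subgroup.closure_insert_induction (p := fun g => g = 1 ∨ g = s) hs (Or.inl rfl) ?_ ?_ hp
    · intro g hg a ha
      rw [Subgroup.mem_bot.mp ha, mul_one]
      exact hg
    · rintro g (rfl | rfl)
      · exact Or.inr (one_mul _)
      · exact Or.inl hs
  rcases this with rfl | rfl
  · exact Or.inl (Subgroup.mem_bot.mpr rfl)
  · exact Or.inr ⟨1, Subgroup.mem_bot.mpr rfl, 1, Subgroup.mem_bot.mpr rfl, by simp⟩

/-- Since `s` commutes with `Q`, conjugating `Q t Q` by `s` gives `Q (s t s) Q = Q (t s t) Q`, which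
lies in `P s P`. This is the inductive step that makes symmetric groups doubly transitive. -/
theorem IsRankTwo.step {P Q : Subgroup G} {s t : G} (h : IsRankTwo P Q t) (hs : s * s = 1)
    (hsQ : ∀ q ∈ Q, s * q = q * s) (hst : s * t * s = t * s * t) :
    IsRankTwo (Subgroup.closure (insert s (P : Set G))) P s := by
  obtain ⟨hQP, htP, hP⟩ := h
  refine ⟨fun p hp => Subgroup.subset_closure (Set.mem_insert_of_mem _ hp),
    Subgroup.subset_closure (Set.mem_insert _ _), fun g hg => ?_⟩
  refine Subgroup.closure_insert_induction
    (p := fun g => g ∈ P ∨ ∃ a ∈ P, ∃ b ∈ P, g = a * s * b) hs (Or.inl P.one_mem) ?_ ?_ hg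
  · rintro g (hg | ⟨a, ha, b, hb, rfl⟩) c hc
    · exact Or.inl (P.mul_mem hg hc)
    · exact Or.inr ⟨a, ha, b * c, P.mul_mem hb hc, by simp only [mul_assoc]⟩
  · rintro g (hg | ⟨a, ha, b, hb, rfl⟩)
    · exact Or.inr ⟨g, hg, 1, P.one_mem, by simp⟩
    · rcases hP b hb with hb | ⟨c, hc, d, hd, rfl⟩
      · left
        rw [mul_assoc, ← hsQ b hb, ← mul_assoc, mul_assoc a, hs, mul_one]
        exact P.mul_mem ha (hQP hb)
      · right
        refine ⟨a * c * t, P.mul_mem (P.mul_mem ha (hQP hc)) htP, t * d,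
          P.mul_mem htP (hQP hd), ?_⟩
        calc a * s * (c * t * d) * s = a * (s * c) * t * (d * s) := by simp only [mul_assoc]
          _ = a * c * (s * t * s) * d := by rw [hsQ c hc, ← hsQ d hd]; simp only [mul_assoc]
          _ = a * c * t * s * (t * d) := by rw [hst]; simp only [mul_assoc]

/-- `P` is the union of `Q`, `Q t Q` and `Q (t w t) Q`, with `w ∈ Q` and `t w t` normalizing
`Q`. -/
def IsRankThree (P Q : Subgroup G) (t w : G) : Prop :=
  Q ≤ P ∧ t ∈ P ∧ w ∈ Q ∧ (∀ q ∈ Q, (t * w * t) * q * (t * w * t)⁻¹ ∈ Q) ∧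
    ∀ p ∈ P, p ∈ Q ∨ (∃ a ∈ Q, ∃ b ∈ Q, p = a * t * b) ∨ ∃ a ∈ Q, ∃ b ∈ Q, p = a * (t * w * t) * b

theorem isRankThree_closure {P : Subgroup G} {s w : G} (hs : s * s = 1) (hw : w ∈ P)
    (hnorm : ∀ p ∈ P, (s * w * s) * p * (s * w * s)⁻¹ ∈ P)
    (hP : ∀ p ∈ P, s * p * s ∈ P ∨ (∃ a ∈ P, ∃ b ∈ P, s * p * s = a * s * b) ∨
      ∃ a ∈ P, ∃ b ∈ P, s * p * s = a * (s * w * s) * b) :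
    IsRankThree (Subgroup.closure (insert s (P : Set G))) P s w := by
  refine ⟨fun p hp => Subgroup.subset_closure (Set.mem_insert_of_mem _ hp),
    Subgroup.subset_closure (Set.mem_insert _ _), hw, hnorm, fun g hg => ?_⟩
  refine Subgroup.closure_insert_induction (p := fun g => g ∈ P ∨
    (∃ a ∈ P, ∃ b ∈ P, g = a * s * b) ∨ ∃ a ∈ P, ∃ b ∈ P, g = a * (s * w * s) * b) hs
    (Or.inl P.one_mem) ?_ ?_ hg
  · rintro g (hg | ⟨a, ha, b, hb, rfl⟩ | ⟨a, ha, b, hb, rfl⟩) c hc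
    · exact Or.inl (P.mul_mem hg hc)
    · exact Or.inr (Or.inl ⟨a, ha, b * c, P.mul_mem hb hc, by simp only [mul_assoc]⟩)
    · exact Or.inr (Or.inr ⟨a, ha, b * c, P.mul_mem hb hc, by simp only [mul_assoc]⟩)
  · rintro g (hg | ⟨a, ha, b, hb, rfl⟩ | ⟨a, ha, b, hb, rfl⟩)
    · exact Or.inr (Or.inl ⟨g, hg, 1, P.one_mem, by simp⟩)
    · have e : a * s * b * s = a * (s * b * s) := by simp only [mul_assoc]
      rw [e]
      rcases hP b hb with h | ⟨c, hc, d, hd, h⟩ | ⟨c, hc, d, hd, h⟩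
      · exact Or.inl (P.mul_mem ha h)
      · exact Or.inr (Or.inl ⟨a * c, P.mul_mem ha hc, d, hd, by rw [h]; simp only [mul_assoc]⟩)
      · exact Or.inr (Or.inr ⟨a * c, P.mul_mem ha hc, d, hd, by rw [h]; simp only [mul_assoc]⟩)
    · refine Or.inr (Or.inl ⟨a * ((s * w * s) * b * (s * w * s)⁻¹), P.mul_mem ha (hnorm b hb), w,
        hw, ?_⟩)
      have hs' : s⁻¹ = s := inv_eq_of_mul_eq_one_left hs
      simp only [mul_inv_rev, hs', mul_assoc]
      rw [← mul_assoc s s, hs, one_mul, inv_mul_cancel, mul_one]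

/-- In the model of signed permutations, `Q` fixes a vector `e`, `t w t` sends `e` to `-e`, and the
three double cosets are the `Q`-orbits of `e`, of `-e` and of the other `±eᵢ`. The step adds a
coordinate. -/
theorem IsRankThree.step {P Q : Subgroup G} {s t w : G} (h : IsRankThree P Q t w)
    (hs : s * s = 1) (ht : t * t = 1) (hsQ : ∀ q ∈ Q, s * q = q * s)
    (hst : s * t * s = t * s * t) :
    IsRankThree (Subgroup.closure (insert s (P : Set G))) P s (t * w * t) := by
  obtain ⟨hQP, htP, hw, hnorm, hP⟩ := h
  have hs' : s⁻¹ = s := inv_eq_of_mul_eq_one_left hs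
  have ht' : t⁻¹ = t := inv_eq_of_mul_eq_one_left ht
  have hw'P : t * w * t ∈ P := P.mul_mem (P.mul_mem htP (hQP hw)) htP
  have hconjQ : ∀ q ∈ Q, s * q * s = q := fun q hq => by
    rw [hsQ q hq, mul_assoc, hs, mul_one]
  refine isRankThree_closure hs hw'P ?_ ?_
  · set v := t * w * t with hv
    have hQ : ∀ q ∈ Q, (s * v * s) * q * (s * v * s)⁻¹ ∈ Q := by
      intro q hq
      have : (s * v * s) * q * (s * v * s)⁻¹ = v * q * v⁻¹ := by
        calc (s * v * s) * q * (s * v * s)⁻¹ = s * (v * (s * q * s) * v⁻¹) * s := by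
              simp only [mul_inv_rev, hs', mul_assoc]
          _ = v * q * v⁻¹ := by rw [hconjQ q hq, hconjQ _ (hnorm q hq)]
      rw [this]
      exact hnorm q hq
    -- As `P` is generated by `t` and `Q` up to the double cosets, it remains to conjugate `t`. The
    -- braid relation and the commutation of `s` with `w` show that `t` commutes with `s v s`.
    have ht2 : (s * v * s) * t * (s * v * s)⁻¹ = t := by
      have hvi : v⁻¹ = t * w⁻¹ * t := by rw [hv]; simp only [mul_inv_rev, ht', mul_assoc]
      have hvt : v * t = t * w := by rw [hv, mul_assoc, ht, mul_one]
      calc (s * v * s) * t * (s * v * s)⁻¹ = s * v * (s * t * s) * v⁻¹ * s := by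
            simp only [mul_inv_rev, hs', mul_assoc]
        _ = s * (v * t) * s * (t * t) * w⁻¹ * t * s := by
            rw [hst, hvi]; simp only [mul_assoc]
        _ = s * t * (w * (s * w⁻¹)) * t * s := by
            rw [hvt, ht, mul_one]; simp only [mul_assoc]
        _ = s * t * s * t * s := by
            rw [hsQ _ (Q.inv_mem hw), ← mul_assoc w, mul_inv_cancel, one_mul]
        _ = t := by
            rw [hst, mul_assoc (t * s), ht, mul_one, mul_assoc, hs, mul_one]
    have hmul : ∀ x y, (s * v * s) * (x * y) * (s * v * s)⁻¹ =
        ((s * v * s) * x * (s * v * s)⁻¹) * ((s * v * s) * y * (s * v * s)⁻¹) := by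
      intro x y
      group
    intro p hp
    have hv2 : (s * v * s) * (t * w * t) * (s * v * s)⁻¹ ∈ P := by
      rw [hmul, hmul, ht2]
      exact P.mul_mem (P.mul_mem htP (hQP (hQ w hw))) htP
    rcases hP p hp with h | ⟨a, ha, b, hb, rfl⟩ | ⟨a, ha, b, hb, rfl⟩
    · exact hQP (hQ p h)
    · rw [hmul, hmul, ht2]
      exact P.mul_mem (P.mul_mem (hQP (hQ a ha)) htP) (hQP (hQ b hb))
    · rw [hmul, hmul]
      exact P.mul_mem (P.mul_mem (hQP (hQ a ha)) hv2) (hQP (hQ b hb))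
  · intro p hp
    have hmid : ∀ a ∈ Q, ∀ b ∈ Q, ∀ x, s * (a * x * b) * s = a * (s * x * s) * b := by
      intro a ha b hb x
      calc s * (a * x * b) * s = (s * a) * x * (b * s) := by simp only [mul_assoc]
        _ = a * (s * x * s) * b := by rw [hsQ a ha, ← hsQ b hb]; simp only [mul_assoc]
    rcases hP p hp with h | ⟨a, ha, b, hb, rfl⟩ | ⟨a, ha, b, hb, rfl⟩
    · left
      rw [hconjQ p h]
      exact hp
    · refine Or.inr (Or.inl ⟨a * t, P.mul_mem (hQP ha) htP, t * b, P.mul_mem htP (hQP hb), ?_⟩)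
      rw [hmid a ha b hb, hst]
      simp only [mul_assoc]
    · exact Or.inr (Or.inr ⟨a, hQP ha, b, hQP hb, hmid a ha b hb _⟩)

theorem isProductOfThreeConjugates_of_forall {P : Subgroup G} (g : G)
    (h : ∀ w : G, ∃ a ∈ P, ∃ b ∈ P, ∃ c ∈ P, w = a * (g * b * g⁻¹) * c) :
    IsProductOfThreeConjugates P := by
  refine ⟨1, g, 1, Set.eq_univ_of_forall fun w => ?_⟩
  obtain ⟨a, ha, b, hb, c, hc, rfl⟩ := h w
  refine Set.mul_mem_mul (Set.mul_mem_mul ?_ ?_) ?_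
  · simpa using ha
  · exact Subgroup.smul_mem_pointwise_smul b (MulAut.conj g) P hb
  · simpa using hc

/-- From `s t s = t s t` follows `s = t (s t s) t`, so the coset `P s P` is contained in `P (s P s)
P`, and so is `P`. -/
theorem IsRankTwo.isProductOfThreeConjugates {P : Subgroup G} {s t : G}
    (h : IsRankTwo ⊤ P s) (hs : s * s = 1) (ht : t * t = 1) (htP : t ∈ P)
    (hst : s * t * s = t * s * t) : IsProductOfThreeConjugates P := by
  have hs' : s⁻¹ = s := inv_eq_of_mul_eq_one_left hs
  refine isProductOfThreeConjugates_of_forall s fun w => ?_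
  rw [hs']
  rcases h.2.2 w trivial with h | ⟨a, ha, b, hb, rfl⟩
  · exact ⟨w, h, 1, P.one_mem, 1, P.one_mem, by simp [hs]⟩
  · refine ⟨a * t, P.mul_mem ha htP, t, htP, t * b, P.mul_mem htP hb, ?_⟩
    rw [hst]
    calc a * s * b = a * (t * t) * s * (t * t) * b := by simp [ht]
      _ = _ := by simp only [mul_assoc]

/-- The first two double cosets are reached as in rank two; the third is represented by `s w s`,
itself an element of `s P s`. -/
theorem IsRankThree.isProductOfThreeConjugates {P : Subgroup G} {s t w : G}
    (h : IsRankThree ⊤ P s w) (hs : s * s = 1) (ht : t * t = 1) (htP : t ∈ P)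
    (hst : s * t * s = t * s * t) : IsProductOfThreeConjugates P := by
  have hs' : s⁻¹ = s := inv_eq_of_mul_eq_one_left hs
  refine isProductOfThreeConjugates_of_forall s fun x => ?_
  rw [hs']
  obtain ⟨-, -, hw, -, hP⟩ := h
  rcases hP x trivial with h | ⟨a, ha, b, hb, rfl⟩ | ⟨a, ha, b, hb, rfl⟩
  · exact ⟨x, h, 1, P.one_mem, 1, P.one_mem, by simp [hs]⟩
  · refine ⟨a * t, P.mul_mem ha htP, t, htP, t * b, P.mul_mem htP hb, ?_⟩
    rw [hst]
    calc a * s * b = a * (t * t) * s * (t * t) * b := by simp [ht]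
      _ = _ := by simp only [mul_assoc]
  · exact ⟨a, ha, w, hw, b, hb, rfl⟩

end DoubleCosets

/-! ### Standard parabolic subgroups. -/

namespace CoxeterSystem

variable {B W : Type*} [Group W] {M : CoxeterMatrix B} (cs : CoxeterSystem M W)

theorem simple_mul_comm_of_eq_two {i j : B} (h : M i j = 2) :
    cs.simple i * cs.simple j = cs.simple j * cs.simple i := by
  have h1 := cs.simple_mul_simple_pow i j
  rw [h, pow_two] at h1
  have h2 := eq_inv_of_mul_eq_one_left h1
  rwa [mul_inv_rev, cs.inv_simple, cs.inv_simple] at h2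

theorem simple_braid_of_eq_three {i j : B} (h : M i j = 3) :
    cs.simple i * cs.simple j * cs.simple i = cs.simple j * cs.simple i * cs.simple j := by
  have h1 := cs.simple_mul_simple_pow i j
  rw [h, pow_succ, pow_two] at h1
  have h2 : (cs.simple i * cs.simple j * cs.simple i) *
      (cs.simple j * cs.simple i * cs.simple j) = 1 := by
    rw [← h1]
    simp only [mul_assoc]
  have h3 := eq_inv_of_mul_eq_one_left h2
  simpa only [mul_inv_rev, cs.inv_simple, mul_assoc] using h3

theorem standardParabolic_mono {I J : Set B} (h : I ⊆ J) :
    cs.standardParabolic I ≤ cs.standardParabolic J :=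
  Subgroup.closure_mono (Set.image_mono h)

theorem simple_mem_standardParabolic {I : Set B} {i : B} (hi : i ∈ I) :
    cs.simple i ∈ cs.standardParabolic I :=
  Subgroup.subset_closure (Set.mem_image_of_mem _ hi)

theorem standardParabolic_univ : cs.standardParabolic Set.univ = ⊤ := by
  rw [standardParabolic, Set.image_univ, cs.subgroup_closure_range_simple]

theorem standardParabolic_empty : cs.standardParabolic ∅ = ⊥ := by
  simp [standardParabolic]

theorem standardParabolic_insert (i : B) (I : Set B) :
    cs.standardParabolic (insert i I) =
      Subgroup.closure (insert (cs.simple i) (cs.standardParabolic I : Set W)) := by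
  rw [Set.insert_eq (cs.simple i), Subgroup.closure_union, Subgroup.closure_eq, standardParabolic,
    Set.image_insert_eq, Set.insert_eq, Subgroup.closure_union, standardParabolic]

theorem simple_mul_comm_of_mem_standardParabolic {I : Set B} {i : B} (h : ∀ j ∈ I, M i j = 2)
    {q : W} (hq : q ∈ cs.standardParabolic I) : cs.simple i * q = q * cs.simple i := by
  have : cs.standardParabolic I ≤ Subgroup.centralizer {cs.simple i} := by
    rw [standardParabolic, Subgroup.closure_le]
    rintro _ ⟨j, hj, rfl⟩
    exact Subgroup.mem_centralizer_singleton_iff.mpr (cs.simple_mul_comm_of_eq_two (h j hj)).symm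
  exact (Subgroup.mem_centralizer_singleton_iff.mp (this hq)).symm

/-- The generators in `I` do not change the `i`-th coordinate of the geometric representation,
whereas `s i` negates it on the `i`-th basis vector. -/
theorem standardParabolic_ne_top [Finite B] {I : Set B} {i : B} (hi : i ∉ I) :
    cs.standardParabolic I ≠ ⊤ := by
  classical
  have := Fintype.ofFinite B
  intro h
  have key : ∀ w ∈ cs.standardParabolic I, ∀ x : B → ℝ, cs.geomRep w x i = x i := by
    intro w hw
    refine Subgroup.closure_induction (p := fun w _ => ∀ x : B → ℝ, cs.geomRep w x i = x i)
      ?_ ?_ ?_ ?_ hw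
    · rintro _ ⟨j, hj, rfl⟩ x
      have hij : i ≠ j := fun e => hi (e ▸ hj)
      simp [cs.geomRep_simple_apply, hij]
    · intro x
      simp
    · intro u v _ _ hu hv x
      rw [map_mul, LinearEquiv.mul_apply, hu, hv]
    · intro u _ hu x
      have := hu (cs.geomRep u⁻¹ x)
      rw [← this, ← LinearEquiv.mul_apply, ← map_mul, mul_inv_cancel, map_one]
      simp
  have h1 := key (cs.simple i) (h ▸ Subgroup.mem_top _) (Pi.single i 1)
  rw [cs.geomRep_simple_apply, M.geomCoroot_single_self] at h1
  norm_num at h1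

end CoxeterSystem

/-! ### Factorizations for the types `A`, `B` and `D`. -/

namespace CoxeterSystem

variable {B W : Type*} [Group W] {M : CoxeterMatrix B} (cs : CoxeterSystem M W)

/-- Some proper standard parabolic subgroup has three conjugates whose product is the group. -/
def HasFactorization : Prop :=
  ∃ I : Set B, cs.standardParabolic I ≠ ⊤ ∧ IsProductOfThreeConjugates (cs.standardParabolic I)

theorem reindex_standardParabolic {B' : Type*} (e : B ≃ B') (I : Set B') :
    (cs.reindex e).standardParabolic I = cs.standardParabolic (e.symm '' I) := by
  rw [standardParabolic, standardParabolic, ← Set.image_comp]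
  rfl

theorem hasFactorization_of_isOfType {B' : Type*} {N : CoxeterMatrix B'} (h : M.IsOfType N)
    (hN : ∀ cs' : CoxeterSystem N W, cs'.HasFactorization) : cs.HasFactorization := by
  obtain ⟨e, rfl⟩ := h
  obtain ⟨I, h1, h2⟩ := hN (cs.reindex e)
  rw [reindex_standardParabolic] at h1 h2
  exact ⟨_, h1, h2⟩

theorem HasFactorization.exists_isParabolic {cs : CoxeterSystem M W} (h : cs.HasFactorization) :
    ∃ P : Subgroup W, cs.IsParabolic P ∧ P ≠ ⊤ ∧ IsProductOfThreeConjugates P := by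
  obtain ⟨I, h1, h2⟩ := h
  exact ⟨_, ⟨I, 1, by simp⟩, h1, h2⟩

section Chain

variable {pos : B → ℕ}

theorem standardParabolic_lt_succ (hinj : Function.Injective pos) (i : B) :
    cs.standardParabolic {b | pos b < pos i + 1} = Subgroup.closure
      (insert (cs.simple i) (cs.standardParabolic {b | pos b < pos i} : Set W)) := by
  rw [← standardParabolic_insert]
  congr 1
  ext b
  simp only [Set.mem_ofPred_eq, Set.mem_insert_iff, Nat.lt_succ_iff, le_iff_eq_or_lt,
    hinj.eq_iff]

/-- The function `pos` orders the generators along a path with all labels `3`, its values forming an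
initial segment of `ℕ`; adding them in this order repeats `IsRankTwo.step`. -/
theorem isRankTwo_chain (hinj : Function.Injective pos)
    (hpos : ∀ i, ∀ k < pos i, ∃ j, pos j = k)
    (hcomm : ∀ i j, pos i + 2 ≤ pos j → M i j = 2)
    (hbraid : ∀ i j, pos j = pos i + 1 → M i j = 3) (k : ℕ) :
    ∀ i, pos i = k → IsRankTwo (cs.standardParabolic {b | pos b < pos i + 1})
      (cs.standardParabolic {b | pos b < pos i}) (cs.simple i) := by
  induction k with
  | zero =>
    intro i hi
    rw [standardParabolic_lt_succ cs hinj, hi]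
    simp only [Nat.not_lt_zero, Set.ofPred_false, standardParabolic_empty]
    exact isRankTwo_bot (cs.simple_mul_simple_self i)
  | succ k ih =>
    intro j hj
    obtain ⟨i, hi⟩ := hpos j k (by omega)
    have h := ih i hi
    rw [standardParabolic_lt_succ cs hinj]
    rw [hi, ← hj] at h
    refine h.step (cs.simple_mul_simple_self j) ?_ ?_
    · intro q hq
      refine cs.simple_mul_comm_of_mem_standardParabolic (fun l hl => ?_) hq
      rw [M.symmetric]
      have : pos l < k := hl
      exact hcomm l j (by omega)
    · exact (cs.simple_braid_of_eq_three (hbraid i j (by omega))).symm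

/-- Beyond position `k₀` the diagram is a simple path, so only the small group at `k₀` depends on
the type. -/
theorem isRankThree_chain (hinj : Function.Injective pos)
    (hpos : ∀ i, ∀ k < pos i, ∃ j, pos j = k) (k₀ : ℕ)
    (hcomm : ∀ i j, k₀ < pos j → pos i + 2 ≤ pos j → M i j = 2)
    (hbraid : ∀ i j, k₀ < pos j → pos j = pos i + 1 → M i j = 3)
    (hbase : ∀ i, pos i = k₀ → ∃ w, IsRankThree (cs.standardParabolic {b | pos b < pos i + 1})
      (cs.standardParabolic {b | pos b < pos i}) (cs.simple i) w) (k : ℕ) (hk : k₀ ≤ k) :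
    ∀ i, pos i = k → ∃ w, IsRankThree (cs.standardParabolic {b | pos b < pos i + 1})
      (cs.standardParabolic {b | pos b < pos i}) (cs.simple i) w := by
  induction k, hk using Nat.le_induction with
  | base => exact hbase
  | succ k hk ih =>
    intro j hj
    obtain ⟨i, hi⟩ := hpos j k (by omega)
    obtain ⟨w, h⟩ := ih i hi
    rw [standardParabolic_lt_succ cs hinj]
    rw [hi, ← hj] at h
    refine ⟨_, h.step (cs.simple_mul_simple_self j) (cs.simple_mul_simple_self i) ?_ ?_⟩
    · intro q hq
      refine cs.simple_mul_comm_of_mem_standardParabolic (fun l hl => ?_) hq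
      rw [M.symmetric]
      have : pos l < k := hl
      exact hcomm l j (by omega) (by omega)
    · exact (cs.simple_braid_of_eq_three (hbraid i j (by omega) (by omega))).symm

theorem hasFactorization_of_isRankTwo [Finite B] {i j : B} (h : M i j = 3)
    (hij : pos i < pos j) (hj : ∀ b, pos b < pos j + 1)
    (h2 : IsRankTwo (cs.standardParabolic {b | pos b < pos j + 1})
      (cs.standardParabolic {b | pos b < pos j}) (cs.simple j)) : cs.HasFactorization := by
  refine ⟨{b | pos b < pos j}, cs.standardParabolic_ne_top (i := j) (by simp), ?_⟩
  simp only [hj, Set.ofPred_true, standardParabolic_univ] at h2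
  exact h2.isProductOfThreeConjugates (cs.simple_mul_simple_self j) (cs.simple_mul_simple_self i)
    (cs.simple_mem_standardParabolic hij) (cs.simple_braid_of_eq_three h).symm

theorem hasFactorization_of_isRankThree [Finite B] {i j : B} (h : M i j = 3)
    (hij : pos i < pos j) (hj : ∀ b, pos b < pos j + 1) {w : W}
    (h2 : IsRankThree (cs.standardParabolic {b | pos b < pos j + 1})
      (cs.standardParabolic {b | pos b < pos j}) (cs.simple j) w) : cs.HasFactorization := by
  refine ⟨{b | pos b < pos j}, cs.standardParabolic_ne_top (i := j) (by simp), ?_⟩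
  simp only [hj, Set.ofPred_true, standardParabolic_univ] at h2
  exact h2.isProductOfThreeConjugates (cs.simple_mul_simple_self j) (cs.simple_mul_simple_self i)
    (cs.simple_mem_standardParabolic hij) (cs.simple_braid_of_eq_three h).symm

end Chain

theorem hasFactorization_A {n : ℕ} (hn : 2 ≤ n) (cs : CoxeterSystem (CoxeterMatrix.A n) W) :
    cs.HasFactorization := by
  have hcomm : ∀ i j : Fin n, (i : ℕ) + 2 ≤ j → CoxeterMatrix.A n i j = 2 := by
    intro i j h
    have : i ≠ j := fun e => by omega
    simp only [CoxeterMatrix.A, Matrix.of_apply, this, if_false]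
    rw [if_neg (by omega)]
  have hbraid : ∀ i j : Fin n, (j : ℕ) = i + 1 → CoxeterMatrix.A n i j = 3 := by
    intro i j h
    have : i ≠ j := fun e => by omega
    simp only [CoxeterMatrix.A, Matrix.of_apply, this, if_false]
    rw [if_pos (by omega)]
  refine cs.hasFactorization_of_isRankTwo (pos := Fin.val) (i := ⟨n - 2, by omega⟩)
    (j := ⟨n - 1, by omega⟩) (hbraid _ _ (by simp; omega)) (by simp; omega)
    (fun b => by simp; omega) (cs.isRankTwo_chain Fin.val_injective ?_ hcomm hbraid _ _ rfl)
  exact fun i k hk => ⟨⟨k, by omega⟩, rfl⟩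

theorem eq_one_or_eq_of_mem {pos : B → ℕ} (hinj : Function.Injective pos) {c : B}
    (hc : pos c = 0) {p : W} (hp : p ∈ cs.standardParabolic {b | pos b < 1}) :
    p = 1 ∨ p = cs.simple c := by
  have : cs.standardParabolic {b | pos b < 1} ≤ Subgroup.zpowers (cs.simple c) := by
    rw [standardParabolic, Subgroup.closure_le]
    rintro _ ⟨b, hb, rfl⟩
    have hb' : pos b < 1 := hb
    have : b = c := hinj (by omega)
    rw [this]
    exact Subgroup.mem_zpowers _
  obtain ⟨k, rfl⟩ := Subgroup.mem_zpowers_iff.mp (this hp)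
  rcases Int.even_or_odd' k with ⟨m, rfl | rfl⟩
  · left
    rw [zpow_mul]
    simp
  · right
    rw [zpow_add, zpow_mul]
    simp

/-- Numbering from the end with label `4` makes the base case the dihedral group generated by `c`
and `t`, with `Q = {1, c}`. Since `(t c)⁴ = 1`, the element `t c t` commutes with `c`. -/
theorem hasFactorization_B {n : ℕ} (hn : 3 ≤ n) (cs : CoxeterSystem (CoxeterMatrix.B n) W) :
    cs.HasFactorization := by
  set pos : Fin n → ℕ := fun i => n - 1 - i with hposdef
  have hinj : Function.Injective pos := by
    intro i j h
    simp only [hposdef] at h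
    ext
    omega
  have hcomm : ∀ i j : Fin n, 1 < pos j → pos i + 2 ≤ pos j → CoxeterMatrix.B n i j = 2 := by
    intro i j h1 h
    simp only [hposdef] at h h1
    have : i ≠ j := fun e => by subst e; omega
    simp only [CoxeterMatrix.B, Matrix.of_apply, this, if_false]
    rw [if_neg (by omega), if_neg (by omega)]
  have hbraid : ∀ i j : Fin n, 1 < pos j → pos j = pos i + 1 → CoxeterMatrix.B n i j = 3 := by
    intro i j h1 h
    simp only [hposdef] at h h1
    have : i ≠ j := fun e => by subst e; omega
    simp only [CoxeterMatrix.B, Matrix.of_apply, this, if_false]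
    rw [if_neg (by omega), if_pos (by omega)]
  have hbase : ∀ i, pos i = 1 → ∃ w, IsRankThree (cs.standardParabolic {b | pos b < pos i + 1})
      (cs.standardParabolic {b | pos b < pos i}) (cs.simple i) w := by
    intro t ht
    set c : Fin n := ⟨n - 1, by omega⟩ with hc
    have hc0 : pos c = 0 := by simp [hposdef, hc]
    have hm : CoxeterMatrix.B n t c = 4 := by
      simp only [hposdef] at ht
      have : t ≠ c := fun e => by rw [e] at ht; simp [hc] at ht
      simp only [CoxeterMatrix.B, Matrix.of_apply, this, if_false]
      rw [if_pos]
      right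
      refine ⟨rfl, by omega⟩
    have hm' := cs.simple_mul_simple_pow t c
    rw [hm] at hm'
    rw [standardParabolic_lt_succ cs hinj, ht]
    have hmem : cs.simple c ∈ cs.standardParabolic {b | pos b < 1} :=
      cs.simple_mem_standardParabolic (by simp [hc0])
    refine ⟨cs.simple c, isRankThree_closure (cs.simple_mul_simple_self t) hmem ?_ ?_⟩
    · intro p hp
      rcases cs.eq_one_or_eq_of_mem hinj hc0 hp with rfl | rfl
      · rw [mul_one, mul_inv_cancel]
        exact Subgroup.one_mem _
      · have h3 : cs.simple t * cs.simple c * cs.simple t * cs.simple c *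
            (cs.simple t * cs.simple c * cs.simple t)⁻¹ = cs.simple c := by
          rw [mul_inv_eq_iff_eq_mul, ← mul_inv_eq_one]
          simp only [mul_inv_rev, cs.inv_simple]
          rw [← hm']
          simp only [pow_succ, pow_zero, one_mul, mul_assoc]
        rw [h3]
        exact hmem
    · intro p hp
      rcases cs.eq_one_or_eq_of_mem hinj hc0 hp with rfl | rfl
      · simp
      · exact Or.inr (Or.inr ⟨1, Subgroup.one_mem _, 1, Subgroup.one_mem _, by simp⟩)
  have hpos : ∀ i, ∀ k < pos i, ∃ j, pos j = k := by
    intro i k hk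
    simp only [hposdef] at hk
    exact ⟨⟨n - 1 - k, by omega⟩, by simp only [hposdef]; omega⟩
  obtain ⟨w, hw⟩ := cs.isRankThree_chain hinj hpos 1 hcomm hbraid hbase (n - 1) (by omega)
    ⟨0, by omega⟩ (by simp [hposdef])
  exact cs.hasFactorization_of_isRankThree (i := ⟨1, by omega⟩)
    (hbraid _ _ (by simp [hposdef]; omega) (by simp [hposdef]; omega))
    (by simp [hposdef]; omega) (fun b => by simp only [hposdef]; omega) hw

/-- The base case is the fork with prongs `a`, `b` and centre `i`. Here `Q = {1, a, b, ab}`, and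
conjugation by `i (ab) i` interchanges `a` and `b`, hence normalizes `Q`. -/
theorem hasFactorization_D {n : ℕ} (hn : 4 ≤ n) (cs : CoxeterSystem (CoxeterMatrix.typeD n) W) :
    cs.HasFactorization := by
  have hcomm : ∀ i j : Fin n, 2 < (j : ℕ) → (i : ℕ) + 2 ≤ j → CoxeterMatrix.typeD n i j = 2 := by
    intro i j h1 h
    have : i ≠ j := fun e => by subst e; omega
    simp only [CoxeterMatrix.typeD, Matrix.of_apply, this, if_false]
    rw [if_neg (by omega)]
  have hbraid : ∀ i j : Fin n, 2 < (j : ℕ) → (j : ℕ) = i + 1 →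
      CoxeterMatrix.typeD n i j = 3 := by
    intro i j h1 h
    have : i ≠ j := fun e => by subst e; omega
    simp only [CoxeterMatrix.typeD, Matrix.of_apply, this, if_false]
    rw [if_pos (by omega)]
  have hbase : ∀ i : Fin n, (i : ℕ) = 2 →
      ∃ w, IsRankThree (cs.standardParabolic {b : Fin n | (b : ℕ) < i + 1})
        (cs.standardParabolic {b : Fin n | (b : ℕ) < i}) (cs.simple i) w := by
    intro i hi
    set a : Fin n := ⟨0, by omega⟩ with ha
    set b : Fin n := ⟨1, by omega⟩ with hb
    have hia : CoxeterMatrix.typeD n a i = 3 := by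
      have : a ≠ i := fun e => by rw [← e] at hi; simp [ha] at hi
      simp only [CoxeterMatrix.typeD, Matrix.of_apply, this, if_false]
      rw [if_pos (by simp [ha]; omega)]
    have hib : CoxeterMatrix.typeD n b i = 3 := by
      have : b ≠ i := fun e => by rw [← e] at hi; simp [hb] at hi
      simp only [CoxeterMatrix.typeD, Matrix.of_apply, this, if_false]
      rw [if_pos (by simp [hb]; omega)]
    have hab : CoxeterMatrix.typeD n a b = 2 := by
      simp [CoxeterMatrix.typeD, ha, hb]
    have eab := cs.simple_mul_comm_of_eq_two hab
    have eia := cs.simple_braid_of_eq_three hia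
    have eib := cs.simple_braid_of_eq_three hib
    have sa := cs.simple_mul_simple_self a
    have sb := cs.simple_mul_simple_self b
    have st := cs.simple_mul_simple_self i
    have hJ : (i : ℕ) = (b : ℕ) + 1 := by simp [hi, hb]
    have hma : cs.simple a ∈ cs.standardParabolic {b : Fin n | (b : ℕ) < i} :=
      cs.simple_mem_standardParabolic (by simp [ha, hi])
    have hmb : cs.simple b ∈ cs.standardParabolic {b : Fin n | (b : ℕ) < i} :=
      cs.simple_mem_standardParabolic (by simp [hb, hi])
    have hfour : ∀ p ∈ cs.standardParabolic {b : Fin n | (b : ℕ) < i},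
        p = 1 ∨ p = cs.simple a ∨ p = cs.simple b ∨ p = cs.simple a * cs.simple b := by
      intro p hp
      rw [hJ, standardParabolic_lt_succ cs Fin.val_injective] at hp
      refine Subgroup.closure_insert_induction (p := fun p => p = 1 ∨ p = cs.simple a ∨
        p = cs.simple b ∨ p = cs.simple a * cs.simple b) sb (Or.inl rfl) ?_ ?_ hp
      · intro g hg q hq
        rcases cs.eq_one_or_eq_of_mem Fin.val_injective (show (a : ℕ) = 0 from rfl) hq with
          rfl | rfl
        · rwa [mul_one]
        · rcases hg with rfl | rfl | rfl | rfl
          · simp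
          · simp
          · simp [eab]
          · rw [eab]
            simp
      · rintro g (rfl | rfl | rfl | rfl)
        · simp
        · simp
        · simp
        · simp
    rw [standardParabolic_lt_succ cs Fin.val_injective]
    generalize cs.standardParabolic {b : Fin n | (b : ℕ) < i} = Q at *
    generalize cs.simple a = α at *
    generalize cs.simple b = β at *
    generalize cs.simple i = τ at *
    have hτ : τ⁻¹ = τ := inv_eq_of_mul_eq_one_left st
    have hα : α⁻¹ = α := inv_eq_of_mul_eq_one_left sa
    have hβ : β⁻¹ = β := inv_eq_of_mul_eq_one_left sb
    -- Stated for arbitrary `α` and `β`, so that it can be used again with the two prongs exchanged.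
    have conj1 : ∀ α β : W, α * α = 1 → β * β = 1 → α * β = β * α → α * τ * α = τ * α * τ →
        β * τ * β = τ * β * τ → (τ * (α * β) * τ) * α = β * (τ * (α * β) * τ) := by
      intro α β sa sb eab eia eib
      have e1 : τ * (α * β) * τ = τ * β * τ * (τ * α * τ) := by
        calc τ * (α * β) * τ = τ * β * (τ * τ) * α * τ := by
              rw [st, eab]; simp only [mul_assoc, mul_one]
          _ = _ := by simp only [mul_assoc]
      rw [e1, ← eia, ← eib]
      calc β * τ * β * (α * τ * α) * α = β * (τ * (β * α) * τ) * (α * α) := by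
            simp only [mul_assoc]
        _ = β * (τ * β * (τ * τ) * α * τ) := by
            rw [sa, st]; simp only [mul_assoc, mul_one]
        _ = β * (τ * β * τ * (τ * α * τ)) := by simp only [mul_assoc]
        _ = _ := by rw [← eia, ← eib]
    refine ⟨α * β, isRankThree_closure st (Q.mul_mem hma hmb) ?_ ?_⟩
    · have hA : (τ * (α * β) * τ) * α * (τ * (α * β) * τ)⁻¹ = β := by
        rw [conj1 α β sa sb eab eia eib, mul_inv_cancel_right]
      have hB : (τ * (α * β) * τ) * β * (τ * (α * β) * τ)⁻¹ = α := by
        rw [eab, conj1 β α sb sa eab.symm eib eia, mul_inv_cancel_right]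
      intro p hp
      rcases hfour p hp with rfl | rfl | rfl | rfl
      · rw [mul_one, mul_inv_cancel]
        exact Q.one_mem
      · rw [hA]
        exact hmb
      · rw [hB]
        exact hma
      · rw [← conj_mul, hA, hB]
        exact Q.mul_mem hmb hma
    · intro p hp
      rcases hfour p hp with rfl | rfl | rfl | rfl
      · left
        rw [mul_one, st]
        exact Q.one_mem
      · exact Or.inr (Or.inl ⟨p, hma, p, hma, eia.symm⟩)
      · exact Or.inr (Or.inl ⟨p, hmb, p, hmb, eib.symm⟩)
      · exact Or.inr (Or.inr ⟨1, Q.one_mem, 1, Q.one_mem, by simp⟩)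
  obtain ⟨w, hw⟩ := cs.isRankThree_chain (pos := Fin.val) Fin.val_injective
    (fun i k hk => ⟨⟨k, by omega⟩, rfl⟩) 2 hcomm hbraid hbase (n - 1) (by omega)
    ⟨n - 1, by omega⟩ rfl
  exact cs.hasFactorization_of_isRankThree (i := ⟨n - 2, by omega⟩)
    (hbraid _ _ (by simp; omega) (by simp; omega)) (by simp; omega) (fun b => by simp; omega) hw

end CoxeterSystem

/-! ### Stabilizers of dominant vectors. -/

namespace CoxeterMatrix

variable {B : Type*} (M : CoxeterMatrix B)

theorem geomCartan_of_eq_five {i j : B} (h : M i j = 5) :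
    M.geomCartan i j = -Real.goldenRatio := by
  rw [geomCartan, h]
  norm_num [Real.cos_pi_div_five, Real.goldenRatio]
  ring

end CoxeterMatrix

namespace CoxeterSystem

variable {B W : Type*} [Fintype B] [DecidableEq B] [Group W] {M : CoxeterMatrix B}
  (cs : CoxeterSystem M W)

/-- The elements of `W` obtained from an element of `W_J` by repeated left multiplication by
simple reflections, in such a way that the image of `v` descends strictly in each step. -/
inductive Descends (v : B → ℝ) (J : Set B) : W → Prop
  | base {p : W} (hp : p ∈ cs.standardParabolic J) : Descends v J p
  | step {w : W} (i : B) (hw : Descends v J w) (h : 0 < M.geomCoroot i (cs.geomRep w v)) :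
      Descends v J (cs.simple i * w)

theorem geomRep_eq_of_mem_standardParabolic {v : B → ℝ} {J : Set B}
    (hJ : ∀ j ∈ J, M.geomCoroot j v = 0) {p : W} (hp : p ∈ cs.standardParabolic J) :
    cs.geomRep p v = v := by
  refine Subgroup.closure_induction (p := fun w _ => cs.geomRep w v = v) ?_ ?_ ?_ ?_ hp
  · rintro _ ⟨j, hj, rfl⟩
    rw [cs.geomRep_simple_apply, hJ j hj, zero_smul, sub_zero]
  · simp
  · intro x y _ _ hx hy
    rw [map_mul, LinearEquiv.mul_apply, hy, hx]
  · intro x _ hx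
    nth_rw 1 [← hx]
    rw [← LinearEquiv.mul_apply, ← map_mul, inv_mul_cancel, map_one]
    rfl

theorem sum_geomRep_simple_mul (i : B) (w : W) (v : B → ℝ) :
    ∑ k, cs.geomRep (cs.simple i * w) v k =
      ∑ k, cs.geomRep w v k - M.geomCoroot i (cs.geomRep w v) := by
  rw [map_mul, LinearEquiv.mul_apply, cs.geomRep_simple_apply]
  simp [Finset.sum_sub_distrib, Pi.single_apply]

/-- The step of a walk through the orbit of a rank two standard parabolic subgroup. -/
theorem geomRep_simple_mul_walk {i j : B} {g a : ℝ} (hg : M.geomCartan i j = -g)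
    {y : B → ℝ} (ha : M.geomCoroot i y = -a) {u : W} {v : B → ℝ} {s t : ℝ}
    (hu : cs.geomRep u v = y + s • Pi.single i 1 + t • Pi.single j 1) :
    cs.geomRep (cs.simple i * u) v =
      y + (a - s + g * t) • Pi.single i 1 + t • Pi.single j 1 := by
  rw [map_mul, LinearEquiv.mul_apply, cs.geomRep_simple_apply, hu]
  simp only [map_add, map_smul, M.geomCoroot_single, M.geomCartan_self, ha, hg, smul_eq_mul]
  module

theorem Descends.simple_mul {v : B → ℝ} {J : Set B} [Finite W]
    (hM : ∀ i j, i ≠ j → M i j = 2 ∨ M i j = 3 ∨ M i j = 5)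
    (hv : ∀ i, 0 ≤ M.geomCoroot i v) (hJ : ∀ i, M.geomCoroot i v = 0 ↔ i ∈ J) (j : B) {w : W}
    (hw : cs.Descends v J w) : cs.Descends v J (cs.simple j * w) := by
  let S : W → ℝ := fun w => ∑ k, cs.geomRep w v k
  -- The induction hypothesis is available for elements whose image of `v` has a larger coordinate
  -- sum.
  have wf : WellFounded (fun x y : W => S y < S x) := by
    have : IsTrans W (fun x y : W => S y < S x) := ⟨fun x y z h1 h2 => h2.trans h1⟩
    have : Std.Irrefl (fun x y : W => S y < S x) := ⟨fun x => lt_irrefl _⟩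
    exact Finite.wellFounded_of_trans_of_irrefl _
  induction w using wf.induction generalizing j with
  | _ w ih =>
  rcases lt_or_ge 0 (M.geomCoroot j (cs.geomRep w v)) with hpos | hneg
  · exact .step j hw hpos
  cases hw with
  | base hp =>
    rw [cs.geomRep_eq_of_mem_standardParabolic (fun j hj => (hJ j).mpr hj) hp] at hneg
    have hj : j ∈ J := (hJ j).mp (le_antisymm hneg (hv j))
    exact .base (mul_mem (cs.simple_mem_standardParabolic hj) hp)
  | @step w' i hw' hpos =>
    by_cases hij : i = j
    · subst hij
      rwa [cs.simple_mul_simple_cancel_left]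
    set w := cs.simple i * w' with hwdef
    set y := cs.geomRep w v with hy
    obtain ⟨a, ha⟩ : ∃ a, M.geomCoroot i y = -a := ⟨_, (neg_neg _).symm⟩
    obtain ⟨b, hb⟩ : ∃ b, M.geomCoroot j y = -b := ⟨_, (neg_neg _).symm⟩
    have hb0 : 0 ≤ b := by linarith
    have hw'w : w' = cs.simple i * w := (cs.simple_mul_simple_cancel_left i).symm
    obtain ⟨g, hg⟩ : ∃ g, M.geomCartan i j = -g := ⟨_, (neg_neg _).symm⟩
    have hg' : M.geomCartan j i = -g := by rw [M.geomCartan_symm, hg]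
    have h1 : cs.geomRep w' v = y + a • Pi.single i 1 + (0 : ℝ) • Pi.single j 1 := by
      have := cs.geomRep_simple_mul_walk hg ha (u := w) (v := v) (s := 0) (t := 0) (by simp [hy])
      rw [hw'w]
      simpa using this
    have ha0 : 0 < a := by
      rw [h1] at hpos
      simp only [map_add, map_smul, M.geomCoroot_single, M.geomCartan_self, ha, smul_eq_mul]
        at hpos
      linarith
    -- The element `s j * w` is reached from `w'` the long way round the orbit of the dihedral group
    -- of `i` and `j`. The condition `0 < s + t` says that the current vector lies above that of
    -- `w`, so the induction hypothesis permits the next step.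
    have next : ∀ (k l : B) (c s t : ℝ) (u : W), M.geomCartan k l = -g → M.geomCoroot k y = -c →
        cs.geomRep u v = y + s • Pi.single k 1 + t • Pi.single l 1 → 0 < s + t →
        cs.Descends v J u → cs.Descends v J (cs.simple k * u) ∧ cs.geomRep (cs.simple k * u) v =
          y + t • Pi.single l 1 + (c - s + g * t) • Pi.single k 1 := by
      intro k l c s t u hkl hc hu hst hd
      refine ⟨ih u ?_ k hd, ?_⟩
      · simp only [S, hu, ← hy]
        simp only [Pi.add_apply, Pi.smul_apply, smul_eq_mul, Finset.sum_add_distrib,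
          ← Finset.mul_sum, Finset.mem_univ, if_true, Pi.single_apply,
          Finset.sum_ite_eq']
        linarith
      · rw [cs.geomRep_simple_mul_walk hkl hc hu]
        abel
    have h1' : cs.geomRep w' v = y + (0 : ℝ) • Pi.single j 1 + a • Pi.single i 1 := by
      rw [h1]; abel
    obtain ⟨d2, h2⟩ := next j i b 0 a _ hg' hb h1' (by linarith) hw'
    rcases hM i j hij with hm | hm | hm
    · have : g = 0 := by linarith [M.geomCartan_of_eq_two hm]
      subst this
      obtain ⟨d3, -⟩ := next i j a _ _ _ hg ha h2 (by linarith) d2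
      convert d3 using 1
      rw [hwdef, ← mul_assoc, ← mul_assoc, cs.simple_mul_comm_of_eq_two hm]
    · have : g = 1 := by linarith [M.geomCartan_of_eq_three hm]
      subst this
      obtain ⟨d3, h3⟩ := next i j a _ _ _ hg ha h2 (by linarith) d2
      obtain ⟨d4, h4⟩ := next j i b _ _ _ hg' hb h3 (by linarith) d3
      obtain ⟨d5, -⟩ := next i j a _ _ _ hg ha h4 (by linarith) d4
      convert d5 using 1
      rw [hw'w]
      have := cs.simple_mul_simple_pow i j
      rw [hm] at this
      have e : cs.simple j * w = (cs.simple i * cs.simple j) ^ 3 * (cs.simple j * w) := by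
        rw [this, one_mul]
      rw [e]
      simp only [pow_succ, pow_zero, one_mul, mul_assoc, cs.simple_mul_simple_cancel_left]
    · have : g = Real.goldenRatio := by linarith [M.geomCartan_of_eq_five hm]
      subst this
      set p := Real.goldenRatio with hp
      have hp0 : 0 < p := Real.goldenRatio_pos
      have hp2 : p * p = p + 1 := by rw [← pow_two]; exact Real.goldenRatio_sq
      have hpa : 0 < p * a := mul_pos hp0 ha0
      have hpb : 0 ≤ p * b := mul_nonneg hp0.le hb0
      -- Along the walk, the offsets from `y` are combinations of `a`, `b`, `p * a` and `p * b` with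
      -- nonnegative coefficients, simplified by `p² = p + 1`.
      have e2 : b - 0 + p * a = b + p * a := by ring
      rw [e2] at h2
      obtain ⟨d3, h3⟩ := next i j a _ _ _ hg ha h2 (by linarith) d2
      have e3 : a - a + p * (b + p * a) = a + p * a + p * b := by linear_combination a * hp2
      rw [e3] at h3
      obtain ⟨d4, h4⟩ := next j i b _ _ _ hg' hb h3 (by linarith) d3
      have e4 : b - (b + p * a) + p * (a + p * a + p * b) = a + b + p * a + p * b := by
        linear_combination (a + b) * hp2
      rw [e4] at h4
      obtain ⟨d5, h5⟩ := next i j a _ _ _ hg ha h4 (by linarith) d4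
      have e5 : a - (a + p * a + p * b) + p * (a + b + p * a + p * b) = a + b + p * a + p * b := by
        linear_combination (a + b) * hp2
      rw [e5] at h5
      obtain ⟨d6, h6⟩ := next j i b _ _ _ hg' hb h5 (by linarith) d5
      have e6 : b - (a + b + p * a + p * b) + p * (a + b + p * a + p * b) =
          b + p * a + p * b := by
        linear_combination (a + b) * hp2
      rw [e6] at h6
      obtain ⟨d7, h7⟩ := next i j a _ _ _ hg ha h6 (by linarith) d6
      have e7 : a - (a + b + p * a + p * b) + p * (b + p * a + p * b) = a + p * b := by
        linear_combination (a + b) * hp2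
      rw [e7] at h7
      obtain ⟨d8, h8⟩ := next j i b _ _ _ hg' hb h7 (by linarith) d7
      have e8 : b - (b + p * a + p * b) + p * (a + p * b) = b := by
        linear_combination b * hp2
      rw [e8] at h8
      obtain ⟨d9, -⟩ := next i j a _ _ _ hg ha h8 (by linarith) d8
      convert d9 using 1
      rw [hw'w]
      have := cs.simple_mul_simple_pow i j
      rw [hm] at this
      have e : cs.simple j * w = (cs.simple i * cs.simple j) ^ 5 * (cs.simple j * w) := by
        rw [this, one_mul]
      rw [e]
      simp only [pow_succ, pow_zero, one_mul, mul_assoc, cs.simple_mul_simple_cancel_left]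

/-- The stabilizer of a dominant vector is the standard parabolic subgroup generated by the
simple reflections that fix it. -/
theorem mem_standardParabolic_of_geomRep_eq {v : B → ℝ} {J : Set B} [Finite W]
    (hM : ∀ i j, i ≠ j → M i j = 2 ∨ M i j = 3 ∨ M i j = 5)
    (hv : ∀ i, 0 ≤ M.geomCoroot i v) (hJ : ∀ i, M.geomCoroot i v = 0 ↔ i ∈ J) {w : W}
    (hw : cs.geomRep w v = v) : w ∈ cs.standardParabolic J := by
  have hd : cs.Descends v J w := cs.simple_induction_left w (.base (one_mem _))
    fun w i ih => Descends.simple_mul cs hM hv hJ i ih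
  -- Each descent lowers the coordinate sum, so `v` can return to itself only if no descent took
  -- place.
  have key : w ∈ cs.standardParabolic J ∨ ∑ k, cs.geomRep w v k < ∑ k, v k := by
    clear hw
    induction hd with
    | base hp => exact .inl hp
    | @step w i _ h ih =>
      right
      rw [sum_geomRep_simple_mul]
      rcases ih with hp | h'
      · rw [cs.geomRep_eq_of_mem_standardParabolic (fun j hj => (hJ j).mpr hj) hp] at h ⊢
        linarith
      · linarith
  rcases key with h | h
  · exact h
  · rw [hw] at h
    exact absurd h (lt_irrefl _)

end CoxeterSystem

/-! ### Exact coordinates and a verified orbit search. -/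

section ListModel

variable {R : Type*} [CommRing R]

/-- The dot product of two lists. -/
def listDot : List R → List R → R
  | a :: l, b :: m => a * b + listDot l m
  | _, _ => 0

theorem listDot_eq_sum : ∀ {n : ℕ} {l m : List R}, l.length = n → m.length = n →
    listDot l m = ∑ j : Fin n, l.getD j 0 * m.getD j 0
  | 0, l, m, hl, hm => by
    rw [List.length_eq_zero_iff.mp hl, List.length_eq_zero_iff.mp hm]
    simp [listDot]
  | n + 1, [], m, hl, hm => by simp at hl
  | n + 1, a :: l, [], hl, hm => by simp at hm
  | n + 1, a :: l, b :: m, hl, hm => by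
    rw [Fin.sum_univ_succ, listDot, listDot_eq_sum (n := n) (by simpa using hl) (by simpa using hm)]
    simp

/-- The `i`-th simple reflection, in coordinates, where `A` is the list of the rows of the
Cartan matrix. -/
def listReflection (A : List (List R)) (i : ℕ) (l : List R) : List R :=
  l.set i (l.getD i 0 - listDot (A.getD i []) l)

/-- The action of a word in the simple reflections, in coordinates. -/
def listWord (A : List (List R)) (q : List ℕ) (l : List R) : List R :=
  q.foldr (listReflection A) l

end ListModel

section Reach

/-- Binary search trees whose nodes carry a key and a value. -/
inductive KeyTree (X : Type*)
  | leaf : KeyTree X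
  | node : KeyTree X → ℕ → X → KeyTree X → KeyTree X

namespace KeyTree

variable {X : Type*}

/-- The values in the tree. -/
def toList : KeyTree X → List X
  | leaf => []
  | node l _ x r => x :: (l.toList ++ r.toList)

/-- Search for a key. -/
def find (k : ℕ) : KeyTree X → Option X
  | leaf => none
  | node l k' x r => bif k.beq k' then some x else bif k.ble k' then l.find k else r.find k

/-- Insertion of a value with a given key. -/
def insert (k : ℕ) (x : X) : KeyTree X → KeyTree X
  | leaf => node leaf k x leaf
  | node l k' y r =>
    bif k.ble k' then node (l.insert k x) k' y r else node l k' y (r.insert k x)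

theorem mem_toList_of_find {k : ℕ} {x : X} : ∀ {t : KeyTree X}, t.find k = some x → x ∈ t.toList
  | leaf, h => by simp [find] at h
  | node l k' y r, h => by
    rw [find] at h
    cases h1 : k.beq k' <;> cases h2 : k.ble k' <;>
      simp only [h1, h2, cond_true, cond_false, Option.some.injEq] at h
    · simp [toList, mem_toList_of_find h]
    · simp [toList, mem_toList_of_find h]
    · simp [toList, h]
    · simp [toList, h]

theorem mem_toList_insert {k : ℕ} {x y : X} :
    ∀ {t : KeyTree X}, y ∈ (t.insert k x).toList ↔ y = x ∨ y ∈ t.toList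
  | leaf => by simp [insert, toList]
  | node l k' z r => by
    rw [insert]
    cases k.ble k' <;>
      simp only [cond_true, cond_false, toList, List.mem_cons, List.mem_append, mem_toList_insert]
    · tauto
    · tauto

end KeyTree

variable {X : Type*} [DecidableEq X]

/-- The elements that are reached from those of the list `todo` by repeated application of the
maps `r j`, for `j` in the list `J`; the first explicit numeral bounds the number of steps. -/
def reach (r : ℕ → X → X) (key : X → ℕ) (J : List ℕ) :
    ℕ → List X → KeyTree X → Option (KeyTree X)
  | 0, _, _ => none
  | _ + 1, [], seen => some seen
  | n + 1, x :: todo, seen =>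
    if seen.find (key x) = some x then reach r key J n todo seen
    else reach r key J n (J.map (fun j => r j x) ++ todo) (seen.insert (key x) x)

/-- The invariant `hc` says that every image of a recorded element is recorded or pending; when
nothing is pending, the record is closed. Soundness requires neither an injective key nor a
correctly ordered tree: a bad lookup can only make the search fail. -/
theorem forall_mem_of_reach {r : ℕ → X → X} {key : X → ℕ} {J : List ℕ} {p : X → Prop}
    (hp : ∀ j ∈ J, ∀ x, p x → p (r j x)) {t : KeyTree X} (n : ℕ) (todo : List X)
    (seen : KeyTree X) (ht : ∀ x ∈ todo, p x) (hs : ∀ x ∈ seen.toList, p x)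
    (hc : ∀ x ∈ seen.toList, ∀ j ∈ J, r j x ∈ seen.toList ∨ r j x ∈ todo)
    (h : reach r key J n todo seen = some t) :
    ∀ x ∈ t.toList, p x ∧ ∀ j ∈ J, r j x ∈ t.toList := by
  induction n generalizing todo seen with
  | zero => simp [reach] at h
  | succ n ih =>
    cases todo with
    | nil =>
      obtain rfl : seen = t := by simpa [reach] using h
      exact fun x hx => ⟨hs x hx, fun j hj => (hc x hx j hj).resolve_right (by simp)⟩
    | cons x todo =>
      rw [List.forall_mem_cons] at ht
      rw [reach] at h
      split_ifs at h with hx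
      · refine ih _ _ ht.2 hs (fun y hy j hj => ?_) h
        rcases hc y hy j hj with h1 | h1
        · exact .inl h1
        · rcases List.mem_cons.mp h1 with h1 | h1
          · exact .inl (h1 ▸ KeyTree.mem_toList_of_find hx)
          · exact .inr h1
      · refine ih _ _ ?_ (fun y hy => ?_) (fun y hy j hj => ?_) h
        · rw [List.forall_mem_append]
          refine ⟨fun y hy => ?_, ht.2⟩
          obtain ⟨j, hj, rfl⟩ := List.mem_map.mp hy
          exact hp j hj x ht.1
        · rcases KeyTree.mem_toList_insert.mp hy with rfl | hy
          · exact ht.1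
          · exact hs y hy
        · rw [KeyTree.mem_toList_insert, List.mem_append]
          rcases KeyTree.mem_toList_insert.mp hy with rfl | hy
          · exact .inr (.inl (List.mem_map_of_mem hj))
          · rcases hc y hy j hj with h1 | h1
            · exact .inl (.inr h1)
            · rcases List.mem_cons.mp h1 with h1 | h1
              · exact .inl (.inl h1)
              · exact .inr (.inr h1)

/-- The elements reached from `todo` include `x` and are permuted by `r i`. -/
def reachIsClosed (r : ℕ → X → X) (key : X → ℕ) (J : List ℕ) (n : ℕ) (todo : List X) (x : X)
    (i : ℕ) : Bool :=
  match reach r key J n todo .leaf with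
  | none => false
  | some t => decide (t.find (key x) = some x) &&
      t.toList.all fun y => decide (t.find (key (r i y)) = some (r i y))

/-- Closure under the maps in `J` comes from the search; closure under the additional map `r i` is
tested afterwards, since `p` need not be preserved by it. -/
theorem exists_of_reachIsClosed {r : ℕ → X → X} {key : X → ℕ} {J : List ℕ} {p : X → Prop}
    (hp : ∀ j ∈ J, ∀ x, p x → p (r j x)) {n i : ℕ} {todo : List X} {x : X}
    (ht : ∀ x ∈ todo, p x) (h : reachIsClosed r key J n todo x i = true) :
    ∃ S : Set X, x ∈ S ∧ ∀ y ∈ S, p y ∧ (∀ j ∈ J, r j y ∈ S) ∧ r i y ∈ S := by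
  rw [reachIsClosed] at h
  split at h
  · exact absurd h Bool.false_ne_true
  · rename_i t e
    simp only [Bool.and_eq_true, decide_eq_true_eq, List.all_eq_true] at h
    refine ⟨{y | y ∈ t.toList}, KeyTree.mem_toList_of_find h.1, fun y hy => ?_⟩
    obtain ⟨h1, h2⟩ := forall_mem_of_reach hp n todo .leaf ht (by simp [KeyTree.toList])
      (by simp [KeyTree.toList]) e y hy
    exact ⟨h1, h2, KeyTree.mem_toList_of_find (h.2 y hy)⟩

end Reach

section ListVector

variable {R : Type*} [CommRing R]

@[simp]
theorem length_listReflection (A : List (List R)) (i : ℕ) (l : List R) :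
    (listReflection A i l).length = l.length := by
  simp [listReflection]

@[simp]
theorem length_listWord (A : List (List R)) (q : List ℕ) (l : List R) :
    (listWord A q l).length = l.length := by
  induction q with
  | nil => rfl
  | cons i q ih => rw [← ih, listWord, List.foldr_cons, length_listReflection, listWord]

/-- The real vector with given coordinates in a ring that is mapped to the reals. -/
def listVector (c : R →+* ℝ) (n : ℕ) (l : List R) : Fin n → ℝ := fun j => c (l.getD j 0)

theorem geomCoroot_listVector {n : ℕ} {N : CoxeterMatrix (Fin n)} {c : R →+* ℝ}
    {A : List (List R)} (hA : ∀ i j : Fin n, c ((A.getD i []).getD j 0) = N.geomCartan i j)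
    (hlen : ∀ i : Fin n, (A.getD i []).length = n) (i : Fin n) {l : List R} (hl : l.length = n) :
    N.geomCoroot i (listVector c n l) = c (listDot (A.getD i []) l) := by
  rw [N.geomCoroot_apply, listDot_eq_sum (hlen i) hl, map_sum]
  exact Finset.sum_congr rfl fun j _ => by rw [map_mul, hA, listVector]

theorem listVector_listReflection {n : ℕ} {N : CoxeterMatrix (Fin n)} {c : R →+* ℝ}
    {A : List (List R)} (hA : ∀ i j : Fin n, c ((A.getD i []).getD j 0) = N.geomCartan i j)
    (hlen : ∀ i : Fin n, (A.getD i []).length = n) (i : Fin n) {l : List R} (hl : l.length = n) :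
    listVector c n (listReflection A i l) = N.geomReflection i (listVector c n l) := by
  rw [N.geomReflection_apply, geomCoroot_listVector hA hlen i hl]
  ext j
  rw [listVector, listReflection]
  by_cases hij : i = j
  · subst hij
    simp [listVector, hl]
  · have : (i : ℕ) ≠ j := fun h => hij (Fin.ext h)
    simp [listVector, this, Ne.symm hij]

end ListVector

namespace CoxeterSystem

variable {W : Type*} [Group W] {n : ℕ} {N : CoxeterMatrix (Fin n)} (cs : CoxeterSystem N W)

/-- The simple reflection with a given number, or `1` if there is none. -/
def natSimple (i : ℕ) : W := if h : i < n then cs.simple ⟨i, h⟩ else 1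

/-- The product of simple reflections given by their numbers. -/
def natWord (q : List ℕ) : W := (q.map cs.natSimple).prod

theorem natWord_reverse (q : List ℕ) : cs.natWord q.reverse = (cs.natWord q)⁻¹ := by
  rw [natWord, natWord, List.prod_inv_reverse, List.map_reverse, List.map_map]
  congr 2
  refine List.map_congr_left fun i _ => ?_
  rw [Function.comp, natSimple]
  split_ifs <;> simp

theorem natWord_append (q r : List ℕ) : cs.natWord (q ++ r) = cs.natWord q * cs.natWord r := by
  simp [natWord]

theorem natWord_mem_standardParabolic {q : List ℕ} {i : Fin n} (hq : (i : ℕ) ∉ q) :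
    cs.natWord q ∈ cs.standardParabolic {i}ᶜ := by
  refine Subgroup.list_prod_mem _ fun x hx => ?_
  obtain ⟨j, hj, rfl⟩ := List.mem_map.mp hx
  rw [natSimple]
  split_ifs with h
  · exact cs.simple_mem_standardParabolic fun e => hq (Set.mem_singleton_iff.mp e ▸ hj)
  · exact one_mem _

variable {R : Type*} [CommRing R]

theorem listVector_listWord {c : R →+* ℝ}
    {A : List (List R)} (hA : ∀ i j : Fin n, c ((A.getD i []).getD j 0) = N.geomCartan i j)
    (hlen : ∀ i : Fin n, (A.getD i []).length = n) (q : List ℕ) {l : List R} (hl : l.length = n) :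
    listVector c n (listWord A q l) = cs.geomRep (cs.natWord q) (listVector c n l) := by
  induction q with
  | nil => simp [listWord, natWord]
  | cons i q ih =>
    have e : listWord A (i :: q) l = listReflection A i (listWord A q l) := rfl
    rw [e, natWord, List.map_cons, List.prod_cons, map_mul, LinearEquiv.mul_apply, ← natWord, ← ih]
    have hl' : (listWord A q l).length = n := by simp [hl]
    by_cases h : i < n
    · have := listVector_listReflection hA hlen ⟨i, h⟩ hl'
      rw [natSimple, dif_pos h, cs.geomRep_simple, ← this]
    -- An index out of range acts trivially on both sides, because `List.set` then leaves the list
    -- unchanged.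
    · rw [natSimple, dif_neg h, map_one, LinearEquiv.coe_one, id, listReflection,
        List.set_eq_of_length_le (by omega)]

/-- A criterion for `W = P (g P g⁻¹) P`, where `P` is the stabilizer of a dominant vector `θ`
that is orthogonal to all simple roots except one: the orbit of `θ` is reached under `P` from the
vectors `g q g⁻¹ θ`, for given elements `q` of `P`. -/
theorem hasFactorization_of_reachIsClosed [Finite W] [DecidableEq R]
    (hN : ∀ i j, i ≠ j → N i j = 2 ∨ N i j = 3 ∨ N i j = 5) (c : R →+* ℝ) (A : List (List R))
    (hA : ∀ i j : Fin n, c ((A.getD i []).getD j 0) = N.geomCartan i j)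
    (hlen : ∀ i : Fin n, (A.getD i []).length = n) (i₀ : Fin n) (θ : List R) (d : R)
    (hd : 0 < c d) (hθlen : θ.length = n)
    (hθ : ∀ i : Fin n, listDot (A.getD i []) θ = if i = i₀ then d else 0)
    (g : List ℕ) (q : List (List ℕ)) (hq : ∀ l ∈ q, (i₀ : ℕ) ∉ l) (key : List R → ℕ) (J : List ℕ)
    (hJ : ∀ j : ℕ, j ∈ J ↔ j < n ∧ j ≠ i₀) (m : ℕ)
    (h : reachIsClosed (listReflection A) key J m
      (q.map fun l => listWord A (g ++ l ++ g.reverse) θ) θ i₀ = true) :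
    cs.HasFactorization := by
  set P := cs.standardParabolic {i₀}ᶜ with hP
  refine ⟨{i₀}ᶜ, cs.standardParabolic_ne_top (i := i₀) (by simp), ?_⟩
  set γ := cs.natWord g with hγ
  set v := listVector c n θ with hv
  have hcoroot : ∀ i, N.geomCoroot i v = if i = i₀ then c d else 0 := by
    intro i
    rw [hv, geomCoroot_listVector hA hlen i hθlen, hθ]
    split_ifs <;> simp
  have hstab : ∀ w, cs.geomRep w v = v → w ∈ P := fun w hw =>
    cs.mem_standardParabolic_of_geomRep_eq hN (v := v)
      (fun i => by rw [hcoroot]; split_ifs <;> linarith)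
      (fun i => by rw [hcoroot]; by_cases hi : i = i₀ <;> simp [hi, hd.ne']) hw
  -- The vectors of the form `a (γ b γ⁻¹) v` with `a, b ∈ P`; this property survives the reflections
  -- in `P`.
  let p : List R → Prop := fun x => x.length = n ∧ ∃ a ∈ P, ∃ b ∈ P,
    listVector c n x = cs.geomRep (a * (γ * b * γ⁻¹)) v
  have step : ∀ (i : Fin n) {x : List R}, x.length = n →
      listVector c n (listReflection A i x) = cs.geomRep (cs.simple i) (listVector c n x) := by
    intro i x hx
    rw [cs.geomRep_simple]
    exact listVector_listReflection hA hlen i hx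
  have hp : ∀ j ∈ J, ∀ x, p x → p (listReflection A j x) := by
    rintro j hj x ⟨h1, a, ha, b, hb, e⟩
    obtain ⟨hjn, hj0⟩ := (hJ j).mp hj
    refine ⟨by simp [h1], cs.simple ⟨j, hjn⟩ * a, P.mul_mem
      (cs.simple_mem_standardParabolic fun e => hj0 (congrArg Fin.val e)) ha, b, hb, ?_⟩
    rw [step ⟨j, hjn⟩ h1, e, ← LinearEquiv.mul_apply, ← map_mul]
    simp only [mul_assoc]
  have ht : ∀ x ∈ q.map fun l => listWord A (g ++ l ++ g.reverse) θ, p x := by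
    intro x hx
    obtain ⟨l, hl, rfl⟩ := List.mem_map.mp hx
    refine ⟨by simp [hθlen], 1, P.one_mem, cs.natWord l,
      cs.natWord_mem_standardParabolic (hq l hl), ?_⟩
    rw [cs.listVector_listWord hA hlen _ hθlen, natWord_append, natWord_append, natWord_reverse,
      one_mul]
  obtain ⟨S, hθS, hS⟩ := exists_of_reachIsClosed hp ht h
  refine isProductOfThreeConjugates_of_forall γ fun w => ?_
  -- The set `S` contains `θ` and is stable under all simple reflections, hence contains the orbit
  -- of `θ`.
  have horb : ∃ x ∈ S, listVector c n x = cs.geomRep w v := by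
    induction w using cs.simple_induction_left with
    | one => exact ⟨θ, hθS, by simp [hv]⟩
    | mul_simple_left w i ih =>
      obtain ⟨x, hx, e⟩ := ih
      obtain ⟨⟨h1, -⟩, h2, h3⟩ := hS x hx
      refine ⟨listReflection A i x, ?_, ?_⟩
      · by_cases hi : i = i₀
        · exact hi ▸ h3
        · exact h2 i ((hJ i).mpr ⟨i.isLt, fun e => hi (Fin.ext e)⟩)
      · rw [step i h1, e, map_mul, LinearEquiv.mul_apply]
  obtain ⟨x, hx, e⟩ := horb
  obtain ⟨⟨-, a, ha, b, hb, e'⟩, -⟩ := hS x hx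
  -- If `w v = a (γ b γ⁻¹) v`, the quotient of the two elements stabilizes `v`, and is the required
  -- third factor in `P`.
  refine ⟨a, ha, b, hb, (a * (γ * b * γ⁻¹))⁻¹ * w, hstab _ ?_, by group⟩
  rw [map_mul, LinearEquiv.mul_apply, ← e, e', ← LinearEquiv.mul_apply, ← map_mul,
    inv_mul_cancel, map_one]
  rfl

end CoxeterSystem

/-- A numerical key for short lists of small integers. -/
def intListKey (l : List ℤ) : ℕ := l.foldl (fun k a => k * 16 + (a + 8).toNat) 0

theorem CoxeterMatrix.geomCartan_of_le_three {n : ℕ} {N : CoxeterMatrix (Fin n)}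
    (A : List (List ℤ)) (h : ∀ i j : Fin n, (N.entry i j, (A.getD i []).getD j 0) ∈
      [(1, (2 : ℤ)), (2, 0), (3, -1)]) (i j : Fin n) :
    Int.castRingHom ℝ ((A.getD i []).getD j 0) = N.geomCartan i j := by
  have := h i j
  simp only [List.mem_cons, Prod.mk.injEq, List.not_mem_nil, or_false] at this
  rcases this with ⟨h1, h2⟩ | ⟨h1, h2⟩ | ⟨h1, h2⟩
  · have : i = j := by
      by_contra hij
      exact N.off_diagonal i j hij h1
    subst this
    rw [h2, N.geomCartan_self]
    simp
  · rw [h2, N.geomCartan_of_eq_two h1]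
    simp
  · rw [h2, N.geomCartan_of_eq_three h1]
    simp

/-! ### Factorizations for the types `E` and `H₄`. -/

namespace CoxeterSystem

variable {W : Type*} [Group W] [Finite W]

theorem hasFactorization_of_simplyLaced {n : ℕ} {N : CoxeterMatrix (Fin n)}
    (cs : CoxeterSystem N W) (A : List (List ℤ))
    (hA : ∀ i j : Fin n, (N.entry i j, (A.getD i []).getD j 0) ∈
      [(1, (2 : ℤ)), (2, 0), (3, -1)])
    (hlen : ∀ i : Fin n, (A.getD i []).length = n) (i₀ : Fin n) (θ : List ℤ)
    (hθlen : θ.length = n)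
    (hθ : ∀ i : Fin n, listDot (A.getD i []) θ = if i = i₀ then 1 else 0)
    (g : List ℕ) (q : List (List ℕ)) (hq : ∀ l ∈ q, (i₀ : ℕ) ∉ l)
    (h : reachIsClosed (listReflection A) intListKey ((List.range n).filter (· ≠ i₀)) 3000
      (q.map fun l => listWord A (g ++ l ++ g.reverse) θ) θ i₀ = true) :
    cs.HasFactorization := by
  refine cs.hasFactorization_of_reachIsClosed (fun i j hij => ?_) (Int.castRingHom ℝ) A
    (CoxeterMatrix.geomCartan_of_le_three A hA) hlen i₀ θ 1 (by simp) hθlen hθ g q hq intListKey _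
    (fun j => by simp) 3000 h
  have := hA i j
  simp only [List.mem_cons, Prod.mk.injEq, List.not_mem_nil, or_false] at this
  rcases this with ⟨h1, -⟩ | ⟨h1, -⟩ | ⟨h1, -⟩
  · exact absurd h1 (N.off_diagonal i j hij)
  · exact .inl h1
  · exact .inr (.inl h1)

/-- In all three types `E`, `θ` is the highest root, orthogonal to every simple root but `i₀`. Under
its stabilizer the roots form five orbits, one for each product `2, 1, 0, -1, -2` with `θ`, and each
of the five words reaches one of them. -/
theorem hasFactorization_E₆ (cs : CoxeterSystem CoxeterMatrix.E₆ W) : cs.HasFactorization :=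
  cs.hasFactorization_of_simplyLaced
    [[2, 0, -1, 0, 0, 0], [0, 2, 0, -1, 0, 0], [-1, 0, 2, -1, 0, 0], [0, -1, -1, 2, -1, 0],
      [0, 0, 0, -1, 2, -1], [0, 0, 0, 0, -1, 2]]
    (by decide) (by decide) 1 [1, 2, 2, 3, 2, 1] rfl (by decide) [1, 3, 4, 2, 3, 1]
    [[], [0], [5, 0], [5, 4, 3, 2, 0], [0, 2, 3, 4, 5, 4, 3, 2, 0]] (by decide)
    (by decide +kernel)

theorem hasFactorization_E₇ (cs : CoxeterSystem CoxeterMatrix.E₇ W) : cs.HasFactorization :=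
  cs.hasFactorization_of_simplyLaced
    [[2, 0, -1, 0, 0, 0, 0], [0, 2, 0, -1, 0, 0, 0], [-1, 0, 2, -1, 0, 0, 0],
      [0, -1, -1, 2, -1, 0, 0], [0, 0, 0, -1, 2, -1, 0], [0, 0, 0, 0, -1, 2, -1],
      [0, 0, 0, 0, 0, -1, 2]]
    (by decide) (by decide) 0 [2, 2, 3, 4, 3, 2, 1] rfl (by decide) [0, 2, 3, 4, 1, 3, 2, 0]
    [[], [5], [5, 6, 4, 5], [5, 6, 4, 3, 2, 1, 3, 4, 5],
      [5, 4, 3, 2, 1, 3, 4, 5, 6, 5, 4, 3, 2, 1, 3, 4, 5]] (by decide)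
    (by decide +kernel)

theorem hasFactorization_E₈ (cs : CoxeterSystem CoxeterMatrix.E₈ W) : cs.HasFactorization :=
  cs.hasFactorization_of_simplyLaced
    [[2, 0, -1, 0, 0, 0, 0, 0], [0, 2, 0, -1, 0, 0, 0, 0], [-1, 0, 2, -1, 0, 0, 0, 0],
      [0, -1, -1, 2, -1, 0, 0, 0], [0, 0, 0, -1, 2, -1, 0, 0], [0, 0, 0, 0, -1, 2, -1, 0],
      [0, 0, 0, 0, 0, -1, 2, -1], [0, 0, 0, 0, 0, 0, -1, 2]]
    (by decide) (by decide) 7 [2, 3, 4, 6, 5, 4, 3, 2] rfl (by decide)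
    [7, 6, 5, 4, 3, 2, 1, 3, 4, 5, 6, 7]
    [[], [0], [0, 2, 3, 4, 1, 3, 2, 0], [0, 2, 3, 4, 5, 6, 1, 3, 4, 5, 2, 3, 4, 1, 3, 2, 0],
      [0, 2, 3, 4, 5, 1, 3, 4, 2, 3, 0, 2, 1, 3, 4, 5, 6, 5, 4, 3, 2, 1, 3, 4, 5, 0, 2, 3, 4, 1,
        3, 2, 0]] (by decide)
    (by decide +kernel)

/-- The real number `x + y u` with given coordinates. -/
noncomputable def quadraticHom {a b : ℤ} {u : ℝ} (hu : u * u = a + b * u) :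
    QuadraticAlgebra ℤ a b →+* ℝ :=
  (QuadraticAlgebra.lift (R := ℤ) (A := ℝ) ⟨u, by simpa using hu⟩).toRingHom

theorem quadraticHom_apply {a b : ℤ} {u : ℝ} (hu : u * u = a + b * u)
    (z : QuadraticAlgebra ℤ a b) : quadraticHom hu z = z.re + z.im * u := by
  simp [quadraticHom]

/-- Injectivity lets inequalities and vanishing tests be transferred from the quadratic ring to the
reals in the non-existence proofs. -/
theorem quadraticHom_injective {a b : ℤ} {u : ℝ} (hu : u * u = a + b * u) (hirr : Irrational u) :
    Function.Injective (quadraticHom hu) := by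
  rw [injective_iff_map_eq_zero]
  intro z hz
  rw [quadraticHom_apply] at hz
  have him : z.im = 0 := by
    by_contra h
    exact ((hirr.intCast_mul h).intCast_add z.re).ne_zero hz
  rw [him] at hz
  ext
  · simpa using hz
  · exact him

/-- The ring homomorphism from `ℤ[φ]` to the real numbers. -/
noncomputable def goldenHom : QuadraticAlgebra ℤ 1 1 →+* ℝ :=
  quadraticHom (u := Real.goldenRatio) (by
    rw [← pow_two, Real.goldenRatio_sq]
    push_cast
    ring)

theorem goldenHom_mk (a b : ℤ) : goldenHom ⟨a, b⟩ = a + b * Real.goldenRatio :=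
  quadraticHom_apply _ _

/-- A numerical key for short lists of small elements of a quadratic ring. -/
def quadraticListKey {a b : ℤ} (l : List (QuadraticAlgebra ℤ a b)) : ℕ :=
  l.foldl (fun k a => (k * 16 + (a.re + 8).toNat) * 16 + (a.im + 8).toNat) 0

theorem goldenHom_eq_geomCartan {n : ℕ} {N : CoxeterMatrix (Fin n)}
    {A : List (List (QuadraticAlgebra ℤ 1 1))}
    (h : ∀ i j : Fin n, (N.entry i j, (A.getD i []).getD j 0) ∈
      [(1, (⟨2, 0⟩ : QuadraticAlgebra ℤ 1 1)), (2, ⟨0, 0⟩), (3, ⟨-1, 0⟩), (5, ⟨0, -1⟩)])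
    (i j : Fin n) : goldenHom ((A.getD i []).getD j 0) = N.geomCartan i j := by
  have := h i j
  simp only [List.mem_cons, Prod.mk.injEq, List.not_mem_nil, or_false] at this
  rcases this with ⟨h1, h2⟩ | ⟨h1, h2⟩ | ⟨h1, h2⟩ | ⟨h1, h2⟩
  · have : i = j := by
      by_contra hij
      exact N.off_diagonal i j hij h1
    subst this
    rw [h2, N.geomCartan_self, goldenHom_mk]
    simp
  · rw [h2, N.geomCartan_of_eq_two h1, goldenHom_mk]
    simp
  · rw [h2, N.geomCartan_of_eq_three h1, goldenHom_mk]
    simp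
  · rw [h2, N.geomCartan_of_eq_five h1, goldenHom_mk]
    simp

/-- The vector `θ` is a multiple of a fundamental weight, scaled so that its norm in the form is
`2`, as for a simple root; this gives `d = φ - 1`. Its `120` images are the vertices of a 600-cell,
which the stabilizer `H₃` divides into nine orbits, one for each word. -/
theorem hasFactorization_H₄ (cs : CoxeterSystem CoxeterMatrix.H₄ W) : cs.HasFactorization := by
  have h : ∀ i j : Fin 4, i ≠ j → CoxeterMatrix.H₄.entry i j = 2 ∨
    CoxeterMatrix.H₄.entry i j = 3 ∨ CoxeterMatrix.H₄.entry i j = 5 := by decide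
  refine cs.hasFactorization_of_reachIsClosed h goldenHom
    [[⟨2, 0⟩, ⟨-1, 0⟩, 0, 0], [⟨-1, 0⟩, ⟨2, 0⟩, ⟨-1, 0⟩, 0], [0, ⟨-1, 0⟩, ⟨2, 0⟩, ⟨0, -1⟩],
      [0, 0, ⟨0, -1⟩, ⟨2, 0⟩]]
    (goldenHom_eq_geomCartan (by decide)) (by decide) 0 [⟨0, 2⟩, ⟨1, 3⟩, ⟨2, 4⟩, ⟨2, 3⟩] ⟨-1, 1⟩ ?_ rfl (by decide)
    [0, 1, 2, 3, 2, 3, 1, 2, 3, 0, 1, 2, 3, 2, 1, 0]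
    [[], [2], [2, 3, 2], [2, 3, 1, 2], [2, 3, 2, 3, 1, 2], [2, 3, 1, 2, 3, 1, 2],
      [2, 3, 2, 3, 1, 2, 3, 2], [2, 3, 1, 2, 3, 1, 2, 3, 1, 2],
      [2, 3, 1, 2, 3, 1, 2, 3, 1, 2, 3, 1, 2]] (by decide) quadraticListKey [1, 2, 3]
    (fun j => ?_) 3000 (by decide +kernel)
  · rw [goldenHom_mk]
    have := Real.one_lt_goldenRatio
    push_cast
    linarith
  · simp
    omega

end CoxeterSystem

/-! ### The invariant form and an obstruction to factorizations. -/

namespace CoxeterMatrix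

variable {B : Type*} (M : CoxeterMatrix B)

theorem geomCartan_of_eq_four {i j : B} (h : M i j = 4) : M.geomCartan i j = -√2 := by
  rw [geomCartan, h]
  norm_num [Real.cos_pi_div_four]
  ring

variable [Fintype B]

/-- The invariant bilinear form of the geometric representation. -/
noncomputable def geomForm (x y : B → ℝ) : ℝ := ∑ i, x i * M.geomCoroot i y

theorem geomForm_symm (x y : B → ℝ) : M.geomForm x y = M.geomForm y x := by
  simp only [geomForm, geomCoroot_apply, Finset.mul_sum]
  rw [Finset.sum_comm]
  refine Finset.sum_congr rfl fun j _ => Finset.sum_congr rfl fun i _ => ?_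
  rw [M.geomCartan_symm]
  ring

theorem geomForm_sub_smul_left (x z y : B → ℝ) (a : ℝ) :
    M.geomForm (x - a • z) y = M.geomForm x y - a * M.geomForm z y := by
  simp only [geomForm, Pi.sub_apply, Pi.smul_apply, smul_eq_mul, sub_mul, Finset.sum_sub_distrib,
    Finset.mul_sum, mul_assoc]

theorem geomForm_sub_smul_right (x z y : B → ℝ) (a : ℝ) :
    M.geomForm x (y - a • z) = M.geomForm x y - a * M.geomForm x z := by
  rw [geomForm_symm, geomForm_sub_smul_left, geomForm_symm, geomForm_symm M z]

variable [DecidableEq B]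

theorem geomForm_single (i : B) (y : B → ℝ) :
    M.geomForm (Pi.single i 1) y = M.geomCoroot i y := by
  simp [geomForm, Pi.single_apply]

theorem geomForm_geomReflection (i : B) (x y : B → ℝ) :
    M.geomForm (M.geomReflection i x) (M.geomReflection i y) = M.geomForm x y := by
  simp only [geomReflection_apply]
  simp only [geomForm_sub_smul_left, geomForm_sub_smul_right, geomForm_symm M _ (Pi.single i 1),
    geomForm_single, geomCoroot_single_self]
  ring

end CoxeterMatrix

namespace CoxeterSystem

variable {B W : Type*} [Group W] {M : CoxeterMatrix B} (cs : CoxeterSystem M W)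

theorem geomForm_geomRep [Fintype B] [DecidableEq B] (w : W) (x y : B → ℝ) :
    M.geomForm (cs.geomRep w x) (cs.geomRep w y) = M.geomForm x y := by
  induction w using cs.simple_induction_left with
  | one => simp
  | mul_simple_left w i ih =>
    rw [map_mul, LinearEquiv.mul_apply, LinearEquiv.mul_apply, cs.geomRep_simple,
      M.geomForm_geomReflection, ih]

end CoxeterSystem

theorem IsProductOfThreeConjugates.exists_forall {G : Type*} [Group G] {A : Subgroup G}
    (h : IsProductOfThreeConjugates A) :
    ∃ g k : G, ∀ w, ∃ a ∈ A, ∃ b ∈ A, ∃ c ∈ A, w = a * g * b * k * c := by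
  obtain ⟨x, y, z, h⟩ := h
  refine ⟨x⁻¹ * y, y⁻¹ * z, fun w => ?_⟩
  have hw : x * w * z⁻¹ ∈ (Set.univ : Set G) := trivial
  rw [← h] at hw
  obtain ⟨_, ⟨_, ⟨a, ha, rfl⟩, _, ⟨b, hb, rfl⟩, rfl⟩, _, ⟨c, hc, rfl⟩, e⟩ := hw
  refine ⟨a, ha, b, hb, c, hc, ?_⟩
  simp only [MulDistribMulAction.toMonoidEnd_apply, MulDistribMulAction.toMonoidHom_apply,
    MulAut.smul_def, MulAut.conj_apply] at e
  have : w = x⁻¹ * (x * w * z⁻¹) * z := by group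
  rw [this, ← e]
  group

theorem IsProductOfThreeConjugates.mono {G : Type*} [Group G] {A A' : Subgroup G} (hA : A ≤ A')
    (h : IsProductOfThreeConjugates A) : IsProductOfThreeConjugates A' := by
  obtain ⟨x, y, z, h⟩ := h
  refine ⟨x, y, z, Set.eq_univ_of_univ_subset ?_⟩
  rw [← h]
  have key : ∀ x : G, ((MulAut.conj x • A : Subgroup G) : Set G) ⊆
      ((MulAut.conj x • A' : Subgroup G) : Set G) := fun x =>
    Subgroup.pointwise_smul_le_pointwise_smul_iff.mpr hA
  exact Set.mul_subset_mul (Set.mul_subset_mul (key x) (key y)) (key z)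

theorem IsProductOfThreeConjugates.of_conj {G : Type*} [Group G] {A : Subgroup G} {g : G}
    (h : IsProductOfThreeConjugates (MulAut.conj g • A)) : IsProductOfThreeConjugates A := by
  obtain ⟨x, y, z, h⟩ := h
  refine ⟨x * g, y * g, z * g, ?_⟩
  simpa only [← mul_smul, ← map_mul] using h

namespace CoxeterSystem

variable {B W : Type*} [Group W] {M : CoxeterMatrix B} (cs : CoxeterSystem M W)

/-- If some proper parabolic subgroup gives a factorization, then so does a maximal standard
one. -/
theorem exists_isProductOfThreeConjugates {P : Subgroup W} (hP : cs.IsParabolic P) (hne : P ≠ ⊤)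
    (h : IsProductOfThreeConjugates P) :
    ∃ i, IsProductOfThreeConjugates (cs.standardParabolic {i}ᶜ) := by
  obtain ⟨I, g, rfl⟩ := hP
  have hI : I ≠ Set.univ := by
    rintro rfl
    rw [standardParabolic_univ] at hne
    apply hne
    rw [eq_top_iff]
    intro x _
    exact ⟨g⁻¹ * x * g, trivial, by simp [mul_assoc]⟩
  obtain ⟨i, hi⟩ := (Set.ne_univ_iff_exists_notMem I).mp hI
  exact ⟨i, h.of_conj.mono (cs.standardParabolic_mono fun j hj e => hi (e ▸ hj))⟩

theorem not_exists_isParabolic_of_isOfType {B' : Type*} {N : CoxeterMatrix B'}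
    (h : M.IsOfType N)
    (hN : ∀ (cs' : CoxeterSystem N W) (i : B'),
      ¬ IsProductOfThreeConjugates (cs'.standardParabolic {i}ᶜ)) :
    ¬ ∃ P : Subgroup W, cs.IsParabolic P ∧ P ≠ ⊤ ∧ IsProductOfThreeConjugates P := by
  rintro ⟨P, h1, h2, h3⟩
  obtain ⟨i, hi⟩ := cs.exists_isProductOfThreeConjugates h1 h2 h3
  obtain ⟨e, rfl⟩ := h
  refine hN (cs.reindex e) (e i) ?_
  rw [reindex_standardParabolic]
  convert hi using 2
  ext j
  simp

theorem geomRep_apply_of_mem [Fintype B] [DecidableEq B] {i : B} {w : W}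
    (hw : w ∈ cs.standardParabolic {i}ᶜ) (x : B → ℝ) : cs.geomRep w x i = x i := by
  refine Subgroup.closure_induction (p := fun w _ => ∀ x : B → ℝ, cs.geomRep w x i = x i)
    ?_ ?_ ?_ ?_ hw x
  · rintro _ ⟨j, hj, rfl⟩ x
    have hij : i ≠ j := fun e => hj e.symm
    simp [cs.geomRep_simple_apply, hij]
  · intro x
    simp
  · intro u v _ _ hu hv x
    rw [map_mul, LinearEquiv.mul_apply, hu, hv]
  · intro u _ hu x
    rw [← hu (cs.geomRep u⁻¹ x), ← LinearEquiv.mul_apply, ← map_mul, mul_inv_cancel, map_one]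
    simp

/-- If `v` is a fundamental weight with `-v` in its orbit, then `W` is not a product of three
conjugates of the corresponding maximal parabolic subgroup, provided that the angle between `v`
and its image under the remaining simple reflection does not occur between vectors of the orbit
that are orthogonal to `v`. -/
theorem not_isProductOfThreeConjugates_of_geomForm_ne [Fintype B] [DecidableEq B] {i : B}
    {v : B → ℝ} (hv : ∀ j, j ≠ i → M.geomCoroot j v = 0) {w₀ : W} (hw₀ : cs.geomRep w₀ v = -v)
    (h : ∀ u w, cs.geomRep u v i = 0 → cs.geomRep w v i = 0 →
      M.geomForm (cs.geomRep u v) (cs.geomRep w v) ≠ M.geomForm v (M.geomReflection i v)) :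
    ¬ IsProductOfThreeConjugates (cs.standardParabolic {i}ᶜ) := by
  intro hprod
  obtain ⟨g, k, hgk⟩ := hprod.exists_forall
  have hfix : ∀ a ∈ cs.standardParabolic {i}ᶜ, cs.geomRep a v = v := fun a ha =>
    cs.geomRep_eq_of_mem_standardParabolic hv ha
  have key : ∀ w, ∃ a ∈ cs.standardParabolic {i}ᶜ, ∃ b ∈ cs.standardParabolic {i}ᶜ,
      cs.geomRep (g⁻¹ * a⁻¹) (cs.geomRep w v) = cs.geomRep (b * k) v := by
    intro w
    obtain ⟨a, ha, b, hb, c, hc, rfl⟩ := hgk w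
    refine ⟨a, ha, b, hb, ?_⟩
    rw [← LinearEquiv.mul_apply, ← map_mul]
    have : g⁻¹ * a⁻¹ * (a * g * b * k * c) = b * k * c := by group
    rw [this, map_mul, LinearEquiv.mul_apply, hfix c hc]
  have hcoord : ∀ b ∈ cs.standardParabolic {i}ᶜ, cs.geomRep (b * k) v i = cs.geomRep k v i := by
    intro b hb
    rw [map_mul, LinearEquiv.mul_apply, cs.geomRep_apply_of_mem hb]
  have hinv : ∀ a ∈ cs.standardParabolic {i}ᶜ, cs.geomRep (g⁻¹ * a⁻¹) v = cs.geomRep g⁻¹ v := by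
    intro a ha
    rw [map_mul, LinearEquiv.mul_apply, hfix _ (inv_mem ha)]
  -- The `i`-th coordinate is unchanged by the parabolic subgroup. Comparing it for `w₀` and for `1`
  -- shows that it vanishes on both `g⁻¹ v` and `k v`; the form of `x` with `v` is a multiple of `x
  -- i`, which is why this means orthogonality.
  obtain ⟨a₀, ha₀, b₀, hb₀, e₀⟩ := key w₀
  obtain ⟨a₁, ha₁, b₁, hb₁, e₁⟩ := key 1
  obtain ⟨a, ha, b, hb, e⟩ := key (cs.simple i)
  rw [hw₀, map_neg, hinv a₀ ha₀] at e₀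
  rw [map_one, LinearEquiv.coe_one, id, hinv a₁ ha₁] at e₁
  have h1 : -(cs.geomRep g⁻¹ v i) = cs.geomRep k v i := by
    rw [← hcoord b₀ hb₀, ← e₀, Pi.neg_apply]
  have h2 : cs.geomRep g⁻¹ v i = cs.geomRep k v i := by rw [← hcoord b₁ hb₁, ← e₁]
  -- For the simple reflection, `g⁻¹ a⁻¹` carries `v` and its reflected image to `g⁻¹ v` and `b k
  -- v`, and preserves the form.
  refine h g⁻¹ (b * k) (by linarith) (by rw [hcoord b hb]; linarith) ?_
  rw [← e, ← hinv a ha, cs.geomForm_geomRep, cs.geomRep_simple]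

variable {n : ℕ} {N : CoxeterMatrix (Fin n)} {R : Type*} [CommRing R]

/-- The invariant form in coordinates. -/
def listForm (A : List (List R)) (x y : List R) : R := listDot x (A.map fun r => listDot r y)

theorem geomForm_listVector {c : R →+* ℝ} {A : List (List R)} (hAlen : A.length = n)
    (hA : ∀ i j : Fin n, c ((A.getD i []).getD j 0) = N.geomCartan i j)
    (hlen : ∀ i : Fin n, (A.getD i []).length = n) {x y : List R} (hx : x.length = n)
    (hy : y.length = n) :
    N.geomForm (listVector c n x) (listVector c n y) = c (listForm A x y) := by
  rw [listForm, listDot_eq_sum hx (by simpa using hAlen), map_sum, CoxeterMatrix.geomForm]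
  refine Finset.sum_congr rfl fun i _ => ?_
  rw [geomCoroot_listVector hA hlen i hy, map_mul, listVector]
  congr 2
  have hi : (i : ℕ) < A.length := hAlen ▸ i.isLt
  simp [hi]

variable [DecidableEq R]

/-- The elements `x` and `y` of the orbit of `θ` whose `i`-th coordinates vanish do not have the
same product as `θ` and its image under the `i`-th simple reflection. -/
def orbitAvoids (A : List (List R)) (key : List R → ℕ) (n m : ℕ) (θ : List R) (i : ℕ) : Bool :=
  match reach (listReflection A) key (List.range n) m [θ] .leaf with
  | none => false
  | some t => decide (θ ∈ t.toList) &&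
      let l := t.toList.filter fun x => x.getD i 0 = 0
      l.all fun x => l.all fun y =>
        decide (listForm A x y ≠ listForm A θ (listReflection A i θ))

theorem not_isProductOfThreeConjugates_of_orbitAvoids (cs : CoxeterSystem N W) {c : R →+* ℝ}
    (hc : Function.Injective c) (A : List (List R)) (hAlen : A.length = n)
    (hA : ∀ i j : Fin n, c ((A.getD i []).getD j 0) = N.geomCartan i j)
    (hlen : ∀ i : Fin n, (A.getD i []).length = n) (i : Fin n) (θ : List R)
    (hθlen : θ.length = n) (hθ : ∀ j : Fin n, j ≠ i → listDot (A.getD j []) θ = 0)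
    (q : List ℕ) (hq : listWord A q θ = θ.map fun x => -x) (key : List R → ℕ) (m : ℕ)
    (h : orbitAvoids A key n m θ i = true) :
    ¬ IsProductOfThreeConjugates (cs.standardParabolic {i}ᶜ) := by
  rw [orbitAvoids] at h
  split at h
  · exact absurd h Bool.false_ne_true
  rename_i t e
  simp only [Bool.and_eq_true, decide_eq_true_eq, List.all_eq_true, List.mem_filter] at h
  obtain ⟨hmem, h⟩ := h
  have hS := forall_mem_of_reach (p := fun x : List R => x.length = n) (fun j _ x hx => by simp [hx])
    m [θ] .leaf (by simp [hθlen]) (by simp [KeyTree.toList]) (by simp [KeyTree.toList]) e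
  have horb : ∀ w, ∃ x ∈ t.toList, listVector c n x = cs.geomRep w (listVector c n θ) := by
    intro w
    induction w using cs.simple_induction_left with
    | one => exact ⟨θ, hmem, by simp⟩
    | mul_simple_left w i ih =>
      obtain ⟨x, hx, e⟩ := ih
      refine ⟨_, (hS x hx).2 i (by simp), ?_⟩
      rw [listVector_listReflection hA hlen i (hS x hx).1, e, map_mul, LinearEquiv.mul_apply,
        cs.geomRep_simple]
  refine cs.not_isProductOfThreeConjugates_of_geomForm_ne (v := listVector c n θ) (fun j hj => ?_)
    (w₀ := cs.natWord q) ?_ fun u w hu hw => ?_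
  · rw [geomCoroot_listVector hA hlen j hθlen, hθ j hj, map_zero]
  · rw [← cs.listVector_listWord hA hlen q hθlen, hq]
    ext j
    simp only [listVector, Pi.neg_apply, ← map_neg]
    congr 1
    have hj : (j : ℕ) < θ.length := hθlen ▸ j.isLt
    simp [hj]
  · obtain ⟨x, hx, ex⟩ := horb u
    obtain ⟨y, hy, ey⟩ := horb w
    rw [← ex, listVector, map_eq_zero_iff c hc] at hu
    rw [← ey, listVector, map_eq_zero_iff c hc] at hw
    rw [← ex, ← ey, ← listVector_listReflection hA hlen i hθlen,
      geomForm_listVector hAlen hA hlen (hS x hx).1 (hS y hy).1,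
      geomForm_listVector hAlen hA hlen hθlen (by simp [hθlen])]
    exact fun e => h x ⟨hx, hu⟩ y ⟨hy, hw⟩ (hc e)

end CoxeterSystem

/-! ### The remaining types and the conclusion. -/

namespace CoxeterSystem

variable {W : Type*} [Group W]

/-- The Coxeter element has order `10` and its fifth power is `-1`, so the same word sends each of
the three weights to its negative. -/
theorem not_isProductOfThreeConjugates_H₃ (cs : CoxeterSystem CoxeterMatrix.H₃ W) (i : Fin 3) :
    ¬ IsProductOfThreeConjugates (cs.standardParabolic {i}ᶜ) := by
  have key := cs.not_isProductOfThreeConjugates_of_orbitAvoids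
    (c := goldenHom) (quadraticHom_injective _ Real.goldenRatio_irrational)
    [[⟨2, 0⟩, ⟨-1, 0⟩, 0], [⟨-1, 0⟩, ⟨2, 0⟩, ⟨0, -1⟩], [0, ⟨0, -1⟩, ⟨2, 0⟩]] rfl
    (goldenHom_eq_geomCartan (by decide)) (by decide) i
  fin_cases i
  · exact key [⟨2, 1⟩, ⟨2, 2⟩, ⟨1, 2⟩] rfl (by decide) (List.replicate 5 [0, 1, 2]).flatten
      (by decide +kernel) quadraticListKey 3000 (by decide +kernel)
  · exact key [⟨1, 1⟩, ⟨2, 2⟩, ⟨1, 2⟩] rfl (by decide) (List.replicate 5 [0, 1, 2]).flatten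
      (by decide +kernel) quadraticListKey 3000 (by decide +kernel)
  · exact key [⟨1, 2⟩, ⟨2, 4⟩, ⟨3, 3⟩] rfl (by decide) (List.replicate 5 [0, 1, 2]).flatten
      (by decide +kernel) quadraticListKey 3000 (by decide +kernel)

/-- The ring homomorphism from `ℤ[√2]` to the real numbers. -/
noncomputable def sqrtTwoHom : QuadraticAlgebra ℤ 2 0 →+* ℝ :=
  quadraticHom (u := √2) (by simp)

theorem sqrtTwoHom_mk (a b : ℤ) : sqrtTwoHom ⟨a, b⟩ = a + b * √2 :=
  quadraticHom_apply _ _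

theorem sqrtTwoHom_eq_geomCartan {n : ℕ} {N : CoxeterMatrix (Fin n)}
    {A : List (List (QuadraticAlgebra ℤ 2 0))}
    (h : ∀ i j : Fin n, (N.entry i j, (A.getD i []).getD j 0) ∈
      [(1, (⟨2, 0⟩ : QuadraticAlgebra ℤ 2 0)), (2, ⟨0, 0⟩), (3, ⟨-1, 0⟩), (4, ⟨0, -1⟩)])
    (i j : Fin n) : sqrtTwoHom ((A.getD i []).getD j 0) = N.geomCartan i j := by
  have := h i j
  simp only [List.mem_cons, Prod.mk.injEq, List.not_mem_nil, or_false] at this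
  rcases this with ⟨h1, h2⟩ | ⟨h1, h2⟩ | ⟨h1, h2⟩ | ⟨h1, h2⟩
  · have : i = j := by
      by_contra hij
      exact N.off_diagonal i j hij h1
    subst this
    rw [h2, N.geomCartan_self, sqrtTwoHom_mk]
    simp
  · rw [h2, N.geomCartan_of_eq_two h1, sqrtTwoHom_mk]
    simp
  · rw [h2, N.geomCartan_of_eq_three h1, sqrtTwoHom_mk]
    simp
  · rw [h2, N.geomCartan_of_eq_four h1, sqrtTwoHom_mk]
    simp

/-- The Coxeter element has order `12` and its sixth power is `-1`. The weights are scaled to have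
coordinates in `ℤ[√2]`. -/
theorem not_isProductOfThreeConjugates_F₄ (cs : CoxeterSystem CoxeterMatrix.F₄ W) (i : Fin 4) :
    ¬ IsProductOfThreeConjugates (cs.standardParabolic {i}ᶜ) := by
  have key := cs.not_isProductOfThreeConjugates_of_orbitAvoids
    (c := sqrtTwoHom) (quadraticHom_injective _ irrational_sqrt_two)
    [[⟨2, 0⟩, ⟨-1, 0⟩, 0, 0], [⟨-1, 0⟩, ⟨2, 0⟩, ⟨0, -1⟩, 0], [0, ⟨0, -1⟩, ⟨2, 0⟩, ⟨-1, 0⟩],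
      [0, 0, ⟨-1, 0⟩, ⟨2, 0⟩]] rfl
    (sqrtTwoHom_eq_geomCartan (by decide)) (by decide) i
  fin_cases i
  · exact key [⟨2, 0⟩, ⟨3, 0⟩, ⟨0, 2⟩, ⟨0, 1⟩] rfl (by decide)
      (List.replicate 6 [0, 1, 2, 3]).flatten
      (by decide +kernel) quadraticListKey 3000 (by decide +kernel)
  · exact key [⟨3, 0⟩, ⟨6, 0⟩, ⟨0, 4⟩, ⟨0, 2⟩] rfl (by decide)
      (List.replicate 6 [0, 1, 2, 3]).flatten
      (by decide +kernel) quadraticListKey 3000 (by decide +kernel)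
  · exact key [⟨0, 2⟩, ⟨0, 4⟩, ⟨6, 0⟩, ⟨3, 0⟩] rfl (by decide)
      (List.replicate 6 [0, 1, 2, 3]).flatten
      (by decide +kernel) quadraticListKey 3000 (by decide +kernel)
  · exact key [⟨0, 1⟩, ⟨0, 2⟩, ⟨3, 0⟩, ⟨2, 0⟩] rfl (by decide)
      (List.replicate 6 [0, 1, 2, 3]).flatten
      (by decide +kernel) quadraticListKey 3000 (by decide +kernel)

/-- The maximal parabolic subgroup is trivial, so the product is a single element. -/
theorem not_isProductOfThreeConjugates_A₁ (cs : CoxeterSystem (CoxeterMatrix.A 1) W) (i : Fin 1) :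
    ¬ IsProductOfThreeConjugates (cs.standardParabolic {i}ᶜ) := by
  have hi : ({i}ᶜ : Set (Fin 1)) = ∅ := by
    ext j
    simp [Subsingleton.elim j i]
  intro h
  obtain ⟨g, k, h⟩ := h.exists_forall
  refine cs.standardParabolic_ne_top (I := {i}ᶜ) (i := i) (by simp) ?_
  rw [hi, standardParabolic_empty] at h ⊢
  simp only [Subgroup.mem_bot, exists_eq_left, one_mul, mul_one] at h
  rw [eq_comm, Subgroup.eq_bot_iff_forall]
  exact fun w _ => (h w).trans (h 1).symm

theorem mem_standardParabolic_fin_two {N : CoxeterMatrix (Fin 2)} (cs : CoxeterSystem N W)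
    (i : Fin 2) {a : W} (ha : a ∈ cs.standardParabolic {i}ᶜ) :
    a = 1 ∨ a = cs.simple (1 - i) := by
  have hi : ({i}ᶜ : Set (Fin 2)) = {1 - i} := by
    ext j
    fin_cases i <;> fin_cases j <;> simp
  rw [hi, standardParabolic, Set.image_singleton, ← Subgroup.zpowers_eq_closure] at ha
  obtain ⟨k, rfl⟩ := Subgroup.mem_zpowers_iff.mp ha
  rcases Int.even_or_odd' k with ⟨m, rfl | rfl⟩
  · left
    rw [zpow_mul]
    simp
  · right
    rw [zpow_add, zpow_mul]
    simp

/-- Counting does not suffice, as the group has order `8 = 2³`. Since the label `4` is even, the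
character that is `-1` on `s i` and `1` on the other generator exists; it would be constant on `A g
A k A`. -/
theorem not_isProductOfThreeConjugates_B₂ (cs : CoxeterSystem (CoxeterMatrix.B 2) W) (i : Fin 2) :
    ¬ IsProductOfThreeConjugates (cs.standardParabolic {i}ᶜ) := by
  intro h
  obtain ⟨g, k, h⟩ := h.exists_forall
  have hlift : (CoxeterMatrix.B 2).IsLiftable (fun j => if j = i then (-1 : ℤˣ) else 1) := by
    have : ∀ i j k : Fin 2, ((if j = i then (-1 : ℤˣ) else 1) * (if k = i then (-1 : ℤˣ) else 1)) ^
        (CoxeterMatrix.B 2).entry j k = 1 := by decide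
    exact this i
  let χ : W →* ℤˣ := cs.lift ⟨_, hlift⟩
  have hχ : ∀ j, χ (cs.simple j) = if j = i then (-1 : ℤˣ) else 1 := fun j =>
    cs.lift_apply_simple hlift j
  have hχA : ∀ a ∈ cs.standardParabolic {i}ᶜ, χ a = 1 := by
    intro a ha
    rcases cs.mem_standardParabolic_fin_two i ha with rfl | rfl
    · exact map_one χ
    · rw [hχ, if_neg (by fin_cases i <;> decide)]
  have key : ∀ w, χ w = χ (g * k) := by
    intro w
    obtain ⟨a, ha, b, hb, c, hc, rfl⟩ := h w
    simp only [map_mul, hχA a ha, hχA b hb, hχA c hc, one_mul, mul_one]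
  have h1 := key (cs.simple i)
  rw [← key 1, hχ, if_pos rfl, map_one] at h1
  exact absurd h1 (by decide)

/-- A maximal parabolic subgroup has at most two elements, so the product has at most eight, whereas
the group maps onto a dihedral group of order `2m > 8`. -/
theorem not_isProductOfThreeConjugates_I₂ {m : ℕ} (hm : 4 < m)
    (cs : CoxeterSystem (CoxeterMatrix.typeI₂ m) W) (i : Fin 2) :
    ¬ IsProductOfThreeConjugates (cs.standardParabolic {i}ᶜ) := by
  have : NeZero m := ⟨by omega⟩
  intro h
  obtain ⟨g, k, h⟩ := h.exists_forall
  have hlift : (CoxeterMatrix.typeI₂ m).IsLiftable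
      (fun j : Fin 2 => (DihedralGroup.sr (j.val : ZMod m))) := by
    intro j l
    rcases eq_or_ne j l with rfl | hjl
    · rw [CoxeterMatrix.diagonal, pow_one, DihedralGroup.sr_mul_self]
    · have : (CoxeterMatrix.typeI₂ m) j l = m := by
        simp [CoxeterMatrix.typeI₂, CoxeterMatrix.I, hjl]
        omega
      rw [this, DihedralGroup.sr_mul_sr, DihedralGroup.r_pow]
      simp
  let χ : W →* DihedralGroup m := cs.lift ⟨_, hlift⟩
  have hχ : ∀ j : Fin 2, χ (cs.simple j) = DihedralGroup.sr (j.val : ZMod m) := fun j =>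
    cs.lift_apply_simple hlift j
  have hsurj : Function.Surjective χ := by
    have hr : ∀ l : ℕ, DihedralGroup.r (l : ZMod m) = χ ((cs.simple 0 * cs.simple 1) ^ l) := by
      intro l
      rw [map_pow, map_mul, hχ, hχ, DihedralGroup.sr_mul_sr]
      simp
    rintro (l | l)
    · refine ⟨_, ((hr l.val).symm.trans ?_)⟩
      rw [ZMod.natCast_zmod_val]
    · refine ⟨cs.simple 0 * (cs.simple 0 * cs.simple 1) ^ l.val, ?_⟩
      rw [map_mul, ← hr, hχ, DihedralGroup.sr_mul_r]
      simp
  let f : Bool × Bool × Bool → DihedralGroup m := fun p =>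
    let s : Bool → W := fun b => bif b then cs.simple (1 - i) else 1
    χ (s p.1 * g * s p.2.1 * k * s p.2.2)
  have hA : ∀ a ∈ cs.standardParabolic {i}ᶜ,
      ∃ b : Bool, a = bif b then cs.simple (1 - i) else 1 := by
    intro a ha
    rcases cs.mem_standardParabolic_fin_two i ha with rfl | rfl
    · exact ⟨false, rfl⟩
    · exact ⟨true, rfl⟩
  have hf : Function.Surjective f := by
    intro x
    obtain ⟨w, rfl⟩ := hsurj x
    obtain ⟨a, ha, b, hb, c, hc, rfl⟩ := h w
    obtain ⟨p, rfl⟩ := hA a ha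
    obtain ⟨q, rfl⟩ := hA b hb
    obtain ⟨r, rfl⟩ := hA c hc
    exact ⟨(p, q, r), rfl⟩
  have hcard := Fintype.card_le_of_surjective f hf
  rw [DihedralGroup.card] at hcard
  simp at hcard
  omega

variable {B : Type*} {M : CoxeterMatrix B} (cs : CoxeterSystem M W)

theorem not_exists_isParabolic_of_isRemainingType (h : M.IsRemainingType) :
    ¬ ∃ P : Subgroup W, cs.IsParabolic P ∧ P ≠ ⊤ ∧ IsProductOfThreeConjugates P := by
  rcases h with h | h | h | h | ⟨m, hm, h⟩
  · exact cs.not_exists_isParabolic_of_isOfType h not_isProductOfThreeConjugates_A₁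
  · exact cs.not_exists_isParabolic_of_isOfType h not_isProductOfThreeConjugates_B₂
  · exact cs.not_exists_isParabolic_of_isOfType h not_isProductOfThreeConjugates_F₄
  · exact cs.not_exists_isParabolic_of_isOfType h not_isProductOfThreeConjugates_H₃
  · exact cs.not_exists_isParabolic_of_isOfType h (not_isProductOfThreeConjugates_I₂ hm)

theorem hasFactorization_of_isFactorizableType [Finite W] (h : M.IsFactorizableType) :
    cs.HasFactorization := by
  rcases h with ⟨n, hn, h⟩ | ⟨n, hn, h⟩ | ⟨n, hn, h⟩ | h | h | h | h
  · exact cs.hasFactorization_of_isOfType h (hasFactorization_A hn)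
  · exact cs.hasFactorization_of_isOfType h (hasFactorization_B hn)
  · exact cs.hasFactorization_of_isOfType h (hasFactorization_D hn)
  · exact cs.hasFactorization_of_isOfType h hasFactorization_H₄
  · exact cs.hasFactorization_of_isOfType h hasFactorization_E₆
  · exact cs.hasFactorization_of_isOfType h hasFactorization_E₇
  · exact cs.hasFactorization_of_isOfType h hasFactorization_E₈

end CoxeterSystem

/-- By the classification a type that is not factorizable is a remaining one, so the forward
implication follows from the exclusion of the remaining types. -/
theorem theorem1p10 {B W : Type*} [Finite B] [Group W] [Finite W] {M : CoxeterMatrix B}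
    (cs : CoxeterSystem M W) (hM : M.IsIrreducible) :
    ((∃ P : Subgroup W, cs.IsParabolic P ∧ P ≠ ⊤ ∧ IsProductOfThreeConjugates P) ↔
      M.IsFactorizableType) ∧
    (M.IsRemainingType →
      ¬ ∃ P : Subgroup W, cs.IsParabolic P ∧ P ≠ ⊤ ∧ IsProductOfThreeConjugates P) := by
  refine ⟨⟨fun h => ?_, fun h => ?_⟩, cs.not_exists_isParabolic_of_isRemainingType⟩
  · exact (cs.isFactorizableType_or_isRemainingType hM).resolve_right fun h' =>
      cs.not_exists_isParabolic_of_isRemainingType h' h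
  · exact (cs.hasFactorization_of_isFactorizableType h).exists_isParabolic
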